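/- Let $T>0$, let $\mathrm V$ be a real Banach space, $\ell$ a non-negative integer, $2\le p<3$, $\gamma\in(0,1]$ with $2+\gamma>p$, and $\varpi(d)=d^{(2+\gamma)/p}$. Let $\omega$ be a control on $[0,T]$: $\omega_{s,t}\ge 0$ for $0\le s\le t\le T$, $\omega_{r,s}+\omega_{s,t}\le\omega_{r,t}$ for $r\le s\le t$, $\omega_{s,s}=0$, and $\omega$ is continuous at the diagonal. Let $\mathbf x$ be a weak geometric $p$-rough path over $\mathbb R^\ell$ controlled by $\omega$: reals $x^i_{s,t},x^{i,j}_{s,t}$ ($0\le s\le t\le T$) with $x^i_{r,t}=x^i_{r,s}+x^i_{s,t}$, $x^{i,j}_{r,t}=x^{i,j}_{r,s}+x^i_{r,s}x^j_{s,t}+x^{i,j}_{s,t}$, $x^{i,j}_{s,t}+x^{j,i}_{s,t}=x^i_{s,t}x^j_{s,t}$, and $|x^i_{s,t}|\le K\omega_{s,t}^{1/p}$, $|x^{i,j}_{s,t}|\le K\omega_{s,t}^{2/p}$ for a constant $K$. Let $f_1,\dots,f_\ell:\mathrm V\to\mathrm V$ be of class $\mathcal C^{2+\gamma}_b$ ($C^2$,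 bounded with bounded derivatives up to order 2, and $\gamma$-Hölder second derivative), and write $[f_i,f_j]=\mathrm df_j\cdot f_i-\mathrm df_i\cdot f_j$. For $s\le t$ and $a\in\mathrm V$ let $\alpha\in[0,1]\mapsto y_{s,t}(\alpha,a)$ be the solution of $$y_{s,t}(\alpha,a)=a+\int_0^\alpha\Big(\sum_i x^i_{s,t}f_i+\tfrac12\sum_{i,j}x^{i,j}_{s,t}[f_i,f_j]\Big)(y_{s,t}(\beta,a))\,\mathrm d\beta,$$ let $\chi_{t,s}(a)=y_{s,t}(1,a)$ (Bailleul's almost flow), and let $\phi_{t,s}(a)=a+\sum_i x^i_{s,t}f_i(a)+\sum_{i,j}x^{i,j}_{s,t}\,\mathrm df_j(a)f_i(a)$ (Davie's almost flow). *Definitions.* Below, $\delta$ is a non-negative, non-decreasing function on $[0,\infty)$ with $\delta_S\to0$ as $S\to0$, and $\eta$ is a non-negative, continuous, increasing function on $[0,\infty)$ with $\eta(\omega_{s,t})\varpi(\omega_{s,t})^\gamma\le\delta_S\varpi(\omega_{s,t})$ for $0\le s\le t\le S\le T$, $S>0$. A family of continuous maps $\zeta_{t,s}:\mathrm V\to\mathrm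 V$, $0\le s\le t\le T$, is an *almost flow* if for some such $\delta,\eta$ and some $M\ge0$, for every $0<S\le T$, all $0\le r\le s\le t\le S$ and all $a,b$: $\zeta_{t,t}=\mathrm{id}$, $|\zeta_{t,s}(a)-a|\le\delta_S$, $|\zeta_{t,s}(b)-\zeta_{t,s}(a)|\le(1+\delta_S)|b-a|+\eta(\omega_{s,t})|b-a|^\gamma$ and $|\zeta_{t,s}(\zeta_{s,r}(a))-\zeta_{t,r}(a)|\le M\varpi(\omega_{r,t})$. A family of continuous maps $\epsilon_{t,s}$ is a *perturbation* if for some such $\delta,\eta$ and some $C\ge0$, likewise: $\epsilon_{t,t}=0$, $|\epsilon_{t,s}(a)|\le C\varpi(\omega_{s,t})$ and $|\epsilon_{t,s}(b)-\epsilon_{t,s}(a)|\le\delta_S|b-a|+\eta(\omega_{s,t})|b-a|^\gamma$. Two families are in the same *galaxy* if their difference at $(t,s)$ is bounded by $C\varpi(\omega_{s,t})$ uniformly on $\mathrm V$. A *semi-flow* is a family with $\psi_{t,t}=\mathrm{id}$ and $\psi_{t,s}\circ\psi_{s,r}=\psi_{t,r}$ for $r\le s\le t$ in $[0,T]$; it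 is a *flow* if it is indexed by all $s,t\in[0,T]$, the same rule holds for $r\ge s\ge t$, and $\psi_{s,t}=\psi_{t,s}^{-1}$. For a partition $\pi$ of $[0,T]$ the iterated product $\zeta^\pi_{t,s}$ is $\zeta_{t,t_j}\circ\zeta_{t_j,t_{j-1}}\circ\dots\circ\zeta_{t_i,s}$, where $t_i<\dots<t_j$ are the points of $\pi$ in $[s,t]$ (and $\zeta_{t,s}$ if there are none); $\zeta^\pi$ converges to $\psi$ if $\sup_{s\le t,\,a}|\zeta^\pi_{t,s}(a)-\psi_{t,s}(a)|\to0$ as the mesh of $\pi$ tends to $0$. A *manifold of solutions* to $\dot y=\zeta'(y)$ is a family of paths $y_{r\curvearrowright\cdot}(a):[r,T]\to\mathrm V$, $r\in[0,T]$, $a\in\mathrm V$, with $y_{r\curvearrowright r}(a)=a$ and, for some constant $C$ (depending on $r,a$), $|y_{r\curvearrowright t}(a)-\zeta_{t,s}(y_{r\curvearrowright s}(a))|\le C\varpi(\omega_{s,t})$ for $r\le s\le t\le T$; it is *Lipschitz* if the paths are continuous and $a\mapsto y_{r\curvearrowright\cdot}(a)$ is Lipschitz for the sup-norm, uniformly in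 $r$. **Proposition.** The equation for $y_{s,t}(\cdot,a)$ has exactly one continuous solution on $[0,1]$. Moreover: 1. $\chi$ and $\phi$ are almost flows, and $\chi-\phi$ is a perturbation. 2. There is a flow $\psi$ (Davie's flow), Lipschitz uniformly in $s,t\in[0,T]$, which lies in the galaxy of $\phi$, agrees on $\{s\le t\}$ with every semi-flow of that galaxy, and to which $\phi^\pi$ converges; and $\chi^\pi$ converges to the same $\psi$. 3. $y_{r\curvearrowright t}(a)=\psi_{t,r}(a)$ is a Lipschitz manifold of solutions to $\dot y=\chi'(y)$, and it is the only manifold of solutions to $\dot y=\chi'(y)$. -/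

import Mathlib

open Set Filter Topology

noncomputable section

/-! Times live in `[0, T]`. A family `φ` of maps is written `φ t s`, with `s ≤ t`, as in `φ_{t,s}`;
a control or a rough path is written with its times in increasing order, as in `ω_{s,t}`. -/

/-- A control on `[0, T]`: a nonnegative super-additive function on `{s ≤ t}`, vanishing on the
diagonal and continuous there. -/
structure IsControl (T : ℝ) (ω : ℝ → ℝ → ℝ) : Prop where
  nonneg : ∀ s t, 0 ≤ s → s ≤ t → t ≤ T → 0 ≤ ω s t
  superadditive : ∀ r s t, 0 ≤ r → r ≤ s → s ≤ t → t ≤ T → ω r s + ω s t ≤ ω r t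
  diag : ∀ s, 0 ≤ s → s ≤ T → ω s s = 0
  continuous_diag : ∀ s, 0 ≤ s → s ≤ T →
    ContinuousWithinAt (fun q : ℝ × ℝ => ω q.1 q.2)
      {q : ℝ × ℝ | 0 ≤ q.1 ∧ q.1 ≤ q.2 ∧ q.2 ≤ T} (s, s)

/-- The remainder function `ϖ(d) = d ^ ((2 + γ) / p)`. -/
def remainderFn (p γ : ℝ) : ℝ → ℝ := fun d => d ^ ((2 + γ) / p)

/-- The function `T ↦ δ_T`: nonnegative, non-decreasing, with limit `0` as `T → 0`. -/
structure IsVanishing (δ : ℝ → ℝ) : Prop where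
  nonneg : ∀ S, 0 ≤ S → 0 ≤ δ S
  monotone : MonotoneOn δ (Ici 0)
  tendsto_zero : Tendsto δ (𝓝[>] 0) (𝓝 0)

/-- The function `η`: nonnegative, continuous, increasing on `[0, ∞)`, and such that
`η(ω_{s,t}) ϖ(ω_{s,t})^γ ≤ δ_S ϖ(ω_{s,t})` for `0 ≤ s ≤ t ≤ S` and every horizon `S ≤ T`. -/
structure IsModulus (T : ℝ) (ω : ℝ → ℝ → ℝ) (ϖ : ℝ → ℝ) (γ : ℝ) (δ η : ℝ → ℝ) : Prop where
  nonneg : ∀ d, 0 ≤ d → 0 ≤ η d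
  continuousOn : ContinuousOn η (Ici 0)
  strictMono : StrictMonoOn η (Ici 0)
  bound : ∀ S, 0 < S → S ≤ T → ∀ s t, 0 ≤ s → s ≤ t → t ≤ S →
    η (ω s t) * ϖ (ω s t) ^ γ ≤ δ S * ϖ (ω s t)

variable {E : Type*} [NormedAddCommGroup E] [NormedSpace ℝ E]

/-- Functions of class `C_b^{r+γ}`: of class `C^r`, bounded together with their derivatives up to
order `r`, with a `γ`-Hölder derivative of order `r` (Lipschitz if `γ = 1`). -/
structure IsCbHolder (r : ℕ) (γ : ℝ) (g : E → E) : Prop where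
  contDiff : ContDiff ℝ r g
  bounded : ∀ k ≤ r, ∃ C, ∀ a, ‖iteratedFDeriv ℝ k g a‖ ≤ C
  holder : ∃ C, ∀ a b, ‖iteratedFDeriv ℝ r g a - iteratedFDeriv ℝ r g b‖ ≤ C * ‖a - b‖ ^ γ

/-- Almost flows on `[0, T]`; the constants `δ_S` refer to all the horizons `S ∈ (0, T]`. -/
def IsAlmostFlow (T : ℝ) (ω : ℝ → ℝ → ℝ) (ϖ : ℝ → ℝ) (γ : ℝ) (φ : ℝ → ℝ → E → E) : Prop :=
  (∀ s t, 0 ≤ s → s ≤ t → t ≤ T → Continuous (φ t s)) ∧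
  ∃ (δ η : ℝ → ℝ) (M : ℝ), IsVanishing δ ∧ IsModulus T ω ϖ γ δ η ∧ 0 ≤ M ∧
    ∀ S, 0 < S → S ≤ T →
      (∀ t, 0 ≤ t → t ≤ S → ∀ a, φ t t a = a) ∧
      (∀ s t, 0 ≤ s → s ≤ t → t ≤ S → ∀ a, ‖φ t s a - a‖ ≤ δ S) ∧
      (∀ s t, 0 ≤ s → s ≤ t → t ≤ S → ∀ a b,
        ‖φ t s b - φ t s a‖ ≤ (1 + δ S) * ‖b - a‖ + η (ω s t) * ‖b - a‖ ^ γ) ∧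
      (∀ r s t, 0 ≤ r → r ≤ s → s ≤ t → t ≤ S → ∀ a,
        ‖φ t s (φ s r a) - φ t r a‖ ≤ M * ϖ (ω r t))

/-- Perturbations on `[0, T]`. -/
def IsPerturbation (T : ℝ) (ω : ℝ → ℝ → ℝ) (ϖ : ℝ → ℝ) (γ : ℝ) (ε : ℝ → ℝ → E → E) : Prop :=
  (∀ s t, 0 ≤ s → s ≤ t → t ≤ T → Continuous (ε t s)) ∧
  ∃ (δ η : ℝ → ℝ) (C : ℝ), IsVanishing δ ∧ IsModulus T ω ϖ γ δ η ∧ 0 ≤ C ∧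
    ∀ S, 0 < S → S ≤ T →
      (∀ t, 0 ≤ t → t ≤ S → ∀ a, ε t t a = 0) ∧
      (∀ s t, 0 ≤ s → s ≤ t → t ≤ S → ∀ a, ‖ε t s a‖ ≤ C * ϖ (ω s t)) ∧
      (∀ s t, 0 ≤ s → s ≤ t → t ≤ S → ∀ a b,
        ‖ε t s b - ε t s a‖ ≤ δ S * ‖b - a‖ + η (ω s t) * ‖b - a‖ ^ γ)

/-- Two families are in the same galaxy: they are at distance `O(ϖ(ω_{s,t}))` in sup-norm. -/
def SameGalaxy (T : ℝ) (ω : ℝ → ℝ → ℝ) (ϖ : ℝ → ℝ) (φ ψ : ℝ → ℝ → E → E) : Prop :=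
  ∃ C, ∀ s t, 0 ≤ s → s ≤ t → t ≤ T → ∀ a, ‖φ t s a - ψ t s a‖ ≤ C * ϖ (ω s t)

/-- Semi-flows on `[0, T]`. -/
def IsSemiFlow (T : ℝ) (ψ : ℝ → ℝ → E → E) : Prop :=
  (∀ t, 0 ≤ t → t ≤ T → ∀ a, ψ t t a = a) ∧
  ∀ r s t, 0 ≤ r → r ≤ s → s ≤ t → t ≤ T → ∀ a, ψ t s (ψ s r a) = ψ t r a

/-- Flows on `[0, T]`: the maps are invertible, with `ψ_{t,s}⁻¹ = ψ_{s,t}`, and the composition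
rule holds for increasing and for decreasing triples of times. -/
def IsFlow (T : ℝ) (ψ : ℝ → ℝ → E → E) : Prop :=
  IsSemiFlow T ψ ∧
  (∀ r s t, 0 ≤ t → t ≤ s → s ≤ r → r ≤ T → ∀ a, ψ t s (ψ s r a) = ψ t r a) ∧
  ∀ s t, 0 ≤ s → s ≤ t → t ≤ T →
    Function.LeftInverse (ψ s t) (ψ t s) ∧ Function.RightInverse (ψ s t) (ψ t s)

/-- The maps `ψ_{t,s}`, `s, t ∈ [0, T]`, are uniformly Lipschitz continuous. -/
def IsLipschitzFamily (T : ℝ) (ψ : ℝ → ℝ → E → E) : Prop :=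
  ∃ L, ∀ s ∈ Icc 0 T, ∀ t ∈ Icc 0 T, ∀ a b, ‖ψ t s a - ψ t s b‖ ≤ L * ‖a - b‖

/-- Partitions of `[0, T]`, as the finite sets of their points. -/
def IsPartition (T : ℝ) (π : Finset ℝ) : Prop :=
  0 ∈ π ∧ T ∈ π ∧ ∀ u ∈ π, 0 ≤ u ∧ u ≤ T

/-- The mesh of `π` is at most `h`: successive points are at distance at most `h`. -/
def MeshLE (π : Finset ℝ) (h : ℝ) : Prop :=
  ∀ u ∈ π, ∀ v ∈ π, u < v → (∀ w ∈ π, w ≤ u ∨ v ≤ w) → v - u ≤ h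

/-- `compAlong φ [u₁, …, uₖ] s t = φ_{t,uₖ} ∘ ⋯ ∘ φ_{u₂,u₁} ∘ φ_{u₁,s}`. -/
def compAlong (φ : ℝ → ℝ → E → E) : List ℝ → ℝ → ℝ → E → E
  | [], s, t => φ t s
  | u :: l, s, t => fun a => compAlong φ l u t (φ u s a)

/-- The iterated product `φ^π_{t,s}`: composition through all the points of `π` in `[s, t]`, and
`φ_{t,s}` if there is none. -/
def iteratedProduct (φ : ℝ → ℝ → E → E) (π : Finset ℝ) (t s : ℝ) : E → E :=
  compAlong φ ((π.filter (fun u => s ≤ u ∧ u ≤ t)).sort (· ≤ ·)) s t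

/-- `φ^π` converges to `ψ` as the mesh of `π` goes to `0`, in the sup-norm, uniformly in time. -/
def IteratedProductsConverge (T : ℝ) (φ ψ : ℝ → ℝ → E → E) : Prop :=
  ∀ ε > 0, ∃ h > 0, ∀ π : Finset ℝ, IsPartition T π → MeshLE π h →
    ∀ s t, 0 ≤ s → s ≤ t → t ≤ T → ∀ a, ‖iteratedProduct φ π t s a - ψ t s a‖ ≤ ε

/-- `y r t a` is the value at time `t` of the solution that starts from `a` at time `r`.
Each `t ↦ y r t a` is a solution in the sense of Davie of `ẏ = φ'(y)` on `[r, T]`. -/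
def IsManifoldOfSolutions (T : ℝ) (ω : ℝ → ℝ → ℝ) (ϖ : ℝ → ℝ) (φ : ℝ → ℝ → E → E)
    (y : ℝ → ℝ → E → E) : Prop :=
  ∀ r, 0 ≤ r → r ≤ T → ∀ a, y r r a = a ∧
    ∃ C, ∀ s t, r ≤ s → s ≤ t → t ≤ T → ‖y r t a - φ t s (y r s a)‖ ≤ C * ϖ (ω s t)

/-- A manifold of solutions is Lipschitz if `a ↦ y r · a` is Lipschitz continuous from `E` to
`C([r, T], E)` with the sup-norm, uniformly in `r`. -/
def IsLipschitzManifold (T : ℝ) (y : ℝ → ℝ → E → E) : Prop :=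
  (∀ r, 0 ≤ r → r ≤ T → ∀ a, ContinuousOn (fun t => y r t a) (Icc r T)) ∧
  ∃ L, ∀ r, 0 ≤ r → r ≤ T → ∀ a b, ∀ t ∈ Icc r T, ‖y r t a - y r t b‖ ≤ L * ‖a - b‖

variable {l : ℕ}

/-- Weak geometric `p`-rough paths over `ℝ^l` (for `2 ≤ p < 3`) controlled by `ω`, through the
coordinates `x1 s t i` and `x2 s t i j` of the levels 1 and 2 of the increments over `[s, t]`. -/
structure IsWeakGeometricRoughPath (T : ℝ) (ω : ℝ → ℝ → ℝ) (p : ℝ)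
    (x1 : ℝ → ℝ → Fin l → ℝ) (x2 : ℝ → ℝ → Fin l → Fin l → ℝ) : Prop where
  chen1 : ∀ r s t, 0 ≤ r → r ≤ s → s ≤ t → t ≤ T → ∀ i, x1 r t i = x1 r s i + x1 s t i
  chen2 : ∀ r s t, 0 ≤ r → r ≤ s → s ≤ t → t ≤ T → ∀ i j,
    x2 r t i j = x2 r s i j + x1 r s i * x1 s t j + x2 s t i j
  geometric : ∀ s t, 0 ≤ s → s ≤ t → t ≤ T → ∀ i j,
    x2 s t i j + x2 s t j i = x1 s t i * x1 s t j
  bounded1 : ∃ K, ∀ s t, 0 ≤ s → s ≤ t → t ≤ T → ∀ i, |x1 s t i| ≤ K * ω s t ^ (1 / p)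
  bounded2 : ∃ K, ∀ s t, 0 ≤ s → s ≤ t → t ≤ T → ∀ i j, |x2 s t i j| ≤ K * ω s t ^ (2 / p)

/-- Davie's almost flow. A vector field `g` acts on functions by `g F (a) = dF(a) (g a)`, so that
`f_i f_j` applied to the identity map is `a ↦ df_j(a) (f_i a)`. -/
def davieAlmostFlow (f : Fin l → E → E) (x1 : ℝ → ℝ → Fin l → ℝ)
    (x2 : ℝ → ℝ → Fin l → Fin l → ℝ) (t s : ℝ) (a : E) : E :=
  a + ∑ i, x1 s t i • f i a + ∑ i, ∑ j, x2 s t i j • fderiv ℝ (f j) a (f i a)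

/-- The vector field `∑ x^i f_i + 1/2 ∑ x^{i,j} [f_i, f_j]`, where
`[g, h](b) = dh(b) (g b) - dg(b) (h b)`. -/
def logField (f : Fin l → E → E) (x1 : ℝ → ℝ → Fin l → ℝ)
    (x2 : ℝ → ℝ → Fin l → Fin l → ℝ) (s t : ℝ) (b : E) : E :=
  ∑ i, x1 s t i • f i b +
    (1 / 2 : ℝ) • ∑ i, ∑ j, x2 s t i j • VectorField.lieBracket ℝ (f i) (f j) b

/-- `y` solves on `[0, 1]` the autonomous ODE driven by `logField` and starting from `a`. -/
def IsLogODESolution (f : Fin l → E → E) (x1 : ℝ → ℝ → Fin l → ℝ)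
    (x2 : ℝ → ℝ → Fin l → Fin l → ℝ) (s t : ℝ) (a : E) (y : ℝ → E) : Prop :=
  ContinuousOn y (Icc 0 1) ∧
    ∀ α ∈ Icc (0 : ℝ) 1, y α = a + ∫ β in (0 : ℝ)..α, logField f x1 x2 s t (y β)

/-- Bailleul's almost flow: the value at time `1` of the solution of the ODE. -/
def bailleulAlmostFlow (f : Fin l → E → E) (x1 : ℝ → ℝ → Fin l → ℝ)
    (x2 : ℝ → ℝ → Fin l → Fin l → ℝ) (t s : ℝ) (a : E) : E :=
  Classical.epsilon (IsLogODESolution f x1 x2 s t a) 1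

/-- `ψ` is Davie's flow: the Lipschitz flow which is the only (semi-)flow in the galaxy of Davie's
almost flow `φ`, and the limit of the iterated products of `φ`. -/
structure IsDavieFlow (T : ℝ) (ω : ℝ → ℝ → ℝ) (ϖ : ℝ → ℝ) (f : Fin l → E → E)
    (x1 : ℝ → ℝ → Fin l → ℝ) (x2 : ℝ → ℝ → Fin l → Fin l → ℝ) (ψ : ℝ → ℝ → E → E) : Prop where
  isFlow : IsFlow T ψ
  lipschitz : IsLipschitzFamily T ψ
  galaxy : SameGalaxy T ω ϖ (davieAlmostFlow f x1 x2) ψ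
  unique : ∀ ψ' : ℝ → ℝ → E → E, IsSemiFlow T ψ' →
    SameGalaxy T ω ϖ (davieAlmostFlow f x1 x2) ψ' →
    ∀ s t, 0 ≤ s → s ≤ t → t ≤ T → ψ' t s = ψ t s
  limit : IteratedProductsConverge T (davieAlmostFlow f x1 x2) ψ

end

/-! Write w = ω^{1/p}. Davie's map φ is explicit, and Chen's relation cancels the first and second
order terms of its failure to compose. What is left are Taylor remainders of order w^{2+γ} = ϖ(ω),
both for the map and for its spatial derivative (`exists_defect_bound`,
`exists_isSmoothAlmostFlow_davie`).

The exponent (2+γ)/p exceeds 1, so an interval cut at half of its control leaves on each side a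
remainder divided by more than two. By induction on the number of factors, all products of φ along
chains of times stay within O(ϖ) of φ, with a constant independent of that number. Over short
intervals the same induction on derivatives keeps the products close to the identity in the
Lipschitz norm (`exists_local_bounds`). Cutting [0, T] into boundedly many short pieces then gives
one Lipschitz constant Λ for all products (`exists_global_bounds`).

With Λ available, the rest is telescoping. Let G be Λ-Lipschitz, compose at the points of a chain,
and be within Cϖ(ω) of another family on each step. Exchanging the factors one by one costs at most
ΛC ∑ ϖ(ω_{u,v}), which tends to 0 with the mesh because ϖ(d) = o(d) and ω is super-additive
(`norm_sub_compAlong_le`). If G is a product along a finer set of times, this is a Cauchy property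
and yields the limit ψ. If G = ψ, it gives convergence of the products of every family in the
galaxy. The version for paths (`IsSemiFlow.eq_of_path`) gives uniqueness of the semi-flow and of the
manifold of solutions. Over short intervals ψ - id is 1/2-Lipschitz, so ψ is a composition of
finitely many bijections with Lipschitz inverses and extends to a flow.

Bailleul's χ enters only through its galaxy. With F the drift field and Q the bracket field, the ODE
at time one expands as a + F + Q + (1/2) dF·F up to O(w³), and weak geometricity says that Q + (1/2)
dF·F is the second order term of φ. Hence χ - φ = O(ϖ), and χ inherits the defect bound of φ, the
limit ψ and the uniqueness of solutions. -/

namespace IsControl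

/-! ### Controls. -/

variable {T : ℝ} {ω : ℝ → ℝ → ℝ}

theorem mono (hω : IsControl T ω) {s' s t t' : ℝ} (h0 : 0 ≤ s') (h1 : s' ≤ s) (h2 : s ≤ t)
    (h3 : t ≤ t') (h4 : t' ≤ T) : ω s t ≤ ω s' t' := by
  have e1 := hω.superadditive s' s t h0 h1 h2 (h3.trans h4)
  have e2 := hω.superadditive s' t t' h0 (h1.trans h2) h3 h4
  have e3 := hω.nonneg s' s h0 h1 (h2.trans (h3.trans h4))
  have e4 := hω.nonneg t t' (h0.trans (h1.trans h2)) h3 h4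
  linarith

/-- A control is uniformly small near the diagonal. -/
theorem exists_forall_sub_le (hω : IsControl T ω) {ε : ℝ} (hε : 0 < ε) :
    ∃ h > 0, ∀ s t, 0 ≤ s → s ≤ t → t ≤ T → t - s ≤ h → ω s t ≤ ε := by
  have key : ∀ u : Icc (0 : ℝ) T, ∃ r > 0, ∀ s t, 0 ≤ s → s ≤ t → t ≤ T →
      s ∈ Metric.ball (u : ℝ) r → t ∈ Metric.ball (u : ℝ) r → ω s t ≤ ε := by
    rintro ⟨u, hu⟩
    obtain ⟨r, hr, h⟩ := Metric.continuousWithinAt_iff.1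
      (hω.continuous_diag u hu.1 hu.2) ε hε
    refine ⟨r, hr, fun s t hs hst ht hsr htr => ?_⟩
    have := h (x := (s, t)) ⟨hs, hst, ht⟩ (by
      rw [Prod.dist_eq]; exact max_lt hsr htr)
    simp only [hω.diag u hu.1 hu.2, Real.dist_eq, sub_zero] at this
    exact (le_abs_self _).trans this.le
  choose r hr h using key
  -- Continuity is known only at the points (u, u). A Lebesgue number of the cover of [0, T] by the
  -- corresponding balls makes it uniform.
  obtain ⟨δ, hδ, H⟩ := lebesgue_number_lemma_of_metric (s := Icc (0 : ℝ) T)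
    (c := fun u : Icc (0 : ℝ) T => Metric.ball (u : ℝ) (r u)) isCompact_Icc
    (fun u => Metric.isOpen_ball)
    (fun x hx => mem_iUnion.2 ⟨⟨x, hx⟩, Metric.mem_ball_self (hr _)⟩)
  refine ⟨δ / 2, by positivity, fun s t hs hst ht hd => ?_⟩
  obtain ⟨u, hu⟩ := H s ⟨hs, hst.trans ht⟩
  refine h u s t hs hst ht (hu (Metric.mem_ball_self hδ)) (hu ?_)
  rw [Metric.mem_ball, Real.dist_eq, abs_of_nonneg (by linarith)]
  linarith

end IsControl

/-! ### Chains of times and partitions. -/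

/-- `IsSteps R [u₁, …, uₖ] s t` says that `R` holds between successive points of
`s, u₁, …, uₖ, t`. -/
def IsSteps (R : ℝ → ℝ → Prop) : List ℝ → ℝ → ℝ → Prop
  | [], s, t => R s t
  | u :: l, s, t => R s u ∧ IsSteps R l u t

namespace IsSteps

/-- The bounds on ω hold only inside [0, T], so the implication is asked only between `a` and `b`;
the order of the endpoints comes along because the induction needs it to stay in that range. -/
theorem imp {R R' : ℝ → ℝ → Prop} {a b : ℝ}
    (h : ∀ u v, a ≤ u → u ≤ v → v ≤ b → R u v → R' u v) (hR : ∀ u v, R u v → u ≤ v) :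
    ∀ {l : List ℝ} {s t : ℝ}, a ≤ s → t ≤ b → IsSteps R l s t → s ≤ t ∧ IsSteps R' l s t := by
  intro l
  induction l with
  | nil => intro s t hs ht H; exact ⟨hR _ _ H, h s t hs (hR _ _ H) ht H⟩
  | cons u l ih =>
    intro s t hs ht H
    have hsu := hR _ _ H.1
    obtain ⟨hut, H'⟩ := ih (hs.trans hsu) ht H.2
    exact ⟨hsu.trans hut, h s u hs hsu (hut.trans ht) H.1, H'⟩

theorem le {l : List ℝ} {s t : ℝ} (h : IsSteps (· ≤ ·) l s t) : s ≤ t :=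
  (imp (R' := (· ≤ ·)) (fun _ _ _ _ _ h => h) (fun _ _ h => h) le_rfl le_rfl h).1

/-- Successive points of the sorted list of the points of `π` in `[s, t]` have no point of `π`
between them. -/
theorem of_pairwise {π : Finset ℝ} {R : ℝ → ℝ → Prop} {t b : ℝ}
    (hR : ∀ u v, b ≤ u → u ≤ v → v ≤ t → (∀ x ∈ π, x ≤ u ∨ v ≤ x) → R u v) :
    ∀ {l : List ℝ} {s : ℝ}, b ≤ s → s ≤ t → l.Pairwise (· ≤ ·) →
      (∀ x ∈ l, s ≤ x ∧ x ≤ t) → (∀ x ∈ π, s < x → x < t → x ∈ l) → IsSteps R l s t := by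
  intro l
  induction l with
  | nil =>
    intro s hb hst _ _ h
    refine hR s t hb hst le_rfl fun x hx => ?_
    by_contra! hc
    simpa using h x hx hc.1 hc.2
  | cons u l ih =>
    intro s hb hst hl hmem h
    rw [List.pairwise_cons] at hl
    have hu := hmem u (by simp)
    refine ⟨hR s u hb hu.1 hu.2 fun x hx => ?_, ih (hb.trans hu.1) hu.2 hl.2
      (fun x hx => ⟨hl.1 x hx, (hmem x (by simp [hx])).2⟩) fun x hx h1 h2 => ?_⟩
    · by_contra! hc
      rcases List.mem_cons.1 (h x hx hc.1 (hc.2.trans_le hu.2)) with rfl | hxl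
      · exact lt_irrefl _ hc.2
      · exact absurd (hl.1 x hxl) (not_le.2 hc.2)
    · rcases List.mem_cons.1 (h x hx (hu.1.trans_lt h1) h2) with rfl | hxl
      · exact absurd h1 (lt_irrefl _)
      · exact hxl

end IsSteps

/-- The endpoints u and v need not belong to π: the last point of π before u and the first one after
v are successive in π and enclose [u, v]. -/
theorem MeshLE.sub_le {T h : ℝ} {π : Finset ℝ} (hπ : IsPartition T π) (hm : MeshLE π h)
    {u v : ℝ} (hu : 0 ≤ u) (huv : u < v) (hv : v ≤ T) (hn : ∀ x ∈ π, x ≤ u ∨ v ≤ x) :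
    v - u ≤ h := by
  obtain ⟨a, ha, ha'⟩ := (π.filter (· ≤ u)).exists_max_image id
    ⟨0, Finset.mem_filter.2 ⟨hπ.1, hu⟩⟩
  obtain ⟨b, hb, hb'⟩ := (π.filter (v ≤ ·)).exists_min_image id
    ⟨T, Finset.mem_filter.2 ⟨hπ.2.1, hv⟩⟩
  simp only [Finset.mem_filter, id] at ha hb ha' hb'
  have := hm a ha.1 b hb.1 (by linarith) fun w hw => (hn w hw).imp
    (fun h => ha' w ⟨hw, h⟩) (fun h => hb' w ⟨hw, h⟩)
  linarith

/-- The sorted list of the points of `π` in `[s, t]`. -/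
noncomputable def pointsIn (π : Finset ℝ) (s t : ℝ) : List ℝ :=
  (π.filter (fun u => s ≤ u ∧ u ≤ t)).sort (· ≤ ·)

theorem mem_pointsIn {π : Finset ℝ} {s t x : ℝ} :
    x ∈ pointsIn π s t ↔ x ∈ π ∧ s ≤ x ∧ x ≤ t := by
  simp [pointsIn]

theorem length_pointsIn_le (π : Finset ℝ) (s t : ℝ) : (pointsIn π s t).length ≤ π.card := by
  rw [pointsIn, Finset.length_sort]
  exact Finset.card_filter_le _ _

theorem isSteps_pointsIn (π : Finset ℝ) {s t : ℝ} (hst : s ≤ t) {R : ℝ → ℝ → Prop}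
    (hR : ∀ u v, s ≤ u → u ≤ v → v ≤ t → (∀ x ∈ π, x ≤ u ∨ v ≤ x) → R u v) :
    IsSteps R (pointsIn π s t) s t :=
  IsSteps.of_pairwise hR le_rfl hst (Finset.pairwise_sort _ _)
    (fun _ hx => (mem_pointsIn.1 hx).2)
    (fun _ hx h1 h2 => mem_pointsIn.2 ⟨hx, h1.le, h2.le⟩)

theorem isSteps_pointsIn_of_meshLE {T h : ℝ} {π : Finset ℝ} (hπ : IsPartition T π)
    (hm : MeshLE π h) (hh : 0 ≤ h) {s t : ℝ} (hs : 0 ≤ s) (hst : s ≤ t) (ht : t ≤ T) :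
    IsSteps (fun u v => u ≤ v ∧ v - u ≤ h) (pointsIn π s t) s t := by
  refine isSteps_pointsIn π hst fun u v hu huv hv hn => ⟨huv, ?_⟩
  -- If s or t belongs to π, the chain has a step of length zero, to which the mesh condition does
  -- not apply.
  rcases huv.eq_or_lt with rfl | huv'
  · simpa using hh
  · exact hm.sub_le hπ (hs.trans hu) huv' (hv.trans ht) hn

/-- Partitions of `[0, T]` with arbitrarily small mesh. -/
theorem exists_isPartition_meshLE {T h : ℝ} (hT : 0 < T) (hh : 0 < h) :
    ∃ π : Finset ℝ, IsPartition T π ∧ MeshLE π h := by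
  obtain ⟨n, hn⟩ := exists_nat_gt (T / h)
  have hn0 : (0 : ℝ) < n := (by positivity : 0 < T / h).trans hn
  have hd : T / n ≤ h := by
    rw [div_le_iff₀ hn0]; rw [div_lt_iff₀ hh] at hn; linarith
  have hTn : 0 < T / n := by positivity
  refine ⟨(Finset.range (n + 1)).image (fun k : ℕ => (k : ℝ) * (T / n)), ⟨?_, ?_, ?_⟩, ?_⟩
  · exact Finset.mem_image.2 ⟨0, by simp, by simp⟩
  · exact Finset.mem_image.2 ⟨n, by simp, by field_simp⟩
  · intro u hu
    obtain ⟨k, hk, rfl⟩ := Finset.mem_image.1 hu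
    refine ⟨by positivity, ?_⟩
    have : (k : ℝ) ≤ n := by exact_mod_cast Nat.lt_succ_iff.1 (Finset.mem_range.1 hk)
    calc (k : ℝ) * (T / n) ≤ n * (T / n) := by gcongr
      _ = T := by field_simp
  · intro u hu v hv huv hc
    obtain ⟨i, hi, rfl⟩ := Finset.mem_image.1 hu
    obtain ⟨j, hj, rfl⟩ := Finset.mem_image.1 hv
    have hij : i < j := by
      have := lt_of_mul_lt_mul_right huv hTn.le
      exact_mod_cast this
    rcases hc (((i + 1 : ℕ) : ℝ) * (T / n)) (Finset.mem_image.2 ⟨i + 1, by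
      simp only [Finset.mem_range] at hj ⊢; omega, rfl⟩) with h1 | h1
    · push_cast at h1; linarith
    · push_cast at h1; linarith

/-! ### Products along chains. -/

section Comp

variable {E : Type*}

theorem compAlong_append (φ : ℝ → ℝ → E → E) (l₂ : List ℝ) (u t : ℝ) :
    ∀ (l₁ : List ℝ) (s : ℝ) (a : E),
      compAlong φ (l₁ ++ u :: l₂) s t a = compAlong φ l₂ u t (compAlong φ l₁ s u a)
  | [], _, _ => rfl
  | v :: l₁, _, a => compAlong_append φ l₂ u t l₁ v (φ v _ a)

theorem compAlong_append_singleton {φ : ℝ → ℝ → E → E} {t : ℝ} (h : ∀ a, φ t t a = a)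
    (l : List ℝ) (s : ℝ) (a : E) : compAlong φ (l ++ [t]) s t a = compAlong φ l s t a := by
  rw [compAlong_append]; exact h _

theorem compAlong_cons_self {φ : ℝ → ℝ → E → E} {s : ℝ} (h : ∀ a, φ s s a = a)
    (l : List ℝ) (t : ℝ) (a : E) : compAlong φ (s :: l) s t a = compAlong φ l s t a := by
  simp only [compAlong, h]

theorem iteratedProduct_eq (φ : ℝ → ℝ → E → E) (π : Finset ℝ) (t s : ℝ) :
    iteratedProduct φ π t s = compAlong φ (pointsIn π s t) s t := rfl

theorem iteratedProduct_self {φ : ℝ → ℝ → E → E} {t : ℝ} (h : ∀ a, φ t t a = a)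
    (π : Finset ℝ) (a : E) : iteratedProduct φ π t t a = a := by
  have : ∀ l : List ℝ, (∀ x ∈ l, x = t) → compAlong φ l t t a = a := by
    intro l
    induction l with
    | nil => intro _; exact h a
    | cons u l ih =>
      intro hl
      obtain rfl : u = t := hl u (by simp)
      rw [compAlong_cons_self h]
      exact ih fun x hx => hl x (by simp [hx])
  exact this _ fun x hx => le_antisymm (mem_pointsIn.1 hx).2.2 (mem_pointsIn.1 hx).2.1

/-- Iterated products along `π` compose at the points of `π`. -/
theorem iteratedProduct_comp {φ : ℝ → ℝ → E → E} {π : Finset ℝ} {s u t : ℝ} (hu : u ∈ π)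
    (hsu : s ≤ u) (hut : u ≤ t) (h : ∀ a, φ u u a = a) (a : E) :
    iteratedProduct φ π t u (iteratedProduct φ π u s a) = iteratedProduct φ π t s a := by
  simp only [iteratedProduct_eq]
  obtain ⟨A, B, hAB⟩ := List.append_of_mem (mem_pointsIn.2 ⟨hu, hsu, hut⟩)
  have hsort : (pointsIn π s t).Pairwise (· ≤ ·) := Finset.pairwise_sort _ _
  have hnd : (pointsIn π s t).Nodup := Finset.sort_nodup _ _
  have hmem : ∀ x, x ∈ A ++ u :: B ↔ x ∈ π ∧ s ≤ x ∧ x ≤ t := fun x => by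
    rw [← hAB, mem_pointsIn]
  rw [hAB] at hsort hnd
  rw [hAB, compAlong_append]
  have hp := hsort
  rw [List.pairwise_append, List.pairwise_cons] at hsort
  obtain ⟨hA, ⟨huB, hB⟩, hAuB⟩ := hsort
  -- A sorted list without repetition is determined by its entries, so only membership has to be
  -- compared.
  have eA : pointsIn π s u = A ++ [u] := by
    have hsub : (A ++ [u]).Sublist (A ++ u :: B) := by simp
    rw [← (List.toFinset_sort (· ≤ ·) (hnd.sublist hsub)).2 (hp.sublist hsub), pointsIn]
    congr 1
    ext x
    simp only [Finset.mem_filter, List.mem_toFinset, List.mem_append, List.mem_singleton]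
    constructor
    · rintro ⟨h1, h2, h3⟩
      rcases List.mem_append.1 ((hmem x).2 ⟨h1, h2, h3.trans hut⟩) with h4 | h4
      · exact Or.inl h4
      · rcases List.mem_cons.1 h4 with h5 | h5
        · exact Or.inr h5
        · exact Or.inr (le_antisymm h3 (huB x h5))
    · rintro (h1 | rfl)
      · have := (hmem x).1 (by simp [h1])
        exact ⟨this.1, this.2.1, hAuB x h1 u (by simp)⟩
      · exact ⟨hu, hsu, le_rfl⟩
  have eB : pointsIn π u t = u :: B := by
    have hsub : (u :: B).Sublist (A ++ u :: B) := by simp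
    rw [← (List.toFinset_sort (· ≤ ·) (hnd.sublist hsub)).2 (hp.sublist hsub), pointsIn]
    congr 1
    ext x
    simp only [Finset.mem_filter, List.mem_toFinset, List.mem_cons]
    constructor
    · rintro ⟨h1, h2, h3⟩
      rcases List.mem_append.1 ((hmem x).2 ⟨h1, hsu.trans h2, h3⟩) with h4 | h4
      · exact Or.inl (le_antisymm (hAuB x h4 u (by simp)) h2)
      · exact List.mem_cons.1 h4
    · rintro (rfl | h1)
      · exact ⟨hu, le_rfl, hut⟩
      · have := (hmem x).1 (by simp [h1])
        exact ⟨this.1, huB x h1, this.2.2⟩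
  -- The point u ends one list and starts the other; both extra factors φ u u are the identity.
  rw [eA, eB, compAlong_append_singleton h, compAlong_cons_self h]

/-- Splitting of a chain of times at the first step where `ω s₀ ·` passes the threshold `c`. -/
theorem exists_compAlong_split {T : ℝ} {ω : ℝ → ℝ → ℝ} {φ : ℝ → ℝ → E → E}
    (hid : ∀ t, 0 ≤ t → t ≤ T → ∀ a, φ t t a = a) {s₀ t c : ℝ} (ht : t ≤ T) :
    ∀ (l : List ℝ) (s : ℝ), 0 ≤ s → IsSteps (· ≤ ·) l s t → ω s₀ s ≤ c →
      ∃ v u l₁ l₂, IsSteps (· ≤ ·) l₁ s v ∧ v ≤ u ∧ IsSteps (· ≤ ·) l₂ u t ∧ ω s₀ v ≤ c ∧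
        (c < ω s₀ u ∨ u = t) ∧ l₁.length ≤ l.length - 1 ∧ l₂.length ≤ l.length - 1 ∧
        ∀ a, compAlong φ l s t a = compAlong φ l₂ u t (φ u v (compAlong φ l₁ s v a))
  | [], s, hs, hl, hc => ⟨s, t, [], [], le_rfl, hl, le_rfl, hc, Or.inr rfl, by simp, by simp,
      fun a => by simp only [compAlong]; rw [hid s hs (hl.trans ht), hid t (hs.trans hl) ht]⟩
  -- Recursion on the empty list would put w in `l₁` and break the strict decrease of the length;
  -- here w becomes v and the chain before it is empty.
  | [w], s, hs, hl, hc => by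
    have hsw : s ≤ w := hl.1
    have hwt : w ≤ t := hl.2
    by_cases h : ω s₀ w ≤ c
    · refine ⟨w, t, [], [], hsw, hwt, le_rfl, h, Or.inr rfl, by simp, by simp, fun a => ?_⟩
      simp only [compAlong]; rw [hid t (hs.trans (hsw.trans hwt)) ht]
    · refine ⟨s, w, [], [], le_rfl, hsw, hwt, hc, Or.inl (not_le.1 h), by simp, by simp,
        fun a => ?_⟩
      simp only [compAlong]; rw [hid s hs (hsw.trans (hwt.trans ht))]
  | w :: w' :: l, s, hs, hl, hc => by
    have hsw : s ≤ w := hl.1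
    have hwt : w ≤ t := hl.2.le
    by_cases h : ω s₀ w ≤ c
    · obtain ⟨v, u, l₁, l₂, h1, h2, h3, h4, h5, h6, h7, h8⟩ :=
        exists_compAlong_split hid ht (w' :: l) w (hs.trans hsw) hl.2 h
      refine ⟨v, u, w :: l₁, l₂, ⟨hsw, h1⟩, h2, h3, h4, h5, ?_, ?_, fun a => ?_⟩
      · simp only [List.length_cons] at h6 ⊢; omega
      · simp only [List.length_cons] at h7 ⊢; omega
      · exact h8 (φ w s a)
    · refine ⟨s, w, [], w' :: l, le_rfl, hsw, hl.2, hc, Or.inl (not_le.1 h), by simp, by simp,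
        fun a => ?_⟩
      simp only [compAlong]; rw [hid s hs (hsw.trans (hwt.trans ht))]

end Comp

/-! ### Telescoping against a Lipschitz family. -/

section Telescoping

variable {E : Type*} [NormedAddCommGroup E]

/-- A Lipschitz family that composes at the points of a chain is close to any product along the
chain whose factors are close to it. -/
theorem norm_sub_compAlong_le {T : ℝ} {ω : ℝ → ℝ → ℝ} (hω : IsControl T ω)
    {G φ : ℝ → ℝ → E → E} {Λ c : ℝ} (hΛ : 1 ≤ Λ) (hc : 0 ≤ c) {t : ℝ} (ht : t ≤ T)
    (hGt : ∀ s, 0 ≤ s → s ≤ t → ∀ a b, ‖G t s a - G t s b‖ ≤ Λ * ‖a - b‖) :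
    ∀ (l : List ℝ) (s : ℝ), 0 ≤ s →
      (∀ u ∈ l, ∀ r, 0 ≤ r → r ≤ u → ∀ a, G t u (G u r a) = G t r a) →
      IsSteps (fun u v => u ≤ v ∧ ∀ a, ‖G v u a - φ v u a‖ ≤ c * ω u v) l s t →
      ∀ a, ‖G t s a - compAlong φ l s t a‖ ≤ Λ * c * ω s t := by
  intro l
  induction l with
  | nil =>
    intro s hs _ hst a
    refine (hst.2 a).trans ?_
    have := hω.nonneg s t hs hst.1 ht
    nlinarith [mul_nonneg hc this]
  | cons u l ih =>
    intro s hs hG hst a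
    have hsu := hst.1.1
    have hut : u ≤ t := (IsSteps.imp (R' := (· ≤ ·)) (fun _ _ _ h _ _ => h) (fun _ _ h => h.1)
      le_rfl le_rfl hst.2).1
    have h1 := ih u (hs.trans hsu) (fun v hv => hG v (by simp [hv])) hst.2 (φ u s a)
    -- The error of a step is carried to time t by the single map G t u, so each error is multiplied
    -- by Λ once, and no power of Λ appears.
    have h2 : ‖G t s a - G t u (φ u s a)‖ ≤ Λ * (c * ω s u) := by
      rw [← hG u (by simp) s hs hsu a]
      refine (hGt u (hs.trans hsu) hut _ _).trans ?_
      gcongr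
      exact hst.1.2 a
    have h3 := hω.superadditive s u t hs hsu hut ht
    calc ‖G t s a - compAlong φ (u :: l) s t a‖
        ≤ ‖G t s a - G t u (φ u s a)‖ + ‖G t u (φ u s a) - compAlong φ l u t (φ u s a)‖ :=
          norm_sub_le_norm_sub_add_norm_sub _ _ _
      _ ≤ Λ * c * (ω s u + ω u t) := by linarith
      _ ≤ Λ * c * ω s t := by gcongr

/-- A path whose increments over the steps of a chain are close to those of a Lipschitz semi-flow
stays close to the semi-flow. -/
theorem norm_sub_path_le {T : ℝ} {ω : ℝ → ℝ → ℝ} (hω : IsControl T ω)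
    {G : ℝ → ℝ → E → E} {Λ c : ℝ} (hΛ : 1 ≤ Λ) (hc : 0 ≤ c) {t : ℝ} (ht : t ≤ T)
    (hGt : ∀ s, 0 ≤ s → s ≤ t → ∀ a b, ‖G t s a - G t s b‖ ≤ Λ * ‖a - b‖)
    (hG : ∀ r u, 0 ≤ r → r ≤ u → u ≤ t → ∀ a, G t u (G u r a) = G t r a) (z : ℝ → E) :
    ∀ (l : List ℝ) (s : ℝ), 0 ≤ s →
      IsSteps (fun u v => u ≤ v ∧ ‖z v - G v u (z u)‖ ≤ c * ω u v) l s t →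
      ‖z t - G t s (z s)‖ ≤ Λ * c * ω s t := by
  intro l
  induction l with
  | nil =>
    intro s hs hst
    refine hst.2.trans ?_
    have := hω.nonneg s t hs hst.1 ht
    nlinarith [mul_nonneg hc this]
  | cons u l ih =>
    intro s hs hst
    have hsu := hst.1.1
    have hut : u ≤ t := (IsSteps.imp (R' := (· ≤ ·)) (fun _ _ _ h _ _ => h) (fun _ _ h => h.1)
      le_rfl le_rfl hst.2).1
    have h1 := ih u (hs.trans hsu) hst.2
    have h2 : ‖G t u (z u) - G t s (z s)‖ ≤ Λ * (c * ω s u) := by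
      rw [← hG s u hs hsu hut (z s)]
      refine (hGt u (hs.trans hsu) hut _ _).trans ?_
      gcongr
      exact hst.1.2
    have h3 := hω.superadditive s u t hs hsu hut ht
    calc ‖z t - G t s (z s)‖ ≤ ‖z t - G t u (z u)‖ + ‖G t u (z u) - G t s (z s)‖ :=
          norm_sub_le_norm_sub_add_norm_sub _ _ _
      _ ≤ Λ * c * (ω s u + ω u t) := by linarith
      _ ≤ Λ * c * ω s t := by gcongr

end Telescoping

/-! ### The exponent (2+γ)/p and the contraction constants. -/

section Exponents

variable {p γ : ℝ}

theorem exists_mul_rpow_le (C : ℝ) {e δ : ℝ} (he : 0 < e) (hδ : 0 < δ) :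
    ∃ W > 0, ∀ x, 0 ≤ x → x ≤ W → C * x ^ e ≤ δ := by
  refine ⟨(δ / (|C| + 1)) ^ (1 / e), by positivity, fun x hx hxW => ?_⟩
  have h1 : x ^ e ≤ δ / (|C| + 1) := by
    calc x ^ e ≤ ((δ / (|C| + 1)) ^ (1 / e)) ^ e := by gcongr
      _ = δ / (|C| + 1) := by
        rw [← Real.rpow_mul (by positivity), one_div_mul_cancel he.ne', Real.rpow_one]
  calc C * x ^ e ≤ (|C| + 1) * x ^ e := by
        gcongr; linarith [le_abs_self C]
    _ ≤ (|C| + 1) * (δ / (|C| + 1)) := by gcongr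
    _ = δ := by field_simp

theorem remainderFn_nonneg {d : ℝ} (hd : 0 ≤ d) : 0 ≤ remainderFn p γ d := by
  unfold remainderFn; positivity

theorem remainderFn_mono (hp : 2 ≤ p) (hγ : 0 < γ) {d e : ℝ} (hd : 0 ≤ d) (hde : d ≤ e) :
    remainderFn p γ d ≤ remainderFn p γ e := by
  unfold remainderFn; gcongr

theorem remainderFn_half_le {c : ℝ} (hp : 2 ≤ p) (hγ : 0 < γ) {d W : ℝ} (hd : 0 ≤ d)
    (hc : c = (1 / 2 : ℝ) ^ ((2 + γ) / p)) (hW : d ≤ W / 2) :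
    remainderFn p γ d ≤ c * remainderFn p γ W := by
  have hW0 : 0 ≤ W := by linarith
  rw [hc, remainderFn, remainderFn, ← Real.mul_rpow (by norm_num) hW0]
  have : d ≤ 1 / 2 * W := by linarith
  gcongr

/-- This is where 2 + γ > p acts: it makes ϖ(d) = o(d), and it makes 2 · (1/2)^{(2+γ)/p} < 1, so
that the two halves of an interval together cost less than the whole. -/
theorem one_lt_exponent (hp : 2 ≤ p) (hpγ : p < 2 + γ) : 1 < (2 + γ) / p := by
  rw [lt_div_iff₀ (by linarith)]; linarith

/-- `ϖ(d) ≤ h^{θ - 1} d` for `d ≤ h`. -/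
theorem remainderFn_le_mul (hp : 2 ≤ p) (hpγ : p < 2 + γ) {d h : ℝ} (hd : 0 ≤ d) (hdh : d ≤ h) :
    remainderFn p γ d ≤ h ^ ((2 + γ) / p - 1) * d := by
  have hθ := one_lt_exponent hp hpγ
  rcases hd.eq_or_lt with rfl | hd
  · simp [remainderFn, Real.zero_rpow (by linarith : (2 + γ) / p ≠ 0)]
  · have : remainderFn p γ d = d ^ ((2 + γ) / p - 1) * d := by
      rw [remainderFn, Real.rpow_sub hd, Real.rpow_one]; field_simp
    rw [this]
    gcongr

/-- The constants of the contraction argument. -/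
theorem exists_contraction_const (hp : 2 ≤ p) (hpγ : p < 2 + γ) :
    ∃ δ κ : ℝ, 0 < δ ∧ δ ≤ 1 / 16 ∧ κ < 1 ∧
      2 * (1 + 2 * δ) ^ 2 * (1 / 2 : ℝ) ^ ((2 + γ) / p) ≤ κ := by
  have hθ := one_lt_exponent hp hpγ
  set ρ := (1 / 2 : ℝ) ^ ((2 + γ) / p) with hρ
  have h0 : 0 < ρ := by positivity
  have h1 : ρ < 1 / 2 := by
    have := Real.rpow_lt_rpow_of_exponent_gt (x := 1 / 2) (by norm_num) (by norm_num) hθ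
    rwa [Real.rpow_one] at this
  -- κ is the midpoint of 2ρ and 1. Since (1 + 2δ)² ≤ 1 + 8δ and ρ < 1/2, the product is at most 2ρ
  -- + 8δ, and δ is chosen so that this equals κ.
  refine ⟨(1 - 2 * ρ) / 16, (1 + 2 * ρ) / 2, by linarith, by linarith, by linarith, ?_⟩
  set δ := (1 - 2 * ρ) / 16 with hδ
  have h2 : 0 < δ := by linarith
  have h3 : δ ≤ 1 / 16 := by linarith
  have h4 : (1 + 2 * δ) ^ 2 ≤ 1 + 8 * δ := by nlinarith
  calc 2 * (1 + 2 * δ) ^ 2 * ρ ≤ 2 * (1 + 8 * δ) * ρ := by gcongr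
    _ ≤ 2 * ρ + 8 * δ := by nlinarith
    _ = (1 + 2 * ρ) / 2 := by rw [hδ]; ring

end Exponents

/-! ### Uniform C¹ estimates for products of a smooth almost flow. -/

section SmoothAlmostFlow

variable {E : Type*} [NormedAddCommGroup E] [NormedSpace ℝ E]

/-- Almost flows made of differentiable maps, whose defect to the semi-flow property is small in
the `C¹` norm. -/
structure IsSmoothAlmostFlow (T : ℝ) (ω : ℝ → ℝ → ℝ) (p γ K : ℝ) (φ : ℝ → ℝ → E → E) : Prop where
  nonneg : 0 ≤ K
  self : ∀ t, 0 ≤ t → t ≤ T → ∀ a, φ t t a = a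
  differentiable : ∀ s t, 0 ≤ s → s ≤ t → t ≤ T → Differentiable ℝ (φ t s)
  norm_sub_le : ∀ s t, 0 ≤ s → s ≤ t → t ≤ T → ∀ a, ‖φ t s a - a‖ ≤ K * ω s t ^ (1 / p)
  fderiv_sub_le : ∀ s t, 0 ≤ s → s ≤ t → t ≤ T → ∀ a,
    ‖fderiv ℝ (φ t s) a - 1‖ ≤ K * ω s t ^ (1 / p)
  fderiv_sub_fderiv_le : ∀ s t, 0 ≤ s → s ≤ t → t ≤ T → ∀ a b,
    ‖fderiv ℝ (φ t s) a - fderiv ℝ (φ t s) b‖ ≤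
      K * (ω s t ^ (1 / p) * ‖a - b‖ + ω s t ^ (2 / p) * ‖a - b‖ ^ γ)
  defect_le : ∀ r s t, 0 ≤ r → r ≤ s → s ≤ t → t ≤ T → ∀ a,
    ‖φ t s (φ s r a) - φ t r a‖ ≤ K * remainderFn p γ (ω r t)
  fderiv_defect_le : ∀ r s t, 0 ≤ r → r ≤ s → s ≤ t → t ≤ T → ∀ a,
    ‖fderiv ℝ (φ t s) (φ s r a) * fderiv ℝ (φ s r) a - fderiv ℝ (φ t r) a‖ ≤
      K * remainderFn p γ (ω r t)

/-- A map whose derivative is close to the identity is close to the identity in the Lipschitz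
norm. -/
theorem norm_sub_sub_sub_le_of_fderiv {F : E → E} {c : ℝ} (hF : Differentiable ℝ F)
    (h : ∀ a, ‖fderiv ℝ F a - 1‖ ≤ c) (a b : E) : ‖F a - F b - (a - b)‖ ≤ c * ‖a - b‖ := by
  have := convex_univ.norm_image_sub_le_of_norm_fderiv_le' (𝕜 := ℝ) (f := F) (C := c)
    (φ := (1 : E →L[ℝ] E)) (fun x _ => hF x) (fun x _ => h x) (mem_univ b) (mem_univ a)
  simpa using this

theorem norm_sub_le_of_norm_sub_sub_sub_le {V : Type*} [NormedAddCommGroup V] {F : V → V} {c : ℝ}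
    {a b : V}
    (h : ‖F a - F b - (a - b)‖ ≤ c * ‖a - b‖) : ‖F a - F b‖ ≤ (1 + c) * ‖a - b‖ := by
  have := norm_le_norm_sub_add (F a - F b) (a - b)
  linarith

theorem compAlong_differentiable {T : ℝ} {φ : ℝ → ℝ → E → E}
    (h : ∀ s t, 0 ≤ s → s ≤ t → t ≤ T → Differentiable ℝ (φ t s)) {t : ℝ} (ht : t ≤ T) :
    ∀ (l : List ℝ) (s : ℝ), 0 ≤ s → IsSteps (· ≤ ·) l s t →
      Differentiable ℝ (compAlong φ l s t) := by
  intro l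
  induction l with
  | nil => intro s hs hst; exact h s t hs hst ht
  | cons u l ih =>
    intro s hs hst
    exact (ih u (hs.trans hst.1) hst.2).comp (h s u hs hst.1 (hst.2.le.trans ht))

/-- X bounds the error on each half of the interval; the factors are the norms of the maps composed
with these errors. -/
theorem contraction_key {X δ : ℝ} (hδ : 0 ≤ δ) (hX : 0 ≤ X) :
    X * ((1 + δ) * (1 + 2 * δ)) + (1 + δ) * ((1 + δ) * X) ≤ 2 * (1 + 2 * δ) ^ 2 * X := by
  nlinarith [mul_nonneg hX hδ, mul_nonneg hX (sq_nonneg δ)]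

/-- A noncommutative telescoping for the chain rule. A₁ and A₂ stand for the derivatives of the two
outer products, B₁ and B₂ for those of φ over the same intervals, C for that of the middle step, and
primes mark a change of base point. The first two terms of the sum receive the induction hypothesis,
the next two Hölder continuity, the last two the defect of φ. -/
theorem norm_mul_mul_sub_le {A : Type*} [NormedRing A] {A₁ A₂ B₁ B₂ B₂' C C' D G : A}
    {e₁ e₂ c a₁ b x y d d' : ℝ} (h₂ : ‖A₂ - B₂‖ ≤ e₂) (h₁ : ‖A₁ - B₁‖ ≤ e₁) (hC : ‖C‖ ≤ c)
    (hA₁ : ‖A₁‖ ≤ a₁) (hB₂ : ‖B₂‖ ≤ b) (hB₂' : ‖B₂'‖ ≤ 2) (hB₁ : ‖B₁‖ ≤ 2) (hC₂ : ‖C‖ ≤ 2)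
    (hx : ‖B₂ - B₂'‖ ≤ x) (hy : ‖C - C'‖ ≤ y) (hd : ‖B₂' * C' - G‖ ≤ d)
    (hd' : ‖G * B₁ - D‖ ≤ d') :
    ‖A₂ * (C * A₁) - D‖ ≤ e₂ * (c * a₁) + b * (c * e₁) + x * (2 * 2) + 2 * (y * 2) + d * 2 + d' := by
  have hmul : ∀ {P Q : A} {u v : ℝ}, ‖P‖ ≤ u → ‖Q‖ ≤ v → ‖P * Q‖ ≤ u * v := fun hP hQ =>
    (norm_mul_le _ _).trans (mul_le_mul hP hQ (norm_nonneg _) ((norm_nonneg _).trans hP))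
  have dec : A₂ * (C * A₁) - D = (A₂ - B₂) * (C * A₁) + B₂ * (C * (A₁ - B₁)) +
      (B₂ - B₂') * (C * B₁) + B₂' * ((C - C') * B₁) + (B₂' * C' - G) * B₁ + (G * B₁ - D) := by
    noncomm_ring
  rw [dec]
  exact norm_add_le_of_le (norm_add_le_of_le (norm_add_le_of_le (norm_add_le_of_le
    (norm_add_le_of_le (hmul h₂ (hmul hC hA₁)) (hmul hB₂ (hmul hC h₁)))
    (hmul hx (hmul hC₂ hB₁))) (hmul hB₂' (hmul hy hB₁))) (hmul hd hB₁)) hd'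

namespace IsSmoothAlmostFlow

variable {T p γ K : ℝ} {ω : ℝ → ℝ → ℝ} {φ : ℝ → ℝ → E → E}

theorem lipschitz (h : IsSmoothAlmostFlow T ω p γ K φ) {s t : ℝ} (hs : 0 ≤ s) (hst : s ≤ t)
    (ht : t ≤ T) (a b : E) : ‖φ t s a - φ t s b‖ ≤ (1 + K * ω s t ^ (1 / p)) * ‖a - b‖ :=
  norm_sub_le_of_norm_sub_sub_sub_le
    (norm_sub_sub_sub_le_of_fderiv (h.differentiable s t hs hst ht) (h.fderiv_sub_le s t hs hst ht)
      a b)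

theorem norm_fderiv_le (h : IsSmoothAlmostFlow T ω p γ K φ) {s t δ : ℝ} (hs : 0 ≤ s) (hst : s ≤ t)
    (ht : t ≤ T) (hδ : K * ω s t ^ (1 / p) ≤ δ) (a : E) : ‖fderiv ℝ (φ t s) a‖ ≤ 1 + δ := by
  have h1 := norm_le_norm_sub_add (fderiv ℝ (φ t s) a) 1
  have h2 := h.fderiv_sub_le s t hs hst ht a
  have h3 : ‖(1 : E →L[ℝ] E)‖ ≤ 1 := ContinuousLinearMap.norm_id_le
  linarith

/-- Products along short chains stay close to the almost flow in sup-norm. -/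
theorem norm_compAlong_sub_le (h : IsSmoothAlmostFlow T ω p γ K φ) (hω : IsControl T ω)
    (hp : 2 ≤ p) (hγ : 0 < γ) {δ κ W L : ℝ} (hδ : 0 < δ) (hκ : κ < 1)
    (hδκ : 2 * (1 + 2 * δ) ^ 2 * (1 / 2 : ℝ) ^ ((2 + γ) / p) ≤ κ)
    (hW : ∀ x, 0 ≤ x → x ≤ W → K * x ^ (1 / p) ≤ δ) (hL : L = 2 * K / (1 - κ)) :
    ∀ (n : ℕ) (l : List ℝ), l.length ≤ n → ∀ s t, 0 ≤ s → t ≤ T → IsSteps (· ≤ ·) l s t →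
      ω s t ≤ W → ∀ a, ‖compAlong φ l s t a - φ t s a‖ ≤ L * remainderFn p γ (ω s t) := by
  have hK := h.nonneg
  have hL0 : 0 ≤ L := by rw [hL]; exact div_nonneg (by linarith) (by linarith)
  have hL' : L * (1 - κ) = 2 * K := by rw [hL]; field_simp [(by linarith : 1 - κ ≠ 0)]
  intro n
  induction n with
  | zero =>
    intro l hl s t hs ht hst hWω a
    obtain rfl : l = [] := by simpa using hl
    simp only [compAlong, sub_self, norm_zero]
    exact mul_nonneg hL0 (remainderFn_nonneg (hω.nonneg s t hs hst.le ht))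
  | succ n ih =>
    intro l hl s t hs ht hst hWω a
    have hst' := hst.le
    have hω0 := hω.nonneg s t hs hst' ht
    -- The cut is at half of the control. The step from v to u that crosses it may itself carry a
    -- large control, so it stays a single factor φ u v, outside the induction hypothesis.
    obtain ⟨v, u, l₁, l₂, h1, hvu, h2, hc1, hc2, e1, e2, hcomp⟩ :=
      exists_compAlong_split (φ := φ) (ω := ω) h.self (s₀ := s) (c := ω s t / 2) ht l s hs hst
        (by rw [hω.diag s hs (hst'.trans ht)]; positivity)
    have hsv := h1.le
    have hut := h2.le
    have hu0 : 0 ≤ u := hs.trans (hsv.trans hvu)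
    have hv0 : 0 ≤ v := hs.trans hsv
    have hc2' : ω u t ≤ ω s t / 2 := by
      rcases hc2 with hc2 | rfl
      · have := hω.superadditive s u t hs (hsv.trans hvu) hut ht
        linarith
      · rw [hω.diag u hu0 ht]; positivity
    set R := remainderFn p γ (ω s t) with hR
    have hR0 : 0 ≤ R := remainderFn_nonneg hω0
    set ρ := (1 / 2 : ℝ) ^ ((2 + γ) / p) with hρ
    have hρ0 : 0 < ρ := by positivity
    have i1 := ih l₁ (by omega) s v hs (hvu.trans (hut.trans ht)) h1 (by linarith) a
    have i2 := ih l₂ (by omega) u t hu0 ht h2 (by linarith) (φ u v (compAlong φ l₁ s v a))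
    have r1 := remainderFn_half_le (p := p) hp hγ
      (hω.nonneg s v hs hsv (hvu.trans (hut.trans ht))) hρ hc1
    have r2 := remainderFn_half_le (p := p) hp hγ (hω.nonneg u t hu0 hut ht) hρ hc2'
    have hδ' : ∀ x y, s ≤ x → x ≤ y → y ≤ t → K * ω x y ^ (1 / p) ≤ δ := fun x y hx hxy hy =>
      hW _ (hω.nonneg x y (hs.trans hx) hxy (hy.trans ht)) ((hω.mono hs hx hxy hy ht).trans hWω)
    have lip : ∀ x y, s ≤ x → x ≤ y → y ≤ t → ∀ a b, ‖φ y x a - φ y x b‖ ≤ (1 + δ) * ‖a - b‖ :=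
      fun x y hx hxy hy a b => (h.lipschitz (hs.trans hx) hxy (hy.trans ht) a b).trans (by
        gcongr; exact hδ' x y hx hxy hy)
    have d1 := h.defect_le v u t hv0 hvu hut ht (φ v s a)
    have d2 := h.defect_le s v t hs hsv (hvu.trans hut) ht a
    have d1' : remainderFn p γ (ω v t) ≤ R := remainderFn_mono hp hγ
      (hω.nonneg v t hv0 (hvu.trans hut) ht) (hω.mono hs hsv (hvu.trans hut) le_rfl ht)
    set x := compAlong φ l₁ s v a
    set y := φ v s a
    have l1 : ‖φ t u (φ u v x) - φ t u (φ u v y)‖ ≤ (1 + δ) * ((1 + δ) * (L * (ρ * R))) := by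
      refine (lip u t (hsv.trans hvu) hut le_rfl _ _).trans ?_
      gcongr
      refine (lip v u hsv hvu hut _ _).trans ?_
      gcongr
      exact i1.trans (by gcongr)
    have i2' := i2.trans (mul_le_mul_of_nonneg_left r2 hL0)
    have d1'' := d1.trans (mul_le_mul_of_nonneg_left d1' hK)
    rw [hcomp]
    have t1 := norm_sub_le_norm_sub_add_norm_sub (compAlong φ l₂ u t (φ u v x))
      (φ t u (φ u v x)) (φ t s a)
    have t2 := norm_sub_le_norm_sub_add_norm_sub (φ t u (φ u v x)) (φ t u (φ u v y)) (φ t s a)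
    have t3 := norm_sub_le_norm_sub_add_norm_sub (φ t u (φ u v y)) (φ t v y) (φ t s a)
    have key : L * (ρ * R) + (1 + δ) * ((1 + δ) * (L * (ρ * R))) ≤ κ * (L * R) := by
      have : L * (ρ * R) + (1 + δ) * ((1 + δ) * (L * (ρ * R))) ≤
          (2 * (1 + 2 * δ) ^ 2 * ρ) * (L * R) := by
        have : 0 ≤ L * (ρ * R) := by positivity
        nlinarith [mul_nonneg this hδ.le, mul_nonneg this (sq_nonneg δ)]
      exact this.trans (mul_le_mul_of_nonneg_right hδκ (by positivity))
    -- L is the fixed point of L = κL + 2K: the halves contribute κL, and the two defects, at u and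
    -- at v, contribute K each.
    have : κ * (L * R) + 2 * K * R = L * R := by rw [← hL']; ring
    linarith

set_option maxHeartbeats 800000 in
/-- The derivatives of products along short chains stay close to that of the almost flow. -/
theorem norm_fderiv_compAlong_sub_le (h : IsSmoothAlmostFlow T ω p γ K φ) (hω : IsControl T ω)
    (hp : 2 ≤ p) (hγ : 0 < γ) {δ κ W L L' : ℝ} (hδ : 0 < δ) (hδ1 : δ ≤ 1 / 16)
    (hκ : κ < 1) (hδκ : 2 * (1 + 2 * δ) ^ 2 * (1 / 2 : ℝ) ^ ((2 + γ) / p) ≤ κ) (hW1 : W ≤ 1)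
    (hW : ∀ x, 0 ≤ x → x ≤ W → K * x ^ (1 / p) ≤ δ)
    (hL : L = 2 * K / (1 - κ))
    (hL' : L' = (8 * (K * (2 * L + (2 * L) ^ γ)) + 3 * K) / (1 - κ))
    (hWL : ∀ x, 0 ≤ x → x ≤ W → L' * remainderFn p γ x ≤ δ) :
    ∀ (n : ℕ) (l : List ℝ), l.length ≤ n → ∀ s t, 0 ≤ s → t ≤ T → IsSteps (· ≤ ·) l s t →
      ω s t ≤ W → ∀ a, ‖fderiv ℝ (compAlong φ l s t) a - fderiv ℝ (φ t s) a‖ ≤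
        L' * remainderFn p γ (ω s t) := by
  have hK := h.nonneg
  have hκ' : 1 - κ ≠ 0 := by linarith
  have hL0 : 0 ≤ L := by rw [hL]; exact div_nonneg (by linarith) (by linarith)
  set K₂ := K * (2 * L + (2 * L) ^ γ) with hK₂
  have hK₂0 : 0 ≤ K₂ := by positivity
  have hL'0 : 0 ≤ L' := by rw [hL']; exact div_nonneg (by positivity) (by linarith)
  have hL'' : L' * (1 - κ) = 8 * K₂ + 3 * K := by rw [hL']; field_simp
  intro n
  induction n with
  | zero =>
    intro l hl s t hs ht hst hWω a
    obtain rfl : l = [] := by simpa using hl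
    have : compAlong φ [] s t = φ t s := rfl
    simp only [this, sub_self, norm_zero]
    exact mul_nonneg hL'0 (remainderFn_nonneg (hω.nonneg s t hs hst.le ht))
  | succ n ih =>
    intro l hl s t hs ht hst hWω a
    have hst' := hst.le
    have hω0 := hω.nonneg s t hs hst' ht
    obtain ⟨v, u, l₁, l₂, h1, hvu, h2, hc1, hc2, e1, e2, hcomp⟩ :=
      exists_compAlong_split (φ := φ) (ω := ω) h.self (s₀ := s) (c := ω s t / 2) ht l s hs hst
        (by rw [hω.diag s hs (hst'.trans ht)]; positivity)
    have hsv := h1.le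
    have hut := h2.le
    have hu0 : 0 ≤ u := hs.trans (hsv.trans hvu)
    have hv0 : 0 ≤ v := hs.trans hsv
    have hvT : v ≤ T := hvu.trans (hut.trans ht)
    have hc2' : ω u t ≤ ω s t / 2 := by
      rcases hc2 with hc2 | rfl
      · have := hω.superadditive s u t hs (hsv.trans hvu) hut ht
        linarith
      · rw [hω.diag u hu0 ht]; positivity
    set R := remainderFn p γ (ω s t) with hR
    have hR0 : 0 ≤ R := remainderFn_nonneg hω0
    set ρ := (1 / 2 : ℝ) ^ ((2 + γ) / p) with hρ
    have hρ0 : 0 < ρ := by positivity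
    set x := compAlong φ l₁ s v a with hx
    set y := φ v s a with hy
    have i1 := ih l₁ (by omega) s v hs hvT h1 (by linarith) a
    have i2 := ih l₂ (by omega) u t hu0 ht h2 (by linarith) (φ u v x)
    have r1 := remainderFn_half_le (p := p) hp hγ (hω.nonneg s v hs hsv hvT) hρ hc1
    have r2 := remainderFn_half_le (p := p) hp hγ (hω.nonneg u t hu0 hut ht) hρ hc2'
    have hδ' : ∀ x y, s ≤ x → x ≤ y → y ≤ t → K * ω x y ^ (1 / p) ≤ δ := fun x y hx hxy hy =>
      hW _ (hω.nonneg x y (hs.trans hx) hxy (hy.trans ht)) ((hω.mono hs hx hxy hy ht).trans hWω)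
    have nf : ∀ x y, s ≤ x → x ≤ y → y ≤ t → ∀ a, ‖fderiv ℝ (φ y x) a‖ ≤ 1 + δ :=
      fun x y hx hxy hy a => h.norm_fderiv_le (hs.trans hx) hxy (hy.trans ht) (hδ' x y hx hxy hy) a
    have hd : ‖x - y‖ ≤ L * R := by
      refine (h.norm_compAlong_sub_le hω hp hγ hδ hκ hδκ hW hL _ l₁ le_rfl s v hs hvT h1
        (by linarith) a).trans ?_
      gcongr
      exact remainderFn_mono hp hγ (hω.nonneg s v hs hsv hvT) (by linarith)
    have hd' : ‖φ u v x - φ u v y‖ ≤ 2 * L * R := by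
      refine (h.lipschitz hv0 hvu (hut.trans ht) _ _).trans ?_
      have := hδ' v u hsv hvu hut
      calc (1 + K * ω v u ^ (1 / p)) * ‖x - y‖ ≤ 2 * ‖x - y‖ := by
            gcongr; linarith
        _ ≤ 2 * (L * R) := by gcongr
        _ = 2 * L * R := by ring
    -- The sup-norm estimate is fed back here: base points that differ by O(R) change the
    -- derivatives only by O(R).
    have holder : ∀ b c z w, s ≤ z → z ≤ w → w ≤ t → ‖b - c‖ ≤ 2 * L * R →
        ‖fderiv ℝ (φ w z) b - fderiv ℝ (φ w z) c‖ ≤ K₂ * R := by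
      intro b c z w hz hzw hw hbc
      have m := hω.mono hs hz hzw hw ht
      have m0 := hω.nonneg z w (hs.trans hz) hzw (hw.trans ht)
      refine (h.fderiv_sub_fderiv_le z w (hs.trans hz) hzw (hw.trans ht) b c).trans ?_
      rw [hK₂, mul_assoc]
      gcongr
      rw [add_mul]
      have q1 : ω z w ^ (1 / p) ≤ 1 := Real.rpow_le_one m0 (by linarith) (by positivity)
      have q2 : ω z w ^ (2 / p) ≤ ω s t ^ (2 / p) := by gcongr
      have q3 : ‖b - c‖ ^ γ ≤ (2 * L) ^ γ * ω s t ^ (γ / p) := by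
        calc ‖b - c‖ ^ γ ≤ (2 * L * R) ^ γ := by gcongr
          _ = (2 * L) ^ γ * R ^ γ := Real.mul_rpow (by positivity) hR0
          _ ≤ (2 * L) ^ γ * ω s t ^ (γ / p) := by
            gcongr
            rw [hR, remainderFn, ← Real.rpow_mul hω0]
            -- R^γ has exponent γ(2+γ)/p ≥ γ/p, which is enough because the control is at most W ≤
            -- 1.
            refine Real.rpow_le_rpow_of_exponent_ge' hω0 (by linarith) (by positivity) ?_
            rw [div_mul_eq_mul_div]
            gcongr
            nlinarith
      have q4 : ω s t ^ (2 / p) * ω s t ^ (γ / p) = R := by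
        rw [hR, remainderFn, ← Real.rpow_add_of_nonneg hω0 (by positivity) (by positivity)]
        ring_nf
      calc ω z w ^ (1 / p) * ‖b - c‖ + ω z w ^ (2 / p) * ‖b - c‖ ^ γ
          ≤ 1 * (2 * L * R) + ω s t ^ (2 / p) * ((2 * L) ^ γ * ω s t ^ (γ / p)) := by gcongr
        _ = 2 * L * R + (2 * L) ^ γ * (ω s t ^ (2 / p) * ω s t ^ (γ / p)) := by ring
        _ = 2 * L * R + (2 * L) ^ γ * R := by rw [q4]
    have d1 := h.fderiv_defect_le v u t hv0 hvu hut ht y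
    have d2 := h.fderiv_defect_le s v t hs hsv (hvu.trans hut) ht a
    have d1' : remainderFn p γ (ω v t) ≤ R := remainderFn_mono hp hγ
      (hω.nonneg v t hv0 (hvu.trans hut) ht) (hω.mono hs hsv (hvu.trans hut) le_rfl ht)
    have hfd : fderiv ℝ (compAlong φ l s t) a = fderiv ℝ (compAlong φ l₂ u t) (φ u v x) *
        (fderiv ℝ (φ u v) x * fderiv ℝ (compAlong φ l₁ s v) a) := by
      have hfun : compAlong φ l s t = compAlong φ l₂ u t ∘ (φ u v ∘ compAlong φ l₁ s v) :=
        funext hcomp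
      have g1 := compAlong_differentiable h.differentiable hvT l₁ s hs h1
      have g2 := compAlong_differentiable h.differentiable ht l₂ u hu0 h2
      have g3 := h.differentiable v u hv0 hvu (hut.trans ht)
      rw [hfun, fderiv_comp _ g2.differentiableAt (g3.comp g1).differentiableAt,
        fderiv_comp _ g3.differentiableAt g1.differentiableAt]
      rfl
    have b2 := nf u t (hsv.trans hvu) hut le_rfl (φ u v x)
    have b2' := nf u t (hsv.trans hvu) hut le_rfl (φ u v y)
    have b1 := nf s v le_rfl hsv (hvu.trans hut) a
    have c1 := nf v u hsv hvu hut x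
    have hLR : L * R ≤ 2 * L * R := by
      have := mul_nonneg hL0 hR0
      linarith
    have x1 := holder x y v u hsv hvu hut (hd.trans hLR)
    have x2 := holder (φ u v x) (φ u v y) u t (hsv.trans hvu) hut le_rfl hd'
    rw [← hy] at d2
    have i1' := i1.trans (mul_le_mul_of_nonneg_left r1 hL'0)
    have i2' := i2.trans (mul_le_mul_of_nonneg_left r2 hL'0)
    -- One δ comes from φ, the other from the induction hypothesis, for W so small that L'ϖ ≤ δ.
    have a1 : ‖fderiv ℝ (compAlong φ l₁ s v) a‖ ≤ 1 + 2 * δ := by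
      have := norm_le_norm_sub_add (fderiv ℝ (compAlong φ l₁ s v) a) (fderiv ℝ (φ v s) a)
      have h3 := hWL (ω s v) (hω.nonneg s v hs hsv hvT) (by linarith)
      linarith
    rw [hfd]
    have t := norm_mul_mul_sub_le i2' i1' c1 a1 b2 (b2'.trans (by linarith))
      (b1.trans (by linarith)) (c1.trans (by linarith)) x2 x1
      (d1.trans (mul_le_mul_of_nonneg_left d1' hK)) d2
    refine t.trans ?_
    have hρL : 0 ≤ L' * (ρ * R) := by positivity
    have key : L' * (ρ * R) * ((1 + δ) * (1 + 2 * δ)) + (1 + δ) * ((1 + δ) * (L' * (ρ * R))) ≤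
        κ * (L' * R) := by
      have : L' * (ρ * R) * ((1 + δ) * (1 + 2 * δ)) + (1 + δ) * ((1 + δ) * (L' * (ρ * R))) ≤
          (2 * (1 + 2 * δ) ^ 2 * ρ) * (L' * R) :=
        (contraction_key hδ.le hρL).trans_eq (by ring)
      exact this.trans (mul_le_mul_of_nonneg_right hδκ (by positivity))
    -- Fixed point for L': each of the two Hölder terms weighs 4 K₂, and the defects weigh 2K and K.
    have : κ * (L' * R) + (8 * K₂ + 3 * K) * R = L' * R := by rw [← hL'']; ring
    linarith

/-- Products along short chains: they are close to the almost flow in sup-norm, and close to the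
identity in the Lipschitz norm. -/
theorem exists_local_bounds (h : IsSmoothAlmostFlow T ω p γ K φ) (hω : IsControl T ω)
    (hp : 2 ≤ p) (hγ : 0 < γ) (hpγ : p < 2 + γ) :
    ∃ W > 0, ∃ L ≥ 0, ∀ l s t, 0 ≤ s → t ≤ T → IsSteps (· ≤ ·) l s t → ω s t ≤ W →
      (∀ a, ‖compAlong φ l s t a - φ t s a‖ ≤ L * remainderFn p γ (ω s t)) ∧
      ∀ a b, ‖compAlong φ l s t a - compAlong φ l s t b - (a - b)‖ ≤ 1 / 2 * ‖a - b‖ := by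
  obtain ⟨δ, κ, hδ, hδ1, hκ, hδκ⟩ := exists_contraction_const (p := p) (γ := γ) hp hpγ
  have hK := h.nonneg
  obtain ⟨L, hL⟩ : ∃ L, L = 2 * K / (1 - κ) := ⟨_, rfl⟩
  obtain ⟨L', hL'⟩ : ∃ L', L' = (8 * (K * (2 * L + (2 * L) ^ γ)) + 3 * K) / (1 - κ) := ⟨_, rfl⟩
  have hL0 : 0 ≤ L := by rw [hL]; exact div_nonneg (by linarith) (by linarith)
  obtain ⟨W₁, hW₁, H₁⟩ := exists_mul_rpow_le K (e := 1 / p) (by positivity) hδ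
  obtain ⟨W₂, hW₂, H₂⟩ := exists_mul_rpow_le L' (e := (2 + γ) / p) (by positivity) hδ
  have b1 : min 1 (min W₁ W₂) ≤ W₁ := (min_le_right _ _).trans (min_le_left _ _)
  have b2 : min 1 (min W₁ W₂) ≤ W₂ := (min_le_right _ _).trans (min_le_right _ _)
  refine ⟨min 1 (min W₁ W₂), by positivity, L, hL0, fun l s t hs ht hst hW => ⟨?_, ?_⟩⟩
  · exact h.norm_compAlong_sub_le hω hp hγ hδ hκ hδκ (fun x hx hxW => H₁ x hx (hxW.trans b1)) hL
      _ l le_rfl s t hs ht hst hW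
  · have hω0 := hω.nonneg s t hs hst.le ht
    have key := h.norm_fderiv_compAlong_sub_le hω hp hγ hδ hδ1 hκ hδκ (min_le_left _ _)
      (fun x hx hxW => H₁ x hx (hxW.trans b1)) hL hL' (fun x hx hxW => H₂ x hx (hxW.trans b2))
      _ l le_rfl s t hs ht hst hW
    refine norm_sub_sub_sub_le_of_fderiv
      (compAlong_differentiable h.differentiable ht l s hs hst) fun a => ?_
    have q1 := key a
    have q2 := h.fderiv_sub_le s t hs hst.le ht a
    have q3 := H₁ _ hω0 (hW.trans b1)
    have q4 := H₂ _ hω0 (hW.trans b2)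
    have q5 := norm_sub_le_norm_sub_add_norm_sub (fderiv ℝ (compAlong φ l s t) a)
      (fderiv ℝ (φ t s) a) 1
    unfold remainderFn at q1
    linarith

/-- Products along arbitrary chains are uniformly Lipschitz, and at a bounded distance from the
identity. -/
theorem exists_global_bounds (h : IsSmoothAlmostFlow T ω p γ K φ) (hω : IsControl T ω)
    (hp : 2 ≤ p) (hγ : 0 < γ) (hpγ : p < 2 + γ) :
    ∃ Λ ≥ 1, ∃ B ≥ 0, ∀ l s t, 0 ≤ s → t ≤ T → IsSteps (· ≤ ·) l s t →
      (∀ a b, ‖compAlong φ l s t a - compAlong φ l s t b‖ ≤ Λ * ‖a - b‖) ∧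
      ∀ a, ‖compAlong φ l s t a - a‖ ≤ B := by
  obtain ⟨W, hW, L, hL, H⟩ := h.exists_local_bounds hω hp hγ hpγ
  have hK := h.nonneg
  -- For negative T there is no chain in [0, T]; otherwise ω 0 T is a genuine bound for the control.
  by_cases hT0 : T < 0
  · exact ⟨1, le_rfl, 0, le_rfl, fun l s t hs ht hst => by linarith [hst.le]⟩
  push Not at hT0
  have hM0 : 0 ≤ ω 0 T := hω.nonneg 0 T le_rfl hT0 le_rfl
  obtain ⟨D, hD⟩ : ∃ D, D = K * ω 0 T ^ (1 / p) := ⟨_, rfl⟩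
  obtain ⟨R, hR⟩ : ∃ R, R = L * remainderFn p γ (ω 0 T) := ⟨_, rfl⟩
  have hD0 : 0 ≤ D := by rw [hD]; positivity
  have hR0 : 0 ≤ R := by rw [hR]; exact mul_nonneg hL (remainderFn_nonneg hM0)
  have lipφ : ∀ s t, 0 ≤ s → s ≤ t → t ≤ T → ∀ a b, ‖φ t s a - φ t s b‖ ≤ (1 + D) * ‖a - b‖ := by
    intro s t hs hst ht a b
    refine (h.lipschitz hs hst ht a b).trans ?_
    have m := hω.mono le_rfl hs hst ht le_rfl
    have m0 := hω.nonneg s t hs hst ht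
    rw [hD]
    gcongr
  have nearφ : ∀ s t, 0 ≤ s → s ≤ t → t ≤ T → ∀ a, ‖φ t s a - a‖ ≤ D := by
    intro s t hs hst ht a
    refine (h.norm_sub_le s t hs hst ht a).trans ?_
    have m := hω.mono le_rfl hs hst ht le_rfl
    have m0 := hω.nonneg s t hs hst ht
    rw [hD]
    gcongr
  have loc : ∀ l s t, 0 ≤ s → t ≤ T → IsSteps (· ≤ ·) l s t → ω s t ≤ W →
      (∀ a b, ‖compAlong φ l s t a - compAlong φ l s t b‖ ≤ 2 * ‖a - b‖) ∧
      ∀ a, ‖compAlong φ l s t a - a‖ ≤ R + D := by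
    intro l s t hs ht hst hW
    obtain ⟨h1, h2⟩ := H l s t hs ht hst hW
    refine ⟨fun a b => ?_, fun a => ?_⟩
    · have := norm_sub_le_of_norm_sub_sub_sub_le (h2 a b)
      linarith [norm_nonneg (a - b)]
    · have q1 := norm_sub_le_norm_sub_add_norm_sub (compAlong φ l s t a) (φ t s a) a
      have q2 := nearφ s t hs hst.le ht a
      have q3 : L * remainderFn p γ (ω s t) ≤ R := by
        have m := remainderFn_mono (p := p) hp hγ (hω.nonneg s t hs hst.le ht)
          (hω.mono le_rfl hs hst.le ht le_rfl)
        rw [hR]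
        gcongr
      linarith [h1 a]
  -- The induction counts blocks of control W, not factors. Super-additivity makes each block
  -- together with the step that leaves it use up at least W, so n depends only on ω 0 T / W. A
  -- block costs a factor 2 and the step that leaves it a factor 1 + D.
  have ind : ∀ n : ℕ, ∀ l s t, 0 ≤ s → t ≤ T → IsSteps (· ≤ ·) l s t → ω s t ≤ (n + 1) * W →
      (∀ a b, ‖compAlong φ l s t a - compAlong φ l s t b‖ ≤
        2 * ((1 + D) * 2) ^ n * ‖a - b‖) ∧
      ∀ a, ‖compAlong φ l s t a - a‖ ≤ (n + 1) * (R + 2 * D) := by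
    intro n
    induction n with
    | zero =>
      intro l s t hs ht hst hn
      obtain ⟨h1, h2⟩ := loc l s t hs ht hst (by simpa using hn)
      exact ⟨by simpa using h1, fun a => (h2 a).trans (by simp; linarith)⟩
    | succ n ih =>
      intro l s t hs ht hst hn
      obtain ⟨v, u, l₁, l₂, h1, hvu, h2, hc1, hc2, -, -, hcomp⟩ :=
        exists_compAlong_split (φ := φ) (ω := ω) h.self (s₀ := s) (c := W) ht l s hs hst
          (by rw [hω.diag s hs (hst.le.trans ht)]; positivity)
      have hsv := h1.le
      have hut := h2.le
      have hu0 : 0 ≤ u := hs.trans (hsv.trans hvu)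
      have hc2' : ω u t ≤ (n + 1) * W := by
        rcases hc2 with hc2 | rfl
        · have := hω.superadditive s u t hs (hsv.trans hvu) hut ht
          push_cast at hn
          linarith
        · rw [hω.diag u hu0 ht]; positivity
      obtain ⟨p1, p2⟩ := loc l₁ s v hs (hvu.trans (hut.trans ht)) h1 hc1
      obtain ⟨q1, q2⟩ := ih l₂ u t hu0 ht h2 hc2'
      refine ⟨fun a b => ?_, fun a => ?_⟩
      · rw [hcomp, hcomp]
        calc _ ≤ 2 * ((1 + D) * 2) ^ n *
              ((1 + D) * (2 * ‖a - b‖)) := by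
              refine (q1 _ _).trans ?_
              gcongr
              refine (lipφ v u (hs.trans hsv) hvu (hut.trans ht) _ _).trans ?_
              gcongr
              exact p1 a b
          _ = 2 * ((1 + D) * 2) ^ (n + 1) * ‖a - b‖ := by ring
      · rw [hcomp]
        set x := compAlong φ l₁ s v a
        have w1 := q2 (φ u v x)
        have w2 := nearφ v u (hs.trans hsv) hvu (hut.trans ht) x
        have w3 := p2 a
        have w4 := norm_sub_le_norm_sub_add_norm_sub (compAlong φ l₂ u t (φ u v x)) (φ u v x) a
        have w5 := norm_sub_le_norm_sub_add_norm_sub (φ u v x) x a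
        push_cast
        linarith
  obtain ⟨n, hn⟩ := exists_nat_ge (ω 0 T / W)
  have hn' : ω 0 T ≤ (n + 1) * W := by
    rw [div_le_iff₀ hW] at hn; linarith
  refine ⟨2 * ((1 + D) * 2) ^ n, ?_, (n + 1) * (R + 2 * D), by positivity,
    fun l s t hs ht hst => ind n l s t hs ht hst
      ((hω.mono le_rfl hs hst.le ht le_rfl).trans hn')⟩
  have : (1 : ℝ) ≤ ((1 + D) * 2) ^ n := one_le_pow₀ (by linarith)
  linarith

end IsSmoothAlmostFlow

end SmoothAlmostFlow

/-! ### Convergence and uniqueness from a Lipschitz bound. -/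

section Convergence

variable {E : Type*} [NormedAddCommGroup E] {T p γ : ℝ} {ω : ℝ → ℝ → ℝ}

/-- Fine steps have a small remainder, relatively to the control. -/
theorem exists_forall_remainderFn_le (hω : IsControl T ω) (hp : 2 ≤ p) (hpγ : p < 2 + γ) {c : ℝ}
    (hc : 0 < c) : ∃ h > 0, ∀ s t, 0 ≤ s → s ≤ t → t ≤ T → t - s ≤ h →
      remainderFn p γ (ω s t) ≤ c * ω s t := by
  have hθ := one_lt_exponent hp hpγ
  obtain ⟨W, hW, H⟩ := exists_mul_rpow_le 1 (e := (2 + γ) / p - 1) (by linarith) hc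
  obtain ⟨h, hh, H'⟩ := hω.exists_forall_sub_le hW
  refine ⟨h, hh, fun s t hs hst ht hd => ?_⟩
  have h0 := hω.nonneg s t hs hst ht
  refine (remainderFn_le_mul hp hpγ h0 (H' s t hs hst ht hd)).trans ?_
  have := H W hW.le le_rfl
  gcongr
  linarith

/-- Iterated products converge to any Lipschitz family of the galaxy that composes at the points
of the partition, with a rate that depends only on the constants. -/
theorem exists_forall_norm_sub_iteratedProduct_le (hω : IsControl T ω) (hp : 2 ≤ p)
    (hpγ : p < 2 + γ) {Λ C ε : ℝ} (hΛ : 1 ≤ Λ) (hC : 0 ≤ C) (hε : 0 < ε) :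
    ∃ h > 0, ∀ (G φ : ℝ → ℝ → E → E) (π : Finset ℝ),
      (∀ s t, 0 ≤ s → s ≤ t → t ≤ T → ∀ a b, ‖G t s a - G t s b‖ ≤ Λ * ‖a - b‖) →
      (∀ s t, 0 ≤ s → s ≤ t → t ≤ T → ∀ a, ‖G t s a - φ t s a‖ ≤ C * remainderFn p γ (ω s t)) →
      (∀ u ∈ π, ∀ r t, 0 ≤ r → r ≤ u → u ≤ t → t ≤ T → ∀ a, G t u (G u r a) = G t r a) →
      IsPartition T π → MeshLE π h →
      ∀ s t, 0 ≤ s → s ≤ t → t ≤ T → ∀ a, ‖G t s a - iteratedProduct φ π t s a‖ ≤ ε := by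
  -- A bound for the total telescoping error per unit of c; the added ones and the absolute value
  -- keep it positive.
  have hM : 0 < Λ * (C + 1) * (|ω 0 T| + 1) := by positivity
  obtain ⟨h, hh, H⟩ := exists_forall_remainderFn_le hω hp hpγ (div_pos hε hM)
  refine ⟨h, hh, fun G φ π hL hG hsemi hπ hm s t hs hst ht a => ?_⟩
  set c := ε / (Λ * (C + 1) * (|ω 0 T| + 1)) with hc
  have hc0 : 0 < c := div_pos hε hM
  have hsteps := (IsSteps.imp (R' := fun u v => u ≤ v ∧ ∀ a, ‖G v u a - φ v u a‖ ≤
      (C * c) * ω u v) (a := s) (b := t) (fun u v hu huv hv huv' => ⟨huv, fun a => by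
        refine (hG u v (hs.trans hu) huv (hv.trans ht) a).trans ?_
        rw [mul_assoc]
        gcongr
        exact H u v (hs.trans hu) huv (hv.trans ht) huv'.2⟩) (fun _ _ h => h.1) le_rfl le_rfl
    (isSteps_pointsIn_of_meshLE hπ hm hh.le hs hst ht)).2
  have key := norm_sub_compAlong_le hω hΛ (by positivity) ht
    (fun r hr hrt => hL r t hr hrt ht) (pointsIn π s t) s hs
    (fun u hu r hr hru => hsemi u (mem_pointsIn.1 hu).1 r t hr hru (mem_pointsIn.1 hu).2.2 ht)
    hsteps a
  refine key.trans ?_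
  have m : ω s t ≤ |ω 0 T| := (hω.mono le_rfl hs hst ht le_rfl).trans (le_abs_self _)
  have m0 := hω.nonneg s t hs hst ht
  calc Λ * (C * c) * ω s t ≤ Λ * ((C + 1) * c) * (|ω 0 T| + 1) := by gcongr <;> linarith
    _ = Λ * (C + 1) * (|ω 0 T| + 1) * c := by ring
    _ = ε := by rw [hc]; field_simp

/-- The maps `ψ_{t,s}`, `s ≤ t`, are Lipschitz continuous with constant `Λ ≥ 1`. -/
def IsForwardLipschitz (T Λ : ℝ) (ψ : ℝ → ℝ → E → E) : Prop :=
  1 ≤ Λ ∧ ∀ s t, 0 ≤ s → s ≤ t → t ≤ T → ∀ a b, ‖ψ t s a - ψ t s b‖ ≤ Λ * ‖a - b‖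

theorem IsLipschitzFamily.exists_isForwardLipschitz {ψ : ℝ → ℝ → E → E}
    (h : IsLipschitzFamily T ψ) : ∃ Λ, IsForwardLipschitz T Λ ψ := by
  obtain ⟨L, hL⟩ := h
  refine ⟨max L 1, le_max_right _ _, fun s t hs hst ht a b => ?_⟩
  refine (hL s ⟨hs, hst.trans ht⟩ t ⟨hs.trans hst, ht⟩ a b).trans ?_
  gcongr
  exact le_max_left _ _

theorem SameGalaxy.exists_nonneg {ζ ψ : ℝ → ℝ → E → E} (hω : IsControl T ω)
    (h : SameGalaxy T ω (remainderFn p γ) ζ ψ) : ∃ C ≥ 0, ∀ s t, 0 ≤ s → s ≤ t → t ≤ T → ∀ a,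
      ‖ψ t s a - ζ t s a‖ ≤ C * remainderFn p γ (ω s t) := by
  obtain ⟨C, hC⟩ := h
  refine ⟨|C|, abs_nonneg C, fun s t hs hst ht a => ?_⟩
  rw [norm_sub_rev]
  refine (hC s t hs hst ht a).trans ?_
  have := remainderFn_nonneg (p := p) (γ := γ) (hω.nonneg s t hs hst ht)
  gcongr
  exact le_abs_self C

/-- Iterated products of any family in the galaxy of a Lipschitz semi-flow converge to it. -/
theorem iteratedProductsConverge {ψ ζ : ℝ → ℝ → E → E} {Λ : ℝ} (hω : IsControl T ω)
    (hp : 2 ≤ p) (hpγ : p < 2 + γ) (hψ : IsSemiFlow T ψ) (hL : IsForwardLipschitz T Λ ψ)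
    (hg : SameGalaxy T ω (remainderFn p γ) ζ ψ) : IteratedProductsConverge T ζ ψ := by
  obtain ⟨C, hC0, hC⟩ := hg.exists_nonneg hω
  intro ε hε
  obtain ⟨h, hh, H⟩ := exists_forall_norm_sub_iteratedProduct_le (E := E) hω hp hpγ hL.1 hC0 hε
  refine ⟨h, hh, fun π hπ hm s t hs hst ht a => ?_⟩
  rw [norm_sub_rev]
  exact H ψ ζ π hL.2 hC (fun u _ r t hr hru hut ht => hψ.2 r u t hr hru hut ht) hπ hm
    s t hs hst ht a

/-- A path that is a solution in the sense of Davie for a Lipschitz semi-flow follows it. -/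
theorem IsSemiFlow.eq_of_path {ψ : ℝ → ℝ → E → E} {Λ C : ℝ} (hω : IsControl T ω)
    (hp : 2 ≤ p) (hpγ : p < 2 + γ) (hT : 0 < T) (hψ : IsSemiFlow T ψ)
    (hL : IsForwardLipschitz T Λ ψ) {z : ℝ → E} {r t : ℝ} (hr : 0 ≤ r) (hrt : r ≤ t) (ht : t ≤ T)
    (hz : ∀ s t, r ≤ s → s ≤ t → t ≤ T → ‖z t - ψ t s (z s)‖ ≤ C * remainderFn p γ (ω s t)) :
    z t = ψ t r (z r) := by
  rw [← sub_eq_zero, ← norm_le_zero_iff]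
  refine le_of_forall_pos_le_add fun ε hε => ?_
  rw [zero_add]
  have hΛ : 0 < Λ := by linarith [hL.1]
  have hM : 0 < Λ * (|C| + 1) * (|ω 0 T| + 1) := by positivity
  obtain ⟨h, hh, H⟩ := exists_forall_remainderFn_le hω hp hpγ (div_pos hε hM)
  obtain ⟨π, hπ, hm⟩ := exists_isPartition_meshLE hT hh
  set c := ε / (Λ * (|C| + 1) * (|ω 0 T| + 1)) with hc
  have hc0 : 0 < c := div_pos hε hM
  have hsteps := (IsSteps.imp (R' := fun u v => u ≤ v ∧ ‖z v - ψ v u (z u)‖ ≤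
      (|C| * c) * ω u v) (a := r) (b := t) (fun u v hu huv hv huv' => ⟨huv, by
        refine (hz u v hu huv (hv.trans ht)).trans ?_
        have := remainderFn_nonneg (p := p) (γ := γ)
          (hω.nonneg u v (hr.trans hu) huv (hv.trans ht))
        rw [mul_assoc]
        gcongr
        · exact le_abs_self C
        · exact H u v (hr.trans hu) huv (hv.trans ht) huv'.2⟩) (fun _ _ h => h.1) le_rfl le_rfl
    (isSteps_pointsIn_of_meshLE hπ hm hh.le hr hrt ht)).2
  refine (norm_sub_path_le hω hL.1 (by positivity) ht
    (fun s hs hst => hL.2 s t hs hst ht) (fun s u hs hsu hut => hψ.2 s u t hs hsu hut ht) z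
    (pointsIn π r t) r hr hsteps).trans ?_
  have m : ω r t ≤ |ω 0 T| := (hω.mono le_rfl hr hrt ht le_rfl).trans (le_abs_self _)
  have m0 := hω.nonneg r t hr hrt ht
  calc Λ * (|C| * c) * ω r t ≤ Λ * ((|C| + 1) * c) * (|ω 0 T| + 1) := by gcongr <;> linarith
    _ = Λ * (|C| + 1) * (|ω 0 T| + 1) * c := by ring
    _ = ε := by rw [hc]; field_simp

/-- A Lipschitz semi-flow is the only semi-flow of its galaxy. -/
theorem IsSemiFlow.unique {ψ ψ' ζ : ℝ → ℝ → E → E} {Λ : ℝ} (hω : IsControl T ω)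
    (hp : 2 ≤ p) (hpγ : p < 2 + γ) (hT : 0 < T) (hψ : IsSemiFlow T ψ)
    (hL : IsForwardLipschitz T Λ ψ) (hg : SameGalaxy T ω (remainderFn p γ) ζ ψ)
    (hψ' : IsSemiFlow T ψ') (hg' : SameGalaxy T ω (remainderFn p γ) ζ ψ') {s t : ℝ}
    (hs : 0 ≤ s) (hst : s ≤ t) (ht : t ≤ T) : ψ' t s = ψ t s := by
  obtain ⟨C, hC0, hC⟩ := hg.exists_nonneg hω
  obtain ⟨C', hC0', hC'⟩ := hg'.exists_nonneg hω
  funext a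
  -- A trajectory of ψ' has increments O(ϖ) from those of ζ, hence from those of ψ.
  have := hψ.eq_of_path hω hp hpγ hT hL (z := fun u => ψ' u s a) (C := C' + C) hs hst ht
    (fun u v hu huv hv => by
      rw [← hψ'.2 s u v hs hu huv hv a, add_mul]
      refine (norm_sub_le_norm_sub_add_norm_sub _ (ζ v u (ψ' u s a)) _).trans
        (add_le_add (hC' u v (hs.trans hu) huv hv _) ?_)
      rw [norm_sub_rev]
      exact hC u v (hs.trans hu) huv hv _)
  simpa [hψ'.1 s hs (hst.trans ht)] using this

/-- A Lipschitz semi-flow is a manifold of solutions for each family of its galaxy. -/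
theorem IsSemiFlow.isManifoldOfSolutions {ψ ζ : ℝ → ℝ → E → E} (hω : IsControl T ω)
    (hψ : IsSemiFlow T ψ) (hg : SameGalaxy T ω (remainderFn p γ) ζ ψ) :
    IsManifoldOfSolutions T ω (remainderFn p γ) ζ (fun r t => ψ t r) := by
  obtain ⟨C, -, hC⟩ := hg.exists_nonneg hω
  intro r hr hrT a
  refine ⟨hψ.1 r hr hrT a, C, fun s t hrs hst ht => ?_⟩
  simp only
  rw [← hψ.2 r s t hr hrs hst ht a]
  exact hC s t (hr.trans hrs) hst ht _

/-- The constant in the definition of a solution may depend on r and a. This is harmless, since each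
path is compared with ψ separately. -/
theorem IsManifoldOfSolutions.eq_semiFlow {ψ ζ y : ℝ → ℝ → E → E} {Λ : ℝ} (hω : IsControl T ω)
    (hp : 2 ≤ p) (hpγ : p < 2 + γ) (hT : 0 < T) (hψ : IsSemiFlow T ψ)
    (hL : IsForwardLipschitz T Λ ψ) (hg : SameGalaxy T ω (remainderFn p γ) ζ ψ)
    (hy : IsManifoldOfSolutions T ω (remainderFn p γ) ζ y) {r t : ℝ}
    (hr : 0 ≤ r) (hrt : r ≤ t) (ht : t ≤ T) : y r t = ψ t r := by
  obtain ⟨C, -, hC⟩ := hg.exists_nonneg hω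
  funext a
  obtain ⟨h0, C', hC'⟩ := hy r hr (hrt.trans ht) a
  have := hψ.eq_of_path hω hp hpγ hT hL (z := fun u => y r u a) (C := C' + C) hr hrt ht
    (fun u v hu huv hv => by
      rw [add_mul]
      refine (norm_sub_le_norm_sub_add_norm_sub _ (ζ v u (y r u a)) _).trans
        (add_le_add (hC' u v hu huv hv) ?_)
      rw [norm_sub_rev]
      exact hC u v (hr.trans hu) huv hv _)
  simpa [h0] using this

end Convergence

/-! ### Inversion of maps close to the identity. -/

section Inversion

variable {E : Type*} [NormedAddCommGroup E] [NormedSpace ℝ E] [CompleteSpace E]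

/-- A map close to the identity in the Lipschitz norm is a bijection with a Lipschitz inverse. -/
theorem bijective_of_norm_sub_sub_sub_le {F : E → E}
    (h : ∀ a b, ‖F a - F b - (a - b)‖ ≤ 1 / 2 * ‖a - b‖) :
    Function.Bijective F ∧ ∀ a b, ‖a - b‖ ≤ 2 * ‖F a - F b‖ := by
  have hanti : ∀ a b, ‖a - b‖ ≤ 2 * ‖F a - F b‖ := fun a b => by
    have h1 := norm_le_norm_sub_add (a - b) (F a - F b)
    rw [norm_sub_rev (a - b)] at h1
    linarith [h a b]
  refine ⟨⟨fun a b hab => ?_, ?_⟩, hanti⟩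
  · have := hanti a b
    rw [hab, sub_self, norm_zero, mul_zero] at this
    exact sub_eq_zero.1 (norm_le_zero_iff.1 this)
  · have hF : ApproximatesLinearOn F ((ContinuousLinearEquiv.refl ℝ E : E ≃L[ℝ] E) : E →L[ℝ] E)
        univ (1 / 2) := fun a _ b _ => by simpa using h a b
    refine hF.surjective ?_
    -- The criterion compares 1/2 with the inverse of the norm of the identity, which is 1 only on a
    -- nontrivial space.
    rcases subsingleton_or_nontrivial E with hE | hE
    · exact Or.inl hE
    · right
      have : ‖(((ContinuousLinearEquiv.refl ℝ E).symm : E ≃L[ℝ] E) : E →L[ℝ] E)‖₊ = 1 :=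
        ContinuousLinearMap.nnnorm_id
      rw [this]
      norm_num

end Inversion

/-! ### Construction of the semi-flow. -/

namespace IsSmoothAlmostFlow

variable {E : Type*} [NormedAddCommGroup E] [NormedSpace ℝ E]
variable {T p γ K : ℝ} {ω : ℝ → ℝ → ℝ} {φ : ℝ → ℝ → E → E}

/-- Below the threshold W this is the local estimate; above it ϖ(ω) ≥ ϖ(W) > 0, and the uniform
distance to the identity suffices. -/
theorem exists_galaxy_bound (h : IsSmoothAlmostFlow T ω p γ K φ) (hω : IsControl T ω)
    (hp : 2 ≤ p) (hγ : 0 < γ) (hpγ : p < 2 + γ) :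
    ∃ C ≥ 0, ∀ l s t, 0 ≤ s → t ≤ T → IsSteps (· ≤ ·) l s t →
      ∀ a, ‖compAlong φ l s t a - φ t s a‖ ≤ C * remainderFn p γ (ω s t) := by
  obtain ⟨W, hW, L, hL, H⟩ := h.exists_local_bounds hω hp hγ hpγ
  obtain ⟨Λ, hΛ, B, hB, H'⟩ := h.exists_global_bounds hω hp hγ hpγ
  have hRW : 0 < remainderFn p γ W := by unfold remainderFn; positivity
  refine ⟨L + 2 * B / remainderFn p γ W, by positivity, fun l s t hs ht hst a => ?_⟩
  have h0 := hω.nonneg s t hs hst.le ht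
  have hR0 := remainderFn_nonneg (p := p) (γ := γ) h0
  rcases le_total (ω s t) W with hc | hc
  · refine ((H l s t hs ht hst hc).1 a).trans ?_
    gcongr
    have : 0 ≤ 2 * B / remainderFn p γ W := by positivity
    linarith
  · have h1 := (H' l s t hs ht hst).2 a
    have h2 : ‖φ t s a - a‖ ≤ B := (H' [] s t hs ht hst.le).2 a
    have h3 := remainderFn_mono (p := p) hp hγ hW.le hc
    have h4 : ‖compAlong φ l s t a - φ t s a‖ ≤ 2 * B := by
      have := norm_sub_le_norm_sub_add_norm_sub (compAlong φ l s t a) a (φ t s a)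
      rw [norm_sub_rev a] at this
      linarith
    calc _ ≤ 2 * B / remainderFn p γ W * remainderFn p γ W := by
          rw [div_mul_cancel₀ _ hRW.ne']; exact h4
      _ ≤ (L + 2 * B / remainderFn p γ W) * remainderFn p γ (ω s t) := by
          gcongr
          linarith

/-- Iterated products converge along the directed set of all finite sets of times. -/
theorem exists_tendsto_iteratedProduct [CompleteSpace E] (h : IsSmoothAlmostFlow T ω p γ K φ)
    (hω : IsControl T ω) (hp : 2 ≤ p) (hγ : 0 < γ) (hpγ : p < 2 + γ) (hT : 0 < T) {s t : ℝ}
    (hs : 0 ≤ s) (hst : s ≤ t) (ht : t ≤ T) (a : E) :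
    ∃ x, Tendsto (fun π : Finset ℝ => iteratedProduct φ π t s a) atTop (𝓝 x) := by
  obtain ⟨Λ, hΛ, B, hB, H⟩ := h.exists_global_bounds hω hp hγ hpγ
  obtain ⟨C, hC, H'⟩ := h.exists_galaxy_bound hω hp hγ hpγ
  refine cauchySeq_tendsto_of_complete (Metric.cauchySeq_iff'.2 fun ε hε => ?_)
  obtain ⟨d, hd, Hd⟩ := exists_forall_norm_sub_iteratedProduct_le (E := E) hω hp hpγ hΛ hC
    (half_pos hε)
  obtain ⟨π₀, hπ₀, hm⟩ := exists_isPartition_meshLE hT hd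
  refine ⟨π₀, fun π hπ => ?_⟩
  have hsteps : ∀ s t, s ≤ t → IsSteps (· ≤ ·) (pointsIn π s t) s t := fun s t hst =>
    isSteps_pointsIn π hst fun _ _ _ huv _ _ => huv
  rw [dist_eq_norm]
  -- The role of the Lipschitz family is played by the product along π ⊇ π₀, which composes at every
  -- point of π₀. The mesh depends only on Λ and C, so one π₀ serves all its refinements.
  refine (Hd (fun t s => iteratedProduct φ π t s) φ π₀ ?_ ?_ ?_ hπ₀ hm s t hs hst ht a).trans_lt
    (half_lt_self hε)
  · exact fun s t hs hst ht => (H _ s t hs ht (hsteps s t hst)).1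
  · exact fun s t hs hst ht => H' _ s t hs ht (hsteps s t hst)
  · exact fun u hu r t hr hru hut ht a => iteratedProduct_comp (hπ hu) hru hut
      (h.self u (hr.trans hru) (hut.trans ht)) a

/-- The semi-flow in the galaxy of a smooth almost flow. -/
theorem exists_semiFlow [CompleteSpace E] (h : IsSmoothAlmostFlow T ω p γ K φ)
    (hω : IsControl T ω) (hp : 2 ≤ p) (hγ : 0 < γ) (hpγ : p < 2 + γ) (hT : 0 < T) :
    ∃ ψ : ℝ → ℝ → E → E, IsSemiFlow T ψ ∧ (∃ Λ, IsForwardLipschitz T Λ ψ) ∧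
      SameGalaxy T ω (remainderFn p γ) φ ψ ∧ ∃ W > 0, ∀ s t, 0 ≤ s → s ≤ t → t ≤ T → ω s t ≤ W →
        ∀ a b, ‖ψ t s a - ψ t s b - (a - b)‖ ≤ 1 / 2 * ‖a - b‖ := by
  obtain ⟨Λ, hΛ, B, hB, H⟩ := h.exists_global_bounds hω hp hγ hpγ
  obtain ⟨C, hC, H'⟩ := h.exists_galaxy_bound hω hp hγ hpγ
  obtain ⟨W, hW, _, -, HW⟩ := h.exists_local_bounds hω hp hγ hpγ
  have hsteps : ∀ (π : Finset ℝ) {s t : ℝ}, s ≤ t → IsSteps (· ≤ ·) (pointsIn π s t) s t :=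
    fun π s t hst => isSteps_pointsIn π hst fun _ _ _ huv _ _ => huv
  have hlip : ∀ (π : Finset ℝ) s t, 0 ≤ s → s ≤ t → t ≤ T → ∀ a b,
      ‖iteratedProduct φ π t s a - iteratedProduct φ π t s b‖ ≤ Λ * ‖a - b‖ :=
    fun π s t hs hst ht => (H _ s t hs ht (hsteps π hst)).1
  have hex : ∀ t s a, ∃ x, 0 ≤ s → s ≤ t → t ≤ T →
      Tendsto (fun π : Finset ℝ => iteratedProduct φ π t s a) atTop (𝓝 x) := by
    intro t s a
    by_cases hc : 0 ≤ s ∧ s ≤ t ∧ t ≤ T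
    · obtain ⟨x, hx⟩ := h.exists_tendsto_iteratedProduct hω hp hγ hpγ hT hc.1 hc.2.1 hc.2.2 a
      exact ⟨x, fun _ _ _ => hx⟩
    · exact ⟨a, fun h1 h2 h3 => absurd ⟨h1, h2, h3⟩ hc⟩
  choose ψ hψ using hex
  have hψlip : ∀ s t, 0 ≤ s → s ≤ t → t ≤ T → ∀ a b, ‖ψ t s a - ψ t s b‖ ≤ Λ * ‖a - b‖ :=
    fun s t hs hst ht a b => le_of_tendsto
      ((hψ t s a hs hst ht).sub (hψ t s b hs hst ht)).norm
      (Eventually.of_forall fun π => hlip π s t hs hst ht a b)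
  refine ⟨ψ, ⟨fun t ht0 ht a => ?_, fun r s t hr hrs hst ht a => ?_⟩, ⟨Λ, hΛ, hψlip⟩,
    ⟨C, fun s t hs hst ht a => ?_⟩, W, hW, fun s t hs hst ht hWω a b => ?_⟩
  · refine tendsto_nhds_unique (hψ t t a ht0 le_rfl ht) (tendsto_const_nhds.congr fun π => ?_)
    rw [iteratedProduct_self (h.self t ht0 ht)]
  · have h1 := hψ s r a hr hrs (hst.trans ht)
    have h2 := hψ t s (ψ s r a) (hr.trans hrs) hst ht
    have h3 := hψ t r a hr (hrs.trans hst) ht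
    -- The common Lipschitz constant of the products allows the inner product to be replaced by its
    -- limit.
    have h4 : Tendsto (fun π : Finset ℝ => iteratedProduct φ π t s (iteratedProduct φ π s r a) -
        iteratedProduct φ π t s (ψ s r a)) atTop (𝓝 0) := by
      refine squeeze_zero_norm (fun π => hlip π s t (hr.trans hrs) hst ht _ _) ?_
      have := ((h1.sub_const (ψ s r a)).norm).const_mul Λ
      simpa using this
    have h5 := h4.add h2
    simp only [sub_add_cancel, zero_add] at h5
    refine tendsto_nhds_unique (h5.congr' ?_) h3
    -- Along the directed set of finite sets every given time s eventually belongs to π, so the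
    -- composition rule at s is exact before the limit.
    filter_upwards [eventually_ge_atTop ({s} : Finset ℝ)] with π hπ
    exact iteratedProduct_comp (hπ (by simp)) hrs hst (h.self s (hr.trans hrs) (hst.trans ht)) a
  · refine le_of_tendsto ((hψ t s a hs hst ht).const_sub (φ t s a)).norm
      (Eventually.of_forall fun π => ?_)
    rw [norm_sub_rev]
    exact H' _ s t hs ht (hsteps π hst) a
  · exact le_of_tendsto
      (((hψ t s a hs hst ht).sub (hψ t s b hs hst ht)).sub_const (a - b)).norm
      (Eventually.of_forall fun π => (HW _ s t hs ht (hsteps π hst) hWω).2 a b)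

end IsSmoothAlmostFlow

/-! ### From the semi-flow to the flow. -/

section Flow

variable {E : Type*} [NormedAddCommGroup E] {T : ℝ}

/-- A semi-flow whose maps over short intervals are close to the identity in the Lipschitz norm
consists of bijections with uniformly Lipschitz inverses. -/
theorem IsSemiFlow.exists_forall_bijective [NormedSpace ℝ E] [CompleteSpace E]
    {ω : ℝ → ℝ → ℝ} (hω : IsControl T ω) (hT : 0 < T)
    {ψ : ℝ → ℝ → E → E} (hψ : IsSemiFlow T ψ) {W : ℝ} (hW : 0 < W)
    (h : ∀ s t, 0 ≤ s → s ≤ t → t ≤ T → ω s t ≤ W →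
      ∀ a b, ‖ψ t s a - ψ t s b - (a - b)‖ ≤ 1 / 2 * ‖a - b‖) :
    ∃ N, ∀ s t, 0 ≤ s → s ≤ t → t ≤ T → Function.Bijective (ψ t s) ∧
      ∀ a b, ‖a - b‖ ≤ N * ‖ψ t s a - ψ t s b‖ := by
  obtain ⟨d, hd, Hd⟩ := hω.exists_forall_sub_le hW
  obtain ⟨π, hπ, hm⟩ := exists_isPartition_meshLE hT hd
  have key : ∀ (t : ℝ), t ≤ T → ∀ (l : List ℝ) (s : ℝ), 0 ≤ s →
      IsSteps (fun u v => u ≤ v ∧ v - u ≤ d) l s t → Function.Bijective (ψ t s) ∧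
      ∀ a b, ‖a - b‖ ≤ 2 ^ (l.length + 1) * ‖ψ t s a - ψ t s b‖ := by
    intro t ht l
    induction l with
    | nil =>
      intro s hs hst
      simpa using bijective_of_norm_sub_sub_sub_le
        (h s t hs hst.1 ht (Hd s t hs hst.1 ht hst.2))
    | cons u l ih =>
      intro s hs hst
      have hsu := hst.1.1
      have hut : u ≤ t := (IsSteps.imp (R' := (· ≤ ·)) (fun _ _ _ h _ _ => h) (fun _ _ h => h.1)
        le_rfl le_rfl hst.2).1
      obtain ⟨b1, e1⟩ := bijective_of_norm_sub_sub_sub_le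
        (h s u hs hsu (hut.trans ht) (Hd s u hs hsu (hut.trans ht) hst.1.2))
      obtain ⟨b2, e2⟩ := ih u (hs.trans hsu) hst.2
      have hcomp : ψ t s = ψ t u ∘ ψ u s := funext fun a => (hψ.2 s u t hs hsu hut ht a).symm
      rw [hcomp]
      refine ⟨b2.comp b1, fun a b => (e1 a b).trans ?_⟩
      calc 2 * ‖ψ u s a - ψ u s b‖
          ≤ 2 * (2 ^ (l.length + 1) * ‖ψ t u (ψ u s a) - ψ t u (ψ u s b)‖) := by
            gcongr; exact e2 _ _
        _ = _ := by simp only [List.length_cons, Function.comp]; ring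
  -- A single fine partition serves all s ≤ t, so the number of short factors, each of inverse
  -- Lipschitz constant 2, is bounded.
  refine ⟨2 ^ (π.card + 1), fun s t hs hst ht => ?_⟩
  obtain ⟨k1, k2⟩ := key t ht _ s hs (isSteps_pointsIn_of_meshLE hπ hm hd.le hs hst ht)
  refine ⟨k1, fun a b => (k2 a b).trans ?_⟩
  gcongr
  · norm_num
  · exact length_pointsIn_le π s t

/-- A semi-flow of bijections extends to a flow. -/
theorem IsSemiFlow.exists_isFlow {ψ : ℝ → ℝ → E → E} (hψ : IsSemiFlow T ψ) {Λ N : ℝ}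
    (hL : IsForwardLipschitz T Λ ψ)
    (hb : ∀ s t, 0 ≤ s → s ≤ t → t ≤ T → Function.Bijective (ψ t s) ∧
      ∀ a b, ‖a - b‖ ≤ N * ‖ψ t s a - ψ t s b‖) :
    ∃ Ψ : ℝ → ℝ → E → E, IsFlow T Ψ ∧ IsLipschitzFamily T Ψ ∧ ∀ s t, s ≤ t → Ψ t s = ψ t s := by
  classical
  let Ψ : ℝ → ℝ → E → E := fun t s => if s ≤ t then ψ t s else Function.invFun (ψ s t)
  have e1 : ∀ s t, s ≤ t → Ψ t s = ψ t s := fun s t hst => if_pos hst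
  have hl : ∀ s t, 0 ≤ s → s ≤ t → t ≤ T → Function.LeftInverse (Ψ s t) (ψ t s) := by
    intro s t hs hst ht
    rcases hst.eq_or_lt with rfl | hst'
    · intro a
      rw [e1 s s le_rfl, hψ.1 s hs ht, hψ.1 s hs ht]
    · have : Ψ s t = Function.invFun (ψ t s) := if_neg (not_le.2 hst')
      rw [this]
      exact Function.leftInverse_invFun (hb s t hs hst ht).1.1
  have hr : ∀ s t, 0 ≤ s → s ≤ t → t ≤ T → Function.RightInverse (Ψ s t) (ψ t s) := by
    intro s t hs hst ht
    exact (hl s t hs hst ht).rightInverse_of_surjective (hb s t hs hst ht).1.2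
  refine ⟨Ψ, ⟨⟨fun t ht0 ht a => ?_, fun r s t hr hrs hst ht a => ?_⟩,
    fun r s t ht hts hsr hrT a => ?_, fun s t hs hst ht => ?_⟩, ⟨max Λ N, ?_⟩, e1⟩
  · rw [e1 t t le_rfl]; exact hψ.1 t ht0 ht a
  · rw [e1 s t hst, e1 r s hrs, e1 r t (hrs.trans hst)]
    exact hψ.2 r s t hr hrs hst ht a
  · refine (hb t r ht (hts.trans hsr) hrT).1.1 ?_
    rw [hr t r ht (hts.trans hsr) hrT a, ← hψ.2 t s r ht hts hsr hrT,
      hr t s ht hts (hsr.trans hrT), hr s r (ht.trans hts) hsr hrT]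
  · rw [e1 s t hst]
    exact ⟨hl s t hs hst ht, hr s t hs hst ht⟩
  · intro s hs t ht a b
    rcases le_total s t with hst | hts
    · rw [e1 s t hst]
      refine (hL.2 s t hs.1 hst ht.2 a b).trans ?_
      gcongr
      exact le_max_left _ _
    · have := (hb t s ht.1 hts hs.2).2 (Ψ t s a) (Ψ t s b)
      rw [hr t s ht.1 hts hs.2, hr t s ht.1 hts hs.2] at this
      refine this.trans ?_
      gcongr
      exact le_max_right _ _

/-- The Lipschitz flow in the galaxy of a smooth almost flow. -/
theorem IsSmoothAlmostFlow.exists_flow [NormedSpace ℝ E] [CompleteSpace E] {ω : ℝ → ℝ → ℝ} {p γ K : ℝ} {φ : ℝ → ℝ → E → E}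
    (h : IsSmoothAlmostFlow T ω p γ K φ) (hω : IsControl T ω) (hp : 2 ≤ p) (hγ : 0 < γ)
    (hpγ : p < 2 + γ) (hT : 0 < T) :
    ∃ ψ : ℝ → ℝ → E → E, IsFlow T ψ ∧ IsLipschitzFamily T ψ ∧
      SameGalaxy T ω (remainderFn p γ) φ ψ := by
  obtain ⟨ψ, hψ, ⟨Λ, hΛ⟩, ⟨C, hC⟩, W, hW, hloc⟩ := h.exists_semiFlow hω hp hγ hpγ hT
  obtain ⟨N, hN⟩ := hψ.exists_forall_bijective hω hT hW hloc
  obtain ⟨Ψ, h1, h2, h3⟩ := hψ.exists_isFlow hΛ hN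
  exact ⟨Ψ, h1, h2, C, fun s t hs hst ht a => by rw [h3 s t hst]; exact hC s t hs hst ht a⟩

end Flow

/-! ### Quantitative Hölder classes. -/

section Bounds

variable {E : Type*} [NormedAddCommGroup E] [NormedSpace ℝ E]

/-- Quantitative `C^{1+γ}_b` bounds: `C` bounds the map, its derivative, and the `γ`-Hölder
seminorm of the derivative. -/
structure HasC1Bounds (γ C : ℝ) (G : E → E) : Prop where
  differentiable : Differentiable ℝ G
  norm_le : ∀ a, ‖G a‖ ≤ C
  norm_fderiv_le : ∀ a, ‖fderiv ℝ G a‖ ≤ C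
  holder : ∀ a b, ‖fderiv ℝ G a - fderiv ℝ G b‖ ≤ C * ‖a - b‖ ^ γ

/-- Quantitative `C^{2+γ}_b` bounds: `C` bounds the map, its derivatives up to order 2, and the
`γ`-Hölder seminorm of the second derivative. -/
structure HasC2Bounds (γ C : ℝ) (F : E → E) : Prop where
  differentiable : Differentiable ℝ F
  differentiable_fderiv : Differentiable ℝ (fderiv ℝ F)
  symm : ∀ a h k, fderiv ℝ (fderiv ℝ F) a h k = fderiv ℝ (fderiv ℝ F) a k h
  norm_le : ∀ a, ‖F a‖ ≤ C
  norm_fderiv_le : ∀ a, ‖fderiv ℝ F a‖ ≤ C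
  norm_fderiv_fderiv_le : ∀ a, ‖fderiv ℝ (fderiv ℝ F) a‖ ≤ C
  holder : ∀ a b, ‖fderiv ℝ (fderiv ℝ F) a - fderiv ℝ (fderiv ℝ F) b‖ ≤ C * ‖a - b‖ ^ γ

variable {γ : ℝ}

theorem norm_sub_le_of_norm_fderiv_le {H : Type*} [NormedAddCommGroup H] [NormedSpace ℝ H]
    {F : E → H} {C : ℝ} (hF : Differentiable ℝ F) (h : ∀ a, ‖fderiv ℝ F a‖ ≤ C) (a b : E) :
    ‖F a - F b‖ ≤ C * ‖a - b‖ :=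
  convex_univ.norm_image_sub_le_of_norm_fderiv_le (fun x _ => hF x) (fun x _ => h x)
    (mem_univ b) (mem_univ a)

theorem norm_taylor_le {H : Type*} [NormedAddCommGroup H] [NormedSpace ℝ H]
    {F : E → H} {C : ℝ} (hF : Differentiable ℝ F) {a b : E}
    (h : ∀ x, ‖x - a‖ ≤ ‖b - a‖ → ‖fderiv ℝ F x - fderiv ℝ F a‖ ≤ C) :
    ‖F b - F a - fderiv ℝ F a (b - a)‖ ≤ C * ‖b - a‖ := by
  refine (convex_closedBall a ‖b - a‖).norm_image_sub_le_of_norm_fderiv_le'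
    (fun x _ => hF x) (fun x hx => h x ?_) (Metric.mem_closedBall_self (norm_nonneg _)) ?_
  · rwa [mem_closedBall_iff_norm] at hx
  · rw [mem_closedBall_iff_norm]

/-- Bounded Lipschitz quantities are Hölder. -/
theorem le_mul_rpow_of_le_of_le_mul {x C d γ : ℝ} (hγ : 0 < γ) (hγ1 : γ ≤ 1) (hC : 0 ≤ C)
    (hd : 0 ≤ d) (h1 : x ≤ C) (h2 : x ≤ C * d) : x ≤ C * d ^ γ := by
  rcases le_total d 1 with h | h
  · refine h2.trans ?_
    gcongr
    simpa using Real.rpow_le_rpow_of_exponent_ge' hd h hγ.le hγ1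
  · refine h1.trans ?_
    have : 1 ≤ d ^ γ := Real.one_le_rpow h hγ.le
    nlinarith

namespace HasC1Bounds

theorem mono {C C' : ℝ} {G : E → E} (h : HasC1Bounds γ C G) (hC : C ≤ C') :
    HasC1Bounds γ C' G where
  differentiable := h.differentiable
  norm_le a := (h.norm_le a).trans hC
  norm_fderiv_le a := (h.norm_fderiv_le a).trans hC
  holder a b := (h.holder a b).trans (by gcongr)

theorem zero : HasC1Bounds γ 0 (fun _ : E => (0 : E)) where
  differentiable := differentiable_const _
  norm_le a := by simp
  norm_fderiv_le a := by simp
  holder a b := by simp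

theorem add {C C' : ℝ} {G G' : E → E} (h : HasC1Bounds γ C G) (h' : HasC1Bounds γ C' G') :
    HasC1Bounds γ (C + C') (fun a => G a + G' a) := by
  have e : fderiv ℝ (fun a => G a + G' a) = fun a => fderiv ℝ G a + fderiv ℝ G' a :=
    funext fun a => fderiv_fun_add (h.differentiable a) (h'.differentiable a)
  refine ⟨h.differentiable.add h'.differentiable,
    fun a => norm_add_le_of_le (h.norm_le a) (h'.norm_le a), fun a => ?_, fun a b => ?_⟩
  · rw [e]; exact norm_add_le_of_le (h.norm_fderiv_le a) (h'.norm_fderiv_le a)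
  · simp only [e]
    rw [add_sub_add_comm, add_mul]
    exact norm_add_le_of_le (h.holder a b) (h'.holder a b)

theorem const_smul {C : ℝ} {G : E → E} (h : HasC1Bounds γ C G) (c : ℝ) :
    HasC1Bounds γ (|c| * C) (fun a => c • G a) := by
  have e : fderiv ℝ (fun a => c • G a) = fun a => c • fderiv ℝ G a :=
    funext fun a => fderiv_fun_const_smul (h.differentiable a) c
  refine ⟨h.differentiable.const_smul c, fun a => ?_, fun a => ?_, fun a b => ?_⟩
  · rw [norm_smul, Real.norm_eq_abs]; gcongr; exact h.norm_le a
  · rw [e, norm_smul, Real.norm_eq_abs]; gcongr; exact h.norm_fderiv_le a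
  · simp only [e]
    rw [← smul_sub, norm_smul, Real.norm_eq_abs, mul_assoc]
    gcongr
    exact h.holder a b

theorem sum {ι : Type*} (s : Finset ι) {C : ℝ} {G : ι → E → E}
    (h : ∀ i ∈ s, HasC1Bounds γ C (G i)) : HasC1Bounds γ (s.card * C) (fun a => ∑ i ∈ s, G i a) := by
  classical
  induction s using Finset.induction_on with
  | empty => simpa using zero
  | insert i s hi ih =>
    have := (h i (by simp)).add (ih fun j hj => h j (by simp [hj]))
    simp only [Finset.sum_insert hi, Finset.card_insert_of_notMem hi]
    refine this.mono ?_
    push_cast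
    linarith

end HasC1Bounds

namespace HasC2Bounds

theorem mono {C C' : ℝ} {F : E → E} (h : HasC2Bounds γ C F) (hC : C ≤ C') :
    HasC2Bounds γ C' F where
  differentiable := h.differentiable
  differentiable_fderiv := h.differentiable_fderiv
  symm := h.symm
  norm_le a := (h.norm_le a).trans hC
  norm_fderiv_le a := (h.norm_fderiv_le a).trans hC
  norm_fderiv_fderiv_le a := (h.norm_fderiv_fderiv_le a).trans hC
  holder a b := (h.holder a b).trans (by gcongr)

theorem zero : HasC2Bounds γ 0 (fun _ : E => (0 : E)) := by
  have e : fderiv ℝ (fun _ : E => (0 : E)) = fun _ => 0 := funext fun a => by simp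
  refine ⟨differentiable_const _, ?_, ?_, ?_, ?_, ?_, ?_⟩ <;> simp [e]

theorem add {C C' : ℝ} {F F' : E → E} (h : HasC2Bounds γ C F) (h' : HasC2Bounds γ C' F') :
    HasC2Bounds γ (C + C') (fun a => F a + F' a) := by
  have e : fderiv ℝ (fun a => F a + F' a) = fun a => fderiv ℝ F a + fderiv ℝ F' a :=
    funext fun a => fderiv_fun_add (h.differentiable a) (h'.differentiable a)
  have e2 : fderiv ℝ (fun a => fderiv ℝ F a + fderiv ℝ F' a) =
      fun a => fderiv ℝ (fderiv ℝ F) a + fderiv ℝ (fderiv ℝ F') a :=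
    funext fun a => fderiv_fun_add (h.differentiable_fderiv a) (h'.differentiable_fderiv a)
  refine ⟨h.differentiable.add h'.differentiable, ?_, fun a u v => ?_,
    fun a => norm_add_le_of_le (h.norm_le a) (h'.norm_le a), fun a => ?_, fun a => ?_,
    fun a b => ?_⟩
  · rw [e]; exact h.differentiable_fderiv.add h'.differentiable_fderiv
  · simp only [e, e2, add_apply]
    rw [h.symm, h'.symm]
  · rw [e]; exact norm_add_le_of_le (h.norm_fderiv_le a) (h'.norm_fderiv_le a)
  · rw [e, e2]; exact norm_add_le_of_le (h.norm_fderiv_fderiv_le a) (h'.norm_fderiv_fderiv_le a)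
  · simp only [e, e2]
    rw [add_sub_add_comm, add_mul]
    exact norm_add_le_of_le (h.holder a b) (h'.holder a b)

theorem const_smul {C : ℝ} {F : E → E} (h : HasC2Bounds γ C F) (c : ℝ) :
    HasC2Bounds γ (|c| * C) (fun a => c • F a) := by
  have e : fderiv ℝ (fun a => c • F a) = fun a => c • fderiv ℝ F a :=
    funext fun a => fderiv_fun_const_smul (h.differentiable a) c
  have e2 : fderiv ℝ (fun a => c • fderiv ℝ F a) = fun a => c • fderiv ℝ (fderiv ℝ F) a :=
    funext fun a => fderiv_fun_const_smul (h.differentiable_fderiv a) c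
  refine ⟨h.differentiable.const_smul c, ?_, fun a u v => ?_, fun a => ?_, fun a => ?_,
    fun a => ?_, fun a b => ?_⟩
  · rw [e]; exact h.differentiable_fderiv.const_smul c
  · simp only [e, e2, smul_apply]
    rw [h.symm]
  · rw [norm_smul, Real.norm_eq_abs]; gcongr; exact h.norm_le a
  · rw [e, norm_smul, Real.norm_eq_abs]; gcongr; exact h.norm_fderiv_le a
  · rw [e, e2, norm_smul, Real.norm_eq_abs]; gcongr; exact h.norm_fderiv_fderiv_le a
  · simp only [e, e2]
    have e3 : c • fderiv ℝ (fderiv ℝ F) a - c • fderiv ℝ (fderiv ℝ F) b =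
        c • (fderiv ℝ (fderiv ℝ F) a - fderiv ℝ (fderiv ℝ F) b) := (smul_sub c _ _).symm
    rw [e3, norm_smul, Real.norm_eq_abs, mul_assoc]
    gcongr
    exact h.holder a b

theorem sum {ι : Type*} (s : Finset ι) {C : ℝ} {F : ι → E → E}
    (h : ∀ i ∈ s, HasC2Bounds γ C (F i)) : HasC2Bounds γ (s.card * C) (fun a => ∑ i ∈ s, F i a) := by
  classical
  induction s using Finset.induction_on with
  | empty => simpa using zero
  | insert i s hi ih =>
    have := (h i (by simp)).add (ih fun j hj => h j (by simp [hj]))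
    simp only [Finset.sum_insert hi, Finset.card_insert_of_notMem hi]
    refine this.mono ?_
    push_cast
    linarith

theorem nonneg {C : ℝ} {F : E → E} (h : HasC2Bounds γ C F) : 0 ≤ C :=
  (norm_nonneg _).trans (h.norm_le 0)

theorem norm_fderiv_sub_le {C : ℝ} {F : E → E} (h : HasC2Bounds γ C F) (a b : E) :
    ‖fderiv ℝ F a - fderiv ℝ F b‖ ≤ C * ‖a - b‖ :=
  norm_sub_le_of_norm_fderiv_le h.differentiable_fderiv h.norm_fderiv_fderiv_le a b

theorem norm_sub_le {C : ℝ} {F : E → E} (h : HasC2Bounds γ C F) (a b : E) :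
    ‖F a - F b‖ ≤ C * ‖a - b‖ :=
  norm_sub_le_of_norm_fderiv_le h.differentiable h.norm_fderiv_le a b

theorem norm_taylor_le {C : ℝ} {F : E → E} (h : HasC2Bounds γ C F) (a b : E) :
    ‖F b - F a - fderiv ℝ F a (b - a)‖ ≤ C * ‖b - a‖ ^ 2 := by
  rw [pow_two, ← mul_assoc]
  refine _root_.norm_taylor_le h.differentiable fun x hx => (h.norm_fderiv_sub_le x a).trans ?_
  have := h.nonneg
  gcongr

theorem norm_fderiv_taylor_le (hγ : 0 < γ) {C : ℝ} {F : E → E} (h : HasC2Bounds γ C F)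
    (a b : E) : ‖fderiv ℝ F b - fderiv ℝ F a - fderiv ℝ (fderiv ℝ F) a (b - a)‖ ≤
      C * ‖b - a‖ ^ γ * ‖b - a‖ := by
  refine _root_.norm_taylor_le h.differentiable_fderiv fun x hx => (h.holder x a).trans ?_
  have := h.nonneg
  gcongr

/-- The derivative of `a ↦ dF(a)(G a)`. -/
theorem hasFDerivAt_fderiv_apply {C : ℝ} {F G : E → E} (hF : HasC2Bounds γ C F)
    (hG : Differentiable ℝ G) (a : E) : HasFDerivAt (fun a => fderiv ℝ F a (G a))
      (fderiv ℝ (fderiv ℝ F) a (G a) + fderiv ℝ F a * fderiv ℝ G a) a := by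
  -- The product rule yields k ↦ d²F(a)(k)(G a); symmetry of the second derivative turns it into the
  -- operator d²F(a)(G a).
  have := (hF.differentiable_fderiv a).hasFDerivAt.clm_apply (hG a).hasFDerivAt
  refine this.congr_fderiv ?_
  ext k
  simp [hF.symm a k (G a), add_comm]

/-- Iterating two vector fields of class `C^{2+γ}_b` gives a field of class `C^{1+γ}_b`. -/
theorem fderiv_apply (hγ : 0 < γ) (hγ1 : γ ≤ 1) {C : ℝ} {F G : E → E} (hF : HasC2Bounds γ C F)
    (hG : HasC2Bounds γ C G) : HasC1Bounds γ (7 * C ^ 2) (fun a => fderiv ℝ F a (G a)) := by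
  have hC := hF.nonneg
  have e : ∀ a, fderiv ℝ (fun a => fderiv ℝ F a (G a)) a =
      fderiv ℝ (fderiv ℝ F) a (G a) + fderiv ℝ F a * fderiv ℝ G a :=
    fun a => (hF.hasFDerivAt_fderiv_apply hG.differentiable a).fderiv
  refine ⟨fun a => (hF.hasFDerivAt_fderiv_apply hG.differentiable a).differentiableAt,
    fun a => ?_, fun a => ?_, fun a b => ?_⟩
  · refine ((fderiv ℝ F a).le_of_opNorm_le_of_le (hF.norm_fderiv_le a) (hG.norm_le a)).trans ?_
    nlinarith
  · rw [e]
    refine (norm_add_le_of_le (ContinuousLinearMap.le_of_opNorm_le_of_le _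
      (hF.norm_fderiv_fderiv_le a) (hG.norm_le a)) ((norm_mul_le _ _).trans (mul_le_mul
      (hF.norm_fderiv_le a) (hG.norm_fderiv_le a) (norm_nonneg _) hC))).trans ?_
    nlinarith
  · rw [e, e]
    -- Quantities of size C with Lipschitz constant C are γ-Hölder with constant 2C, since two
    -- values differ by at most 2C.
    have holder_of : ∀ {H : Type _} [NormedAddCommGroup H] (x y : H), ‖x‖ ≤ C → ‖y‖ ≤ C →
        ‖x - y‖ ≤ C * ‖a - b‖ → ‖x - y‖ ≤ 2 * C * ‖a - b‖ ^ γ := by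
      intro H _ x y hx hy hxy
      refine le_mul_rpow_of_le_of_le_mul hγ hγ1 (by positivity) (norm_nonneg _) ?_ ?_
      · exact (_root_.norm_sub_le x y).trans (by linarith)
      · exact hxy.trans (by nlinarith [mul_nonneg hC (norm_nonneg (a - b))])
    have h1 := holder_of (G a) (G b) (hG.norm_le a) (hG.norm_le b) (hG.norm_sub_le a b)
    have h2 := holder_of (fderiv ℝ F a) (fderiv ℝ F b) (hF.norm_fderiv_le a)
      (hF.norm_fderiv_le b) (hF.norm_fderiv_sub_le a b)
    have h3 := holder_of (fderiv ℝ G a) (fderiv ℝ G b) (hG.norm_fderiv_le a)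
      (hG.norm_fderiv_le b) (hG.norm_fderiv_sub_le a b)
    have dec : fderiv ℝ (fderiv ℝ F) a (G a) + fderiv ℝ F a * fderiv ℝ G a -
        (fderiv ℝ (fderiv ℝ F) b (G b) + fderiv ℝ F b * fderiv ℝ G b) =
        (fderiv ℝ (fderiv ℝ F) a - fderiv ℝ (fderiv ℝ F) b) (G a) +
        fderiv ℝ (fderiv ℝ F) b (G a - G b) + (fderiv ℝ F a - fderiv ℝ F b) * fderiv ℝ G a +
        fderiv ℝ F b * (fderiv ℝ G a - fderiv ℝ G b) := by
      rw [map_sub, sub_apply]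
      noncomm_ring
    rw [dec]
    have hd : 0 ≤ ‖a - b‖ ^ γ := by positivity
    have b1 := ContinuousLinearMap.le_of_opNorm_le_of_le
      (fderiv ℝ (fderiv ℝ F) a - fderiv ℝ (fderiv ℝ F) b) (hF.holder a b) (hG.norm_le a)
    have b2 := ContinuousLinearMap.le_of_opNorm_le_of_le
      (fderiv ℝ (fderiv ℝ F) b) (hF.norm_fderiv_fderiv_le b) h1
    have b3 := (norm_mul_le (fderiv ℝ F a - fderiv ℝ F b) (fderiv ℝ G a)).trans
      (mul_le_mul h2 (hG.norm_fderiv_le a) (norm_nonneg _) (by positivity))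
    have b4 := (norm_mul_le (fderiv ℝ F b) (fderiv ℝ G a - fderiv ℝ G b)).trans
      (mul_le_mul (hF.norm_fderiv_le b) h3 (norm_nonneg _) hC)
    -- One term carries C² and three carry 2C²; this is the origin of 7 C².
    exact (norm_add_le_of_le (norm_add_le_of_le (norm_add_le_of_le b1 b2) b3) b4).trans_eq
      (by ring)

end HasC2Bounds

theorem IsCbHolder.exists_hasC2Bounds {f : E → E} (h : IsCbHolder 2 γ f) :
    ∃ C, HasC2Bounds γ C f := by
  obtain ⟨C₀, h0⟩ := h.bounded 0 (by norm_num)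
  obtain ⟨C₁, h1⟩ := h.bounded 1 (by norm_num)
  obtain ⟨C₂, h2⟩ := h.bounded 2 le_rfl
  obtain ⟨C₃, h3⟩ := h.holder
  have hC2 : ContDiff ℝ 2 f := h.contDiff
  have d1 : Differentiable ℝ f := hC2.differentiable (by norm_num)
  have d2 : Differentiable ℝ (fderiv ℝ f) :=
    (hC2.fderiv_right (m := 1) (by norm_num)).differentiable (by norm_num)
  set C := max (max C₀ C₁) (max C₂ C₃)
  have m0 : C₀ ≤ C := (le_max_left _ _).trans (le_max_left _ _)
  have m1 : C₁ ≤ C := (le_max_right _ _).trans (le_max_left _ _)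
  have m2 : C₂ ≤ C := (le_max_left _ _).trans (le_max_right _ _)
  have m3 : C₃ ≤ C := (le_max_right _ _).trans (le_max_right _ _)
  refine ⟨C, d1, d2, fun a u v => ?_, fun a => ?_, fun a => ?_, fun a => ?_, fun a b => ?_⟩
  · exact (hC2.contDiffAt.isSymmSndFDerivAt (by simp)).eq u v
  · have := h0 a
    rw [norm_iteratedFDeriv_zero] at this
    exact this.trans m0
  · have := h1 a
    rw [norm_iteratedFDeriv_one] at this
    exact this.trans m1
  · have hb := (h2 a).trans m2
    refine ContinuousLinearMap.opNorm_le_bound₂ _ ((norm_nonneg _).trans hb) fun u v => ?_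
    have e := (iteratedFDeriv ℝ 2 f a).le_opNorm ![u, v]
    rw [iteratedFDeriv_two_apply] at e
    simp only [Fin.prod_univ_two, Matrix.cons_val_zero, Matrix.cons_val_one] at e
    rw [← mul_assoc] at e
    exact e.trans (by gcongr)
  · have hb := (h3 a b).trans (mul_le_mul_of_nonneg_right m3 (by positivity))
    refine ContinuousLinearMap.opNorm_le_bound₂ _ ((norm_nonneg _).trans hb) fun u v => ?_
    have e := (iteratedFDeriv ℝ 2 f a - iteratedFDeriv ℝ 2 f b).le_opNorm ![u, v]
    rw [sub_apply, iteratedFDeriv_two_apply,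
      iteratedFDeriv_two_apply] at e
    simp only [Fin.prod_univ_two, Matrix.cons_val_zero, Matrix.cons_val_one] at e
    rw [← mul_assoc] at e
    simp only [sub_apply]
    exact e.trans (by gcongr)

end Bounds

/-! ### The local defect estimate. -/

section Defect

/-- As γ ≤ 1 and w stays bounded, genuine third order errors are absorbed into w^{2+γ}. -/
theorem pow_three_le {γ w M : ℝ} (hγ : 0 < γ) (hγ1 : γ ≤ 1) (hw : 0 ≤ w) (hwM : w ≤ M) :
    w ^ 3 ≤ max 1 M * w ^ (2 + γ) := by
  have e : w ^ 3 = w ^ (1 - γ) * w ^ (2 + γ) := by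
    rw [← Real.rpow_add_of_nonneg hw (by linarith) (by linarith), ← Real.rpow_natCast]
    norm_num
  rw [e]
  gcongr
  calc w ^ (1 - γ) ≤ (max 1 M) ^ (1 - γ) := by
        gcongr
        exact hwM.trans (le_max_right _ _)
    _ ≤ (max 1 M) ^ (1 : ℝ) := by
        gcongr
        · exact le_max_left _ _
        · linarith
    _ = max 1 M := Real.rpow_one _

variable {E : Type*} [NormedAddCommGroup E] [NormedSpace ℝ E]

/-- The defect to the semi-flow property, with its derivative, of `a ↦ a + F a + G a`. -/
theorem exists_defect_bound {γ : ℝ} (hγ : 0 < γ) (hγ1 : γ ≤ 1) {c M : ℝ} (hc : 0 ≤ c)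
    (hM : 0 ≤ M) : ∃ C ≥ 0, ∀ (F₁ F₂ G₁ G₂ : E → E) (w : ℝ), 0 ≤ w → w ≤ M →
      HasC2Bounds γ (c * w) F₁ → HasC2Bounds γ (c * w) F₂ →
      HasC1Bounds γ (c * w ^ 2) G₁ → HasC1Bounds γ (c * w ^ 2) G₂ → ∀ a,
      ‖F₂ (a + F₁ a + G₁ a) - F₂ a - fderiv ℝ F₂ a (F₁ a) + (G₂ (a + F₁ a + G₁ a) - G₂ a)‖ ≤
        C * w ^ (2 + γ) ∧
      ∃ D : E →L[ℝ] E, HasFDerivAt (fun a => F₂ (a + F₁ a + G₁ a) - F₂ a - fderiv ℝ F₂ a (F₁ a) +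
        (G₂ (a + F₁ a + G₁ a) - G₂ a)) D a ∧ ‖D‖ ≤ C * w ^ (2 + γ) := by
  obtain ⟨d, hd⟩ : ∃ d, d = c * (1 + M) := ⟨_, rfl⟩
  have hd0 : 0 ≤ d := by rw [hd]; positivity
  refine ⟨(c * d ^ 2 + 2 * c ^ 2 + c * d) * max 1 M + c * d ^ γ * d + c * d ^ γ, by positivity,
    fun F₁ F₂ G₁ G₂ w hw hwM hF₁ hF₂ hG₁ hG₂ a => ?_⟩
  have hw3 := pow_three_le hγ hγ1 hw hwM
  have hwγ : w ^ γ * w ^ 2 = w ^ (2 + γ) := by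
    rw [← Real.rpow_natCast w 2, ← Real.rpow_add_of_nonneg hw hγ.le (by norm_num)]
    norm_num [add_comm]
  have hw20 : (0 : ℝ) ≤ w ^ (2 + γ) := by positivity
  set b := a + F₁ a + G₁ a with hb
  have hba : b - a = F₁ a + G₁ a := by rw [hb]; abel
  have hsum : c * w + c * w ^ 2 ≤ d * w := by
    have : c * w ^ 2 ≤ c * w * M := by rw [pow_two, ← mul_assoc]; gcongr
    rw [hd]; linarith
  have hn : ‖b - a‖ ≤ d * w := by
    rw [hba]; exact (norm_add_le_of_le (hF₁.norm_le a) (hG₁.norm_le a)).trans hsum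
  have hnγ : ‖b - a‖ ^ γ ≤ d ^ γ * w ^ γ := by
    rw [← Real.mul_rpow hd0 hw]; gcongr
  have hcw : 0 ≤ c * w := by positivity
  have hcw2 : 0 ≤ c * w ^ 2 := by positivity
  constructor
  · have t1 := hF₂.norm_taylor_le a b
    have t2 := (fderiv ℝ F₂ a).le_of_opNorm_le_of_le (hF₂.norm_fderiv_le a) (hG₁.norm_le a)
    have t3 := norm_sub_le_of_norm_fderiv_le hG₂.differentiable hG₂.norm_fderiv_le b a
    -- With F of size w, G of size w² and b - a = O(w), each of the three terms is O(w³).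
    have dec : F₂ b - F₂ a - fderiv ℝ F₂ a (F₁ a) + (G₂ b - G₂ a) =
        (F₂ b - F₂ a - fderiv ℝ F₂ a (b - a)) + fderiv ℝ F₂ a (G₁ a) + (G₂ b - G₂ a) := by
      rw [hba, map_add]; abel
    rw [dec]
    refine (norm_add_le_of_le (norm_add_le_of_le t1 t2) t3).trans ?_
    have q1 : c * w * ‖b - a‖ ^ 2 ≤ c * w * (d * w) ^ 2 := by gcongr
    have q2 : c * w ^ 2 * ‖b - a‖ ≤ c * w ^ 2 * (d * w) := by gcongr
    calc _ ≤ c * w * (d * w) ^ 2 + c * w * (c * w ^ 2) + c * w ^ 2 * (d * w) := by linarith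
      _ ≤ (c * d ^ 2 + 2 * c ^ 2 + c * d) * w ^ 3 := by
        have : 0 ≤ c ^ 2 * w ^ 3 := by positivity
        linarith
      _ ≤ (c * d ^ 2 + 2 * c ^ 2 + c * d) * (max 1 M * w ^ (2 + γ)) := by gcongr
      _ ≤ _ := by
        have : 0 ≤ (c * d ^ γ * d + c * d ^ γ) * w ^ (2 + γ) := by positivity
        linarith
  · have hβ : HasFDerivAt (fun a => a + F₁ a + G₁ a) (1 + fderiv ℝ F₁ a + fderiv ℝ G₁ a) a :=
      ((hasFDerivAt_id a).add (hF₁.differentiable a).hasFDerivAt).add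
        (hG₁.differentiable a).hasFDerivAt
    have hD : HasFDerivAt (fun a => F₂ (a + F₁ a + G₁ a) - F₂ a - fderiv ℝ F₂ a (F₁ a) +
        (G₂ (a + F₁ a + G₁ a) - G₂ a))
        (fderiv ℝ F₂ b * (1 + fderiv ℝ F₁ a + fderiv ℝ G₁ a) - fderiv ℝ F₂ a -
          (fderiv ℝ (fderiv ℝ F₂) a (F₁ a) + fderiv ℝ F₂ a * fderiv ℝ F₁ a) +
          (fderiv ℝ G₂ b * (1 + fderiv ℝ F₁ a + fderiv ℝ G₁ a) - fderiv ℝ G₂ a)) a :=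
      (((((hF₂.differentiable b).hasFDerivAt.comp a hβ).sub
        (hF₂.differentiable a).hasFDerivAt).sub
        (hF₂.hasFDerivAt_fderiv_apply hF₁.differentiable a))).add
        (((hG₂.differentiable b).hasFDerivAt.comp a hβ).sub (hG₂.differentiable a).hasFDerivAt)
    refine ⟨_, hD, ?_⟩
    -- One derivative is lost: the Taylor remainder of dF₂ and the increment of dG₂ are only Hölder,
    -- of order w·w^γ·w and w²·w^γ, that is w^{2+γ}. The other terms are O(w³).
    have dec : fderiv ℝ F₂ b * (1 + fderiv ℝ F₁ a + fderiv ℝ G₁ a) - fderiv ℝ F₂ a -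
          (fderiv ℝ (fderiv ℝ F₂) a (F₁ a) + fderiv ℝ F₂ a * fderiv ℝ F₁ a) +
          (fderiv ℝ G₂ b * (1 + fderiv ℝ F₁ a + fderiv ℝ G₁ a) - fderiv ℝ G₂ a) =
        (fderiv ℝ F₂ b - fderiv ℝ F₂ a - fderiv ℝ (fderiv ℝ F₂) a (b - a)) +
        fderiv ℝ (fderiv ℝ F₂) a (G₁ a) +
        (fderiv ℝ F₂ b - fderiv ℝ F₂ a) * (fderiv ℝ F₁ a + fderiv ℝ G₁ a) +
        fderiv ℝ F₂ a * fderiv ℝ G₁ a + (fderiv ℝ G₂ b - fderiv ℝ G₂ a) +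
        fderiv ℝ G₂ b * (fderiv ℝ F₁ a + fderiv ℝ G₁ a) := by
      rw [hba, map_add]
      noncomm_ring
    rw [dec]
    have hX : ‖fderiv ℝ F₁ a + fderiv ℝ G₁ a‖ ≤ d * w :=
      (norm_add_le_of_le (hF₁.norm_fderiv_le a) (hG₁.norm_fderiv_le a)).trans hsum
    have hmul : ∀ {P Q : E →L[ℝ] E} {u v : ℝ}, ‖P‖ ≤ u → ‖Q‖ ≤ v → ‖P * Q‖ ≤ u * v :=
      fun hP hQ => (norm_mul_le _ _).trans
        (mul_le_mul hP hQ (norm_nonneg _) ((norm_nonneg _).trans hP))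
    have t1 := hF₂.norm_fderiv_taylor_le hγ a b
    have t1' : c * w * ‖b - a‖ ^ γ * ‖b - a‖ ≤ c * w * (d ^ γ * w ^ γ) * (d * w) := by gcongr
    have t2 := ContinuousLinearMap.le_of_opNorm_le_of_le (fderiv ℝ (fderiv ℝ F₂) a)
      (hF₂.norm_fderiv_fderiv_le a) (hG₁.norm_le a)
    have t3 : ‖fderiv ℝ F₂ b - fderiv ℝ F₂ a‖ ≤ c * w * (d * w) :=
      (hF₂.norm_fderiv_sub_le b a).trans (by gcongr)
    have t5 : ‖fderiv ℝ G₂ b - fderiv ℝ G₂ a‖ ≤ c * w ^ 2 * (d ^ γ * w ^ γ) :=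
      (hG₂.holder b a).trans (by gcongr)
    refine (norm_add_le_of_le (norm_add_le_of_le (norm_add_le_of_le (norm_add_le_of_le
      (norm_add_le_of_le (t1.trans t1') t2) (hmul t3 hX))
      (hmul (hF₂.norm_fderiv_le a) (hG₁.norm_fderiv_le a))) t5)
      (hmul (hG₂.norm_fderiv_le b) hX)).trans ?_
    calc _ = (c * d ^ 2 + 2 * c ^ 2 + c * d) * w ^ 3 +
          (c * d ^ γ * d + c * d ^ γ) * (w ^ γ * w ^ 2) := by ring
      _ ≤ (c * d ^ 2 + 2 * c ^ 2 + c * d) * (max 1 M * w ^ (2 + γ)) +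
          (c * d ^ γ * d + c * d ^ γ) * w ^ (2 + γ) := by rw [hwγ]; gcongr
      _ = _ := by ring

end Defect

/-! ### Fields built from the coordinates of the rough path. -/

section RoughFields

variable {E : Type*} [NormedAddCommGroup E] [NormedSpace ℝ E] {l : ℕ}

/-- The vector field `∑ x^i f_i`. -/
def driftField (f : Fin l → E → E) (x : Fin l → ℝ) (a : E) : E := ∑ i, x i • f i a

/-- The map `∑ x^{i,j} f_i f_j`, where `f_i f_j (a) = df_j(a) (f_i a)`. -/
noncomputable def areaField (f : Fin l → E → E) (x : Fin l → Fin l → ℝ) (a : E) : E :=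
  ∑ i, ∑ j, x i j • fderiv ℝ (f j) a (f i a)

/-- The vector field `1/2 ∑ x^{i,j} [f_i, f_j]`. -/
noncomputable def bracketField (f : Fin l → E → E) (x : Fin l → Fin l → ℝ) (a : E) : E :=
  (1 / 2 : ℝ) • ∑ i, ∑ j, x i j • VectorField.lieBracket ℝ (f i) (f j) a

theorem davieAlmostFlow_eq (f : Fin l → E → E) (x1 : ℝ → ℝ → Fin l → ℝ)
    (x2 : ℝ → ℝ → Fin l → Fin l → ℝ) (t s : ℝ) : davieAlmostFlow f x1 x2 t s =
      fun a => a + driftField f (x1 s t) a + areaField f (x2 s t) a := rfl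

theorem logField_eq (f : Fin l → E → E) (x1 : ℝ → ℝ → Fin l → ℝ)
    (x2 : ℝ → ℝ → Fin l → Fin l → ℝ) (s t : ℝ) : logField f x1 x2 s t =
      fun a => driftField f (x1 s t) a + bracketField f (x2 s t) a := rfl

variable {γ C k : ℝ} {f : Fin l → E → E}

theorem hasC2Bounds_driftField (hf : ∀ i, HasC2Bounds γ C (f i)) (hC : 0 ≤ C) {x : Fin l → ℝ}
    (hx : ∀ i, |x i| ≤ k) : HasC2Bounds γ (l * (k * C)) (driftField f x) := by
  have := HasC2Bounds.sum (γ := γ) Finset.univ (C := k * C) (F := fun i a => x i • f i a)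
    fun i _ => ((hf i).const_smul (x i)).mono (by gcongr; exact hx i)
  rwa [Finset.card_univ, Fintype.card_fin] at this

theorem hasC1Bounds_areaField (hγ : 0 < γ) (hγ1 : γ ≤ 1) (hf : ∀ i, HasC2Bounds γ C (f i))
    {x : Fin l → Fin l → ℝ} (hx : ∀ i j, |x i j| ≤ k) :
    HasC1Bounds γ (l * (l * (k * (7 * C ^ 2)))) (areaField f x) := by
  have h1 : ∀ i, HasC1Bounds γ (l * (k * (7 * C ^ 2)))
      (fun a => ∑ j, x i j • fderiv ℝ (f j) a (f i a)) := fun i => by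
    have := HasC1Bounds.sum (γ := γ) Finset.univ (C := k * (7 * C ^ 2))
      (G := fun j a => x i j • fderiv ℝ (f j) a (f i a))
      fun j _ => (((hf j).fderiv_apply hγ hγ1 (hf i)).const_smul (x i j)).mono
        (by gcongr; exact hx i j)
    simpa using this
  have := HasC1Bounds.sum (γ := γ) Finset.univ fun i _ => h1 i
  rwa [Finset.card_univ, Fintype.card_fin] at this

/-- Exchanging i and j in half of the bracket moves the antisymmetry onto the coefficients, so
bracket fields inherit every estimate on area fields. -/
theorem bracketField_eq (x : Fin l → Fin l → ℝ) :
    bracketField f x = areaField f (fun i j => 1 / 2 * (x i j - x j i)) := by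
  funext a
  have e : ∑ i, ∑ j, x i j • fderiv ℝ (f i) a (f j a) =
      ∑ i, ∑ j, x j i • fderiv ℝ (f j) a (f i a) := Finset.sum_comm
  simp only [bracketField, areaField, VectorField.lieBracket, smul_sub, Finset.sum_sub_distrib,
    mul_smul, sub_smul]
  rw [e, Finset.smul_sum, Finset.smul_sum]
  simp only [Finset.smul_sum]

theorem fderiv_driftField (hf : ∀ i, Differentiable ℝ (f i)) (x : Fin l → ℝ) (a h : E) :
    fderiv ℝ (driftField f x) a h = ∑ j, x j • fderiv ℝ (f j) a h := by
  have : HasFDerivAt (driftField f x) (∑ j, x j • fderiv ℝ (f j) a) a :=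
    HasFDerivAt.fun_sum fun j _ => ((hf j a).hasFDerivAt).const_smul (x j)
  rw [this.fderiv]
  simp

/-- `d(∑ y^j f_j)(∑ x^i f_i) = ∑ x^i y^j f_i f_j`. -/
theorem fderiv_driftField_driftField (hf : ∀ i, Differentiable ℝ (f i)) (x y : Fin l → ℝ) (a : E) :
    fderiv ℝ (driftField f y) a (driftField f x a) = areaField f (fun i j => x i * y j) a := by
  rw [fderiv_driftField hf]
  simp only [driftField, areaField, map_sum, map_smul, Finset.smul_sum, smul_smul]
  rw [Finset.sum_comm]
  simp only [mul_comm]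

theorem driftField_add (x y : Fin l → ℝ) (a : E) :
    driftField f (fun i => x i + y i) a = driftField f x a + driftField f y a := by
  simp [driftField, add_smul, Finset.sum_add_distrib]

theorem areaField_add (x y : Fin l → Fin l → ℝ) (a : E) :
    areaField f (fun i j => x i j + y i j) a = areaField f x a + areaField f y a := by
  simp [areaField, add_smul, Finset.sum_add_distrib]

theorem areaField_smul (c : ℝ) (x : Fin l → Fin l → ℝ) (a : E) :
    areaField f (fun i j => c * x i j) a = c • areaField f x a := by
  simp [areaField, mul_smul, Finset.smul_sum]

end RoughFields

/-! ### Davie's almost flow. -/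

section Rough

variable {E : Type*} [NormedAddCommGroup E] [NormedSpace ℝ E] {l : ℕ} {T p γ : ℝ}
  {ω : ℝ → ℝ → ℝ} {f : Fin l → E → E} {x1 : ℝ → ℝ → Fin l → ℝ} {x2 : ℝ → ℝ → Fin l → Fin l → ℝ}

theorem exists_hasC2Bounds_of_isCbHolder (hf : ∀ i, IsCbHolder 2 γ (f i)) :
    ∃ C ≥ 0, ∀ i, HasC2Bounds γ C (f i) := by
  choose C hC using fun i => (hf i).exists_hasC2Bounds
  refine ⟨∑ i, C i, Finset.sum_nonneg fun i _ => (hC i).nonneg, fun i => (hC i).mono ?_⟩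
  exact Finset.single_le_sum (fun j _ => (hC j).nonneg) (Finset.mem_univ i)

/-- Bounds on the fields driven by a rough path, in terms of the `p`-th root of the control. -/
structure HasRoughBounds (T : ℝ) (ω : ℝ → ℝ → ℝ) (p γ c : ℝ) (f : Fin l → E → E)
    (x1 : ℝ → ℝ → Fin l → ℝ) (x2 : ℝ → ℝ → Fin l → Fin l → ℝ) : Prop where
  nonneg : 0 ≤ c
  differentiable : ∀ i, Differentiable ℝ (f i)
  drift : ∀ s t, 0 ≤ s → s ≤ t → t ≤ T →
    HasC2Bounds γ (c * ω s t ^ (1 / p)) (driftField f (x1 s t))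
  area : ∀ s t, 0 ≤ s → s ≤ t → t ≤ T →
    HasC1Bounds γ (c * (ω s t ^ (1 / p)) ^ 2) (areaField f (x2 s t))
  bracket : ∀ s t, 0 ≤ s → s ≤ t → t ≤ T →
    HasC1Bounds γ (c * (ω s t ^ (1 / p)) ^ 2) (bracketField f (x2 s t))

theorem exists_hasRoughBounds (hω : IsControl T ω) (hγ : 0 < γ) (hγ1 : γ ≤ 1)
    (hf : ∀ i, IsCbHolder 2 γ (f i)) (hx : IsWeakGeometricRoughPath T ω p x1 x2) :
    ∃ c, HasRoughBounds T ω p γ c f x1 x2 := by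
  obtain ⟨C, hC, hfC⟩ := exists_hasC2Bounds_of_isCbHolder hf
  obtain ⟨K₁, hK₁⟩ := hx.bounded1
  obtain ⟨K₂, hK₂⟩ := hx.bounded2
  set c₁ := l * (|K₁| * C) with hc₁
  set c₂ := l * (l * (|K₂| * (7 * C ^ 2))) with hc₂
  have h1 : 0 ≤ c₁ := by positivity
  have h2 : 0 ≤ c₂ := by positivity
  have hsq : ∀ s t, 0 ≤ s → s ≤ t → t ≤ T → ω s t ^ (2 / p) = (ω s t ^ (1 / p)) ^ 2 :=
    fun s t hs hst ht => by
      rw [← Real.rpow_natCast, ← Real.rpow_mul (hω.nonneg s t hs hst ht)]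
      congr 1
      push_cast
      ring
  have b2 : ∀ s t, 0 ≤ s → s ≤ t → t ≤ T → ∀ i j, |x2 s t i j| ≤ |K₂| * (ω s t ^ (1 / p)) ^ 2 :=
    fun s t hs hst ht i j => by
      have h0 := hω.nonneg s t hs hst ht
      refine (hK₂ s t hs hst ht i j).trans ?_
      rw [← hsq s t hs hst ht]
      gcongr
      exact le_abs_self _
  refine ⟨c₁ + c₂, by positivity, fun i => (hfC i).differentiable, fun s t hs hst ht => ?_,
    fun s t hs hst ht => ?_, fun s t hs hst ht => ?_⟩
  · have h0 := hω.nonneg s t hs hst ht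
    have := hasC2Bounds_driftField hfC hC (k := |K₁| * ω s t ^ (1 / p)) (x := x1 s t) fun i =>
      (hK₁ s t hs hst ht i).trans (by gcongr; exact le_abs_self _)
    refine this.mono ?_
    calc _ = c₁ * ω s t ^ (1 / p) := by rw [hc₁]; ring
      _ ≤ _ := by gcongr; linarith
  · have h0 := hω.nonneg s t hs hst ht
    have := hasC1Bounds_areaField hγ hγ1 hfC (b2 s t hs hst ht)
    refine this.mono ?_
    calc _ = c₂ * (ω s t ^ (1 / p)) ^ 2 := by rw [hc₂]; ring
      _ ≤ _ := by gcongr; linarith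
  · have h0 := hω.nonneg s t hs hst ht
    rw [bracketField_eq]
    have := hasC1Bounds_areaField hγ hγ1 hfC (k := |K₂| * (ω s t ^ (1 / p)) ^ 2)
      (x := fun i j => 1 / 2 * (x2 s t i j - x2 s t j i)) fun i j => by
        have e1 := abs_le.1 (b2 s t hs hst ht i j)
        have e2 := abs_le.1 (b2 s t hs hst ht j i)
        rw [abs_le]
        constructor <;> linarith [e1.1, e1.2, e2.1, e2.2]
    refine this.mono ?_
    calc _ = c₂ * (ω s t ^ (1 / p)) ^ 2 := by rw [hc₂]; ring
      _ ≤ _ := by gcongr; linarith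

/-- Chen's relation for the fields. -/
theorem areaField_chen (hf : ∀ i, Differentiable ℝ (f i))
    (hx : IsWeakGeometricRoughPath T ω p x1 x2) {r s t : ℝ} (hr : 0 ≤ r) (hrs : r ≤ s)
    (hst : s ≤ t) (ht : t ≤ T) (a : E) : areaField f (x2 r t) a = areaField f (x2 r s) a +
      fderiv ℝ (driftField f (x1 s t)) a (driftField f (x1 r s) a) + areaField f (x2 s t) a := by
  rw [fderiv_driftField_driftField hf, ← areaField_add, ← areaField_add]
  congr 1
  funext i j
  exact hx.chen2 r s t hr hrs hst ht i j

theorem driftField_chen (hx : IsWeakGeometricRoughPath T ω p x1 x2) {r s t : ℝ} (hr : 0 ≤ r)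
    (hrs : r ≤ s) (hst : s ≤ t) (ht : t ≤ T) (a : E) :
    driftField f (x1 r t) a = driftField f (x1 r s) a + driftField f (x1 s t) a := by
  rw [← driftField_add]
  congr 1
  funext i
  exact hx.chen1 r s t hr hrs hst ht i

/-- The geometric property: the symmetric part of the second level. -/
theorem areaField_eq_of_geometric (hf : ∀ i, Differentiable ℝ (f i))
    (hx : IsWeakGeometricRoughPath T ω p x1 x2) {s t : ℝ} (hs : 0 ≤ s)
    (hst : s ≤ t) (ht : t ≤ T) (a : E) : areaField f (x2 s t) a = bracketField f (x2 s t) a +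
      (1 / 2 : ℝ) • fderiv ℝ (driftField f (x1 s t)) a (driftField f (x1 s t) a) := by
  rw [fderiv_driftField_driftField hf, bracketField_eq, ← areaField_smul, ← areaField_add]
  congr 1
  funext i j
  rw [← hx.geometric s t hs hst ht i j]
  ring

theorem rpow_root_rpow {d : ℝ} (hd : 0 ≤ d) : (d ^ (1 / p)) ^ (2 + γ) = remainderFn p γ d := by
  rw [remainderFn, ← Real.rpow_mul hd]
  congr 1
  ring

theorem IsWeakGeometricRoughPath.diag (hx : IsWeakGeometricRoughPath T ω p x1 x2) {t : ℝ}
    (ht0 : 0 ≤ t) (ht : t ≤ T) : (∀ i, x1 t t i = 0) ∧ ∀ i j, x2 t t i j = 0 := by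
  have h1 : ∀ i, x1 t t i = 0 := fun i => by
    have := hx.chen1 t t t ht0 le_rfl le_rfl ht i
    linarith
  refine ⟨h1, fun i j => ?_⟩
  have := hx.chen2 t t t ht0 le_rfl le_rfl ht i j
  rw [h1 i] at this
  linarith

/-- Davie's almost flow is smooth. -/
theorem exists_isSmoothAlmostFlow_davie (hω : IsControl T ω) (hp : 2 ≤ p) (hγ : 0 < γ)
    (hγ1 : γ ≤ 1) {c : ℝ} (hc : HasRoughBounds T ω p γ c f x1 x2)
    (hx : IsWeakGeometricRoughPath T ω p x1 x2) :
    ∃ K, IsSmoothAlmostFlow T ω p γ K (davieAlmostFlow f x1 x2) := by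
  have hc0 := hc.nonneg
  have hM : (0 : ℝ) ≤ |ω 0 T| ^ (1 / p) := by positivity
  obtain ⟨C, hC0, hC⟩ := exists_defect_bound (E := E) hγ hγ1 hc0 hM
  set M := |ω 0 T| ^ (1 / p) with hMdef
  have root_le : ∀ s t, 0 ≤ s → s ≤ t → t ≤ T → ω s t ^ (1 / p) ≤ M := fun s t hs hst ht => by
    have h0 := hω.nonneg s t hs hst ht
    have := (hω.mono le_rfl hs hst ht le_rfl).trans (le_abs_self _)
    rw [hMdef]
    gcongr
  set φ := davieAlmostFlow f x1 x2
  have hD : ∀ s t, 0 ≤ s → s ≤ t → t ≤ T → ∀ a, HasFDerivAt (φ t s)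
      (1 + fderiv ℝ (driftField f (x1 s t)) a + fderiv ℝ (areaField f (x2 s t)) a) a :=
    fun s t hs hst ht a =>
      ((hasFDerivAt_id a).add ((hc.drift s t hs hst ht).differentiable a).hasFDerivAt).add
        ((hc.area s t hs hst ht).differentiable a).hasFDerivAt
  have near : ∀ s t, 0 ≤ s → s ≤ t → t ≤ T →
      c * ω s t ^ (1 / p) + c * (ω s t ^ (1 / p)) ^ 2 ≤
        (c * (1 + M) + C) * ω s t ^ (1 / p) := fun s t hs hst ht => by
    have h0 : 0 ≤ ω s t ^ (1 / p) := Real.rpow_nonneg (hω.nonneg s t hs hst ht) _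
    have h1 := root_le s t hs hst ht
    have : c * (ω s t ^ (1 / p)) ^ 2 ≤ c * ω s t ^ (1 / p) * M := by
      rw [pow_two, ← mul_assoc]; gcongr
    nlinarith [mul_nonneg hC0 h0]
  -- Chen's relation puts the defect in the form treated by `exists_defect_bound`: the cross term of
  -- the second level is exactly the derivative of one drift along the other.
  have hdef : ∀ r s t, 0 ≤ r → r ≤ s → s ≤ t → t ≤ T →
      (fun a => φ t s (φ s r a) - φ t r a) =
      (fun a => driftField f (x1 s t) (a + driftField f (x1 r s) a + areaField f (x2 r s) a) -
        driftField f (x1 s t) a - fderiv ℝ (driftField f (x1 s t)) a (driftField f (x1 r s) a) +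
        (areaField f (x2 s t) (a + driftField f (x1 r s) a + areaField f (x2 r s) a) -
          areaField f (x2 s t) a)) := by
    intro r s t hr hrs hst ht
    funext a
    simp only [φ, davieAlmostFlow_eq]
    rw [areaField_chen hc.differentiable hx hr hrs hst ht a, driftField_chen hx hr hrs hst ht a]
    abel
  have hdefect : ∀ r s t, 0 ≤ r → r ≤ s → s ≤ t → t ≤ T → ∀ a,
      ‖φ t s (φ s r a) - φ t r a‖ ≤ C * remainderFn p γ (ω r t) ∧
      ∃ D : E →L[ℝ] E, HasFDerivAt (fun a => φ t s (φ s r a) - φ t r a) D a ∧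
        ‖D‖ ≤ C * remainderFn p γ (ω r t) := by
    intro r s t hr hrs hst ht a
    have h0 := hω.nonneg r t hr (hrs.trans hst) ht
    have h1 := hω.nonneg r s hr hrs (hst.trans ht)
    have h2 := hω.nonneg s t (hr.trans hrs) hst ht
    have m1 : ω r s ^ (1 / p) ≤ ω r t ^ (1 / p) := by
      have := hω.mono hr le_rfl hrs hst ht
      gcongr
    have m2 : ω s t ^ (1 / p) ≤ ω r t ^ (1 / p) := by
      have := hω.mono hr hrs hst le_rfl ht
      gcongr
    have key := hC (driftField f (x1 r s)) (driftField f (x1 s t)) (areaField f (x2 r s))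
      (areaField f (x2 s t)) (ω r t ^ (1 / p)) (by positivity) (root_le r t hr (hrs.trans hst) ht)
      ((hc.drift r s hr hrs (hst.trans ht)).mono (by gcongr))
      ((hc.drift s t (hr.trans hrs) hst ht).mono (by gcongr))
      ((hc.area r s hr hrs (hst.trans ht)).mono (by gcongr))
      ((hc.area s t (hr.trans hrs) hst ht).mono (by gcongr)) a
    rw [rpow_root_rpow h0] at key
    rw [hdef r s t hr hrs hst ht]
    exact ⟨(congrFun (hdef r s t hr hrs hst ht) a ▸ key.1), key.2⟩
  have hCK : C ≤ c * (1 + M) + C := by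
    have : 0 ≤ c * (1 + M) := by positivity
    linarith
  have hcK : c ≤ c * (1 + M) + C := by nlinarith [mul_nonneg hc0 hM]
  refine ⟨c * (1 + M) + C, by positivity, fun t ht0 ht a => ?_, fun s t hs hst ht a =>
    (hD s t hs hst ht a).differentiableAt, fun s t hs hst ht a => ?_, fun s t hs hst ht a => ?_,
    fun s t hs hst ht a b => ?_, fun r s t hr hrs hst ht a => ?_, fun r s t hr hrs hst ht a => ?_⟩
  · obtain ⟨h1, h2⟩ := hx.diag ht0 ht
    simp [φ, davieAlmostFlow, h1, h2]
  · have e : φ t s a - a = driftField f (x1 s t) a + areaField f (x2 s t) a := by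
      simp only [φ, davieAlmostFlow_eq]; abel
    rw [e]
    exact (norm_add_le_of_le ((hc.drift s t hs hst ht).norm_le a)
      ((hc.area s t hs hst ht).norm_le a)).trans (near s t hs hst ht)
  · have e : fderiv ℝ (φ t s) a - 1 =
        fderiv ℝ (driftField f (x1 s t)) a + fderiv ℝ (areaField f (x2 s t)) a := by
      rw [(hD s t hs hst ht a).fderiv]; abel
    rw [e]
    exact (norm_add_le_of_le ((hc.drift s t hs hst ht).norm_fderiv_le a)
      ((hc.area s t hs hst ht).norm_fderiv_le a)).trans (near s t hs hst ht)
  · have e : fderiv ℝ (φ t s) a - fderiv ℝ (φ t s) b =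
        (fderiv ℝ (driftField f (x1 s t)) a - fderiv ℝ (driftField f (x1 s t)) b) +
        (fderiv ℝ (areaField f (x2 s t)) a - fderiv ℝ (areaField f (x2 s t)) b) := by
      rw [(hD s t hs hst ht a).fderiv, (hD s t hs hst ht b).fderiv]; abel
    have h0 := hω.nonneg s t hs hst ht
    have esq : (ω s t ^ (1 / p)) ^ 2 = ω s t ^ (2 / p) := by
      rw [← Real.rpow_natCast, ← Real.rpow_mul h0]
      congr 1
      push_cast
      ring
    rw [e]
    refine (norm_add_le_of_le ((hc.drift s t hs hst ht).norm_fderiv_sub_le a b)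
      ((hc.area s t hs hst ht).holder a b)).trans ?_
    rw [esq]
    calc _ = c * (ω s t ^ (1 / p) * ‖a - b‖ + ω s t ^ (2 / p) * ‖a - b‖ ^ γ) := by ring
      _ ≤ _ := by gcongr
  · refine (hdefect r s t hr hrs hst ht a).1.trans ?_
    have := remainderFn_nonneg (p := p) (γ := γ) (hω.nonneg r t hr (hrs.trans hst) ht)
    gcongr
  · obtain ⟨D, hD1, hD2⟩ := (hdefect r s t hr hrs hst ht a).2
    have hs1 := (hD s t (hr.trans hrs) hst ht (φ s r a)).differentiableAt.hasFDerivAt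
    have hs2 := (hD r s hr hrs (hst.trans ht) a).differentiableAt.hasFDerivAt
    have hs3 := (hD r t hr (hrs.trans hst) ht a).differentiableAt.hasFDerivAt
    -- The derivative estimated on the Chen form coincides, by uniqueness, with the one given by the
    -- chain rule.
    have := hD1.unique ((hs1.comp a hs2).sub hs3)
    have e : fderiv ℝ (φ t s) (φ s r a) * fderiv ℝ (φ s r) a - fderiv ℝ (φ t r) a = D :=
      this.symm
    rw [e]
    refine hD2.trans ?_
    have := remainderFn_nonneg (p := p) (γ := γ) (hω.nonneg r t hr (hrs.trans hst) ht)
    gcongr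

end Rough

/-! ### Autonomous ODEs on [0, 1]. -/

section AutonomousODE

variable {E : Type*} [NormedAddCommGroup E] [NormedSpace ℝ E]

/-- `y` solves `ẏ = V(y)` on `[0, 1]`, starting from `a`. -/
def IsODESolution (V : E → E) (a : E) (y : ℝ → E) : Prop :=
  y 0 = a ∧ ∀ t ∈ Icc (0 : ℝ) 1, HasDerivWithinAt y (V (y t)) (Icc 0 1) t

theorem isODESolution_iff_integral [CompleteSpace E] {V : E → E} (hV : Continuous V) {a : E}
    {y : ℝ → E} : (ContinuousOn y (Icc 0 1) ∧
      ∀ α ∈ Icc (0 : ℝ) 1, y α = a + ∫ β in (0 : ℝ)..α, V (y β)) ↔ IsODESolution V a y := by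
  have hV' : ∀ s : Set ℝ, ContinuousOn (Function.uncurry fun (_ : ℝ) => V) (s ×ˢ univ) :=
    fun s => (hV.comp continuous_snd).continuousOn
  have h0 : (0 : ℝ) ∈ Icc (0 : ℝ) 1 := by simp
  constructor
  · rintro ⟨hy, h⟩
    refine ⟨by simpa using h 0 h0, fun t ht => ?_⟩
    exact (ODE.hasDerivWithinAt_picard_Icc (f := fun _ => V) h0 (hV' _) hy
      (fun t _ => mem_univ _) a ht).congr (fun s hs => h s hs) (h t ht)
  · rintro ⟨rfl, h⟩
    refine ⟨HasDerivWithinAt.continuousOn h, fun t ht => ?_⟩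
    have hsub : uIcc 0 t ⊆ Icc (0 : ℝ) 1 := by
      rw [uIcc_of_le ht.1]; exact Icc_subset_Icc_right ht.2
    exact (ODE.picard_eq_of_hasDerivAt (f := fun _ => V) (hV' _)
      (fun s hs => (h s (hsub hs)).mono hsub) (fun s _ => mem_univ _)).symm

/-- A field bounded by B moves a point by at most B in unit time, so Picard–Lindelöf on the ball of
radius B reaches time one without continuation. -/
theorem exists_isODESolution [CompleteSpace E] {V : E → E} {k B : ℝ} (hk : 0 ≤ k) (hB : 0 ≤ B)
    (hV : ∀ a b, ‖V a - V b‖ ≤ k * ‖a - b‖) (hVB : ∀ a, ‖V a‖ ≤ B) (a : E) :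
    ∃ y, IsODESolution V a y := by
  have hpl : IsPicardLindelof (fun _ => V) (⟨0, by simp⟩ : Icc (0 : ℝ) 1) a B.toNNReal 0
      B.toNNReal k.toNNReal := by
    refine IsPicardLindelof.of_time_independent (fun x _ => ?_) (fun x _ y _ => ?_) ?_
    · rw [Real.coe_toNNReal _ hB]; exact hVB x
    · have := LipschitzWith.of_dist_le_mul (K := k.toNNReal) (f := V) fun x y => by
        rw [dist_eq_norm, dist_eq_norm, Real.coe_toNNReal _ hk]; exact hV x y
      exact this x y
    · simp
  exact hpl.exists_eq_forall_mem_Icc_hasDerivWithinAt₀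

namespace IsODESolution

variable {V : E → E} {a b : E} {y z : ℝ → E} {k B : ℝ}

theorem continuousOn (h : IsODESolution V a y) : ContinuousOn y (Icc 0 1) :=
  HasDerivWithinAt.continuousOn h.2

theorem norm_sub_le (hk : 0 ≤ k) (hV : ∀ a b, ‖V a - V b‖ ≤ k * ‖a - b‖)
    (hy : IsODESolution V a y) (hz : IsODESolution V b z) {t : ℝ} (ht : t ∈ Icc (0 : ℝ) 1) :
    ‖y t - z t‖ ≤ ‖a - b‖ * Real.exp k := by
  have hlip : LipschitzWith k.toNNReal V := LipschitzWith.of_dist_le_mul fun x y => by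
    rw [dist_eq_norm, dist_eq_norm, Real.coe_toNNReal _ hk]; exact hV x y
  have hder : ∀ {w : ℝ → E} {c : E}, IsODESolution V c w → ∀ t ∈ Ico (0 : ℝ) 1,
      HasDerivWithinAt w (V (w t)) (Ici t) t := fun hw t ht =>
    ((hw.2 t ⟨ht.1, ht.2.le⟩).mono (Icc_subset_Icc_left ht.1)).mono_of_mem_nhdsWithin
      (Icc_mem_nhdsGE ht.2)
  have := dist_le_of_trajectories_ODE (v := fun _ => V) (fun _ => hlip) hy.continuousOn
    (hder hy) hz.continuousOn (hder hz) (δ := ‖a - b‖)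
    (by rw [hy.1, hz.1, dist_eq_norm]) t ht
  rw [dist_eq_norm, Real.coe_toNNReal _ hk, sub_zero] at this
  refine this.trans ?_
  gcongr
  nlinarith [ht.2]

theorem eqOn (hk : 0 ≤ k) (hV : ∀ a b, ‖V a - V b‖ ≤ k * ‖a - b‖)
    (hy : IsODESolution V a y) (hz : IsODESolution V a z) : EqOn y z (Icc 0 1) := fun t ht => by
  have := hy.norm_sub_le hk hV hz ht
  rw [sub_self, norm_zero, zero_mul] at this
  exact sub_eq_zero.1 (norm_le_zero_iff.1 this)

/-- The mean value inequality from the initial time. -/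
theorem norm_sub_le_of_hasDerivWithinAt {g g' : ℝ → E} {C : ℝ}
    (hg : ∀ t ∈ Icc (0 : ℝ) 1, HasDerivWithinAt g (g' t) (Icc 0 1) t)
    (hC : ∀ t ∈ Icc (0 : ℝ) 1, ‖g' t‖ ≤ C) {t : ℝ} (ht : t ∈ Icc (0 : ℝ) 1) :
    ‖g t - g 0‖ ≤ C := by
  have h0 : (0 : ℝ) ∈ Icc (0 : ℝ) 1 := by simp
  have := (convex_Icc (0 : ℝ) 1).norm_image_sub_le_of_norm_hasDerivWithin_le hg hC h0 ht
  refine this.trans ?_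
  have hC0 : 0 ≤ C := (norm_nonneg _).trans (hC 0 h0)
  rw [sub_zero, Real.norm_eq_abs, abs_of_nonneg ht.1]
  nlinarith [ht.2]

/-- The difference of two solutions has velocity at most k times their distance, which Grönwall's
inequality bounds by exp k ‖a - b‖. -/
theorem norm_sub_sub_sub_le (hk : 0 ≤ k) (hV : ∀ a b, ‖V a - V b‖ ≤ k * ‖a - b‖)
    (hy : IsODESolution V a y) (hz : IsODESolution V b z) :
    ‖y 1 - z 1 - (a - b)‖ ≤ k * Real.exp k * ‖a - b‖ := by
  have := norm_sub_le_of_hasDerivWithinAt (g := fun t => y t - z t)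
    (fun t ht => (hy.2 t ht).sub (hz.2 t ht)) (C := k * (‖a - b‖ * Real.exp k))
    (fun t ht => (hV _ _).trans (by gcongr; exact hy.norm_sub_le hk hV hz ht))
    (t := 1) (by simp)
  simp only [hy.1, hz.1] at this
  exact this.trans_eq (by ring)

theorem norm_sub_initial_le (hVB : ∀ a, ‖V a‖ ≤ B) (hy : IsODESolution V a y) {t : ℝ}
    (ht : t ∈ Icc (0 : ℝ) 1) : ‖y t - a‖ ≤ B := by
  have := norm_sub_le_of_hasDerivWithinAt hy.2 (fun t _ => hVB _) ht
  rwa [hy.1] at this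

end IsODESolution

/-- The time-one expansion of the solution of `ẏ = (F + Q)(y)`. -/
theorem exists_ode_expansion_bound {γ c M : ℝ} (hc : 0 ≤ c) (hM : 0 ≤ M) :
    ∃ C ≥ 0, ∀ (F Q : E → E) (w : ℝ), 0 ≤ w → w ≤ M → HasC2Bounds γ (c * w) F →
      HasC1Bounds γ (c * w ^ 2) Q → ∀ a y, IsODESolution (fun b => F b + Q b) a y →
      ‖y 1 - (a + F a + (Q a + (1 / 2 : ℝ) • fderiv ℝ F a (F a)))‖ ≤ C * w ^ 3 := by
  obtain ⟨d, hd⟩ : ∃ d, d = c * (1 + M) := ⟨_, rfl⟩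
  have hd0 : 0 ≤ d := by rw [hd]; positivity
  refine ⟨c * d ^ 2 + c * (c * d + c) + c * d, by positivity, fun F Q w hw hwM hF hQ a y hy => ?_⟩
  have hcw : 0 ≤ c * w := by positivity
  have hsum : c * w + c * w ^ 2 ≤ d * w := by
    have : c * w ^ 2 ≤ c * w * M := by rw [pow_two, ← mul_assoc]; gcongr
    rw [hd]; linarith
  have hn : ∀ t ∈ Icc (0 : ℝ) 1, ‖y t - a‖ ≤ d * w := fun t ht =>
    hy.norm_sub_initial_le (fun b => (norm_add_le_of_le (hF.norm_le b) (hQ.norm_le b)).trans hsum)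
      ht
  -- A first order expansion, needed because dF(a) is applied to y t - a - t F a in the second order
  -- one.
  have hn2 : ∀ t ∈ Icc (0 : ℝ) 1, ‖y t - a - t • F a‖ ≤ (c * d + c) * w ^ 2 := fun t ht => by
    have := IsODESolution.norm_sub_le_of_hasDerivWithinAt (g := fun t => y t - t • F a)
      (g' := fun t => F (y t) + Q (y t) - (1 : ℝ) • F a) (C := (c * d + c) * w ^ 2)
      (fun t ht => (hy.2 t ht).sub ((hasDerivWithinAt_id t _).smul_const (F a)))
      (fun t ht => by
        have e : F (y t) + Q (y t) - (1 : ℝ) • F a = (F (y t) - F a) + Q (y t) := by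
          rw [one_smul]; abel
        rw [e]
        refine (norm_add_le_of_le (hF.norm_sub_le _ _) (hQ.norm_le _)).trans ?_
        have : c * w * ‖y t - a‖ ≤ c * w * (d * w) := by gcongr; exact hn t ht
        linarith) ht
    simp only [hy.1, zero_smul, sub_zero] at this
    rwa [sub_right_comm]
  have := IsODESolution.norm_sub_le_of_hasDerivWithinAt
    (g := fun t => y t - t • (F a + Q a) - (t ^ 2 / 2) • fderiv ℝ F a (F a))
    (g' := fun t => F (y t) + Q (y t) - (1 : ℝ) • (F a + Q a) - t • fderiv ℝ F a (F a))
    (C := (c * d ^ 2 + c * (c * d + c) + c * d) * w ^ 3)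
    (fun t ht => by
      have h2 : HasDerivWithinAt (fun t : ℝ => t ^ 2 / 2) t (Icc 0 1) t := by
        have := ((hasDerivAt_pow 2 t).div_const 2).hasDerivWithinAt (s := Icc 0 1)
        simpa using this
      exact ((hy.2 t ht).sub ((hasDerivWithinAt_id t _).smul_const (F a + Q a))).sub
        (h2.smul_const _))
    (fun t ht => by
      -- The derivative of the remainder splits into a Taylor remainder of F, dF(a) applied to the
      -- first order error, and an increment of Q; each is O(w³).
      have e : F (y t) + Q (y t) - (1 : ℝ) • (F a + Q a) - t • fderiv ℝ F a (F a) =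
          (F (y t) - F a - fderiv ℝ F a (y t - a)) + fderiv ℝ F a (y t - a - t • F a) +
            (Q (y t) - Q a) := by
        rw [one_smul, map_sub _ (y t - a), map_smul]; abel
      rw [e]
      have q1 : c * w * ‖y t - a‖ ^ 2 ≤ c * w * (d * w) ^ 2 := by gcongr; exact hn t ht
      have q2 := (fderiv ℝ F a).le_of_opNorm_le_of_le (hF.norm_fderiv_le a) (hn2 t ht)
      have q3 := norm_sub_le_of_norm_fderiv_le hQ.differentiable hQ.norm_fderiv_le (y t) a
      have q4 : c * w ^ 2 * ‖y t - a‖ ≤ c * w ^ 2 * (d * w) := by gcongr; exact hn t ht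
      refine (norm_add_le_of_le (norm_add_le_of_le ((hF.norm_taylor_le a (y t)).trans q1) q2)
        (q3.trans q4)).trans_eq ?_
      ring) (t := 1) (by simp)
  have e : y 1 - (a + F a + (Q a + (1 / 2 : ℝ) • fderiv ℝ F a (F a))) =
      y 1 - (1 : ℝ) • (F a + Q a) - ((1 : ℝ) ^ 2 / 2) • fderiv ℝ F a (F a) -
        (y 0 - (0 : ℝ) • (F a + Q a) - ((0 : ℝ) ^ 2 / 2) • fderiv ℝ F a (F a)) := by
    rw [hy.1]
    norm_num
    abel
  rw [e]
  exact this

end AutonomousODE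

/-! ### Bailleul's almost flow. -/

section Bailleul

variable {E : Type*} [NormedAddCommGroup E] [NormedSpace ℝ E] {l : ℕ} {T p γ c : ℝ}
  {ω : ℝ → ℝ → ℝ} {f : Fin l → E → E} {x1 : ℝ → ℝ → Fin l → ℝ} {x2 : ℝ → ℝ → Fin l → Fin l → ℝ}

namespace HasRoughBounds

theorem logField_bounds (hc : HasRoughBounds T ω p γ c f x1 x2) (hω : IsControl T ω)
    (hp : 2 ≤ p) : ∃ d ≥ 0, ∀ s t, 0 ≤ s → s ≤ t → t ≤ T →
      (∀ a, ‖logField f x1 x2 s t a‖ ≤ d * ω s t ^ (1 / p)) ∧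
      ∀ a b, ‖logField f x1 x2 s t a - logField f x1 x2 s t b‖ ≤ d * ω s t ^ (1 / p) * ‖a - b‖ := by
  have hc0 := hc.nonneg
  refine ⟨c * (1 + |ω 0 T| ^ (1 / p)), by positivity, fun s t hs hst ht => ?_⟩
  have h0 := hω.nonneg s t hs hst ht
  have hle : ω s t ^ (1 / p) ≤ |ω 0 T| ^ (1 / p) := by
    have := (hω.mono le_rfl hs hst ht le_rfl).trans (le_abs_self _)
    gcongr
  have hsum : c * ω s t ^ (1 / p) + c * (ω s t ^ (1 / p)) ^ 2 ≤
      c * (1 + |ω 0 T| ^ (1 / p)) * ω s t ^ (1 / p) := by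
    have : c * (ω s t ^ (1 / p)) ^ 2 ≤ c * ω s t ^ (1 / p) * |ω 0 T| ^ (1 / p) := by
      rw [pow_two, ← mul_assoc]; gcongr
    linarith
  have hF := hc.drift s t hs hst ht
  have hQ := hc.bracket s t hs hst ht
  simp only [logField_eq]
  refine ⟨fun a => (norm_add_le_of_le (hF.norm_le a) (hQ.norm_le a)).trans hsum, fun a b => ?_⟩
  rw [add_sub_add_comm]
  refine (norm_add_le_of_le (hF.norm_sub_le a b)
    (norm_sub_le_of_norm_fderiv_le hQ.differentiable hQ.norm_fderiv_le a b)).trans ?_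
  rw [← add_mul]
  gcongr

theorem continuous_logField (hc : HasRoughBounds T ω p γ c f x1 x2) {s t : ℝ} (hs : 0 ≤ s)
    (hst : s ≤ t) (ht : t ≤ T) : Continuous (logField f x1 x2 s t) := by
  rw [logField_eq]
  exact (hc.drift s t hs hst ht).differentiable.continuous.add
    (hc.bracket s t hs hst ht).differentiable.continuous

variable [CompleteSpace E]

theorem isLogODESolution_iff (hc : HasRoughBounds T ω p γ c f x1 x2) {s t : ℝ} (hs : 0 ≤ s)
    (hst : s ≤ t) (ht : t ≤ T) {a : E} {y : ℝ → E} :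
    IsLogODESolution f x1 x2 s t a y ↔ IsODESolution (logField f x1 x2 s t) a y :=
  isODESolution_iff_integral (hc.continuous_logField hs hst ht)

/-- The solutions of the ODE that defines Bailleul's almost flow. -/
theorem exists_isODESolution_bailleul (hc : HasRoughBounds T ω p γ c f x1 x2)
    (hω : IsControl T ω) (hp : 2 ≤ p) {s t : ℝ} (hs : 0 ≤ s) (hst : s ≤ t) (ht : t ≤ T) (a : E) :
    ∃ y, IsODESolution (logField f x1 x2 s t) a y ∧ bailleulAlmostFlow f x1 x2 t s a = y 1 ∧
      ∀ z, IsODESolution (logField f x1 x2 s t) a z → EqOn z y (Icc 0 1) := by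
  obtain ⟨d, hd, H⟩ := hc.logField_bounds hω hp
  obtain ⟨hb, hl⟩ := H s t hs hst ht
  have hk : 0 ≤ d * ω s t ^ (1 / p) :=
    mul_nonneg hd (Real.rpow_nonneg (hω.nonneg s t hs hst ht) _)
  obtain ⟨y, hy⟩ := exists_isODESolution hk hk hl hb a
  -- Existence of a solution is what makes the choice in `bailleulAlmostFlow` a solution.
  have hspec : IsODESolution (logField f x1 x2 s t) a
      (Classical.epsilon (IsLogODESolution f x1 x2 s t a)) :=
    (hc.isLogODESolution_iff hs hst ht).1
      (Classical.epsilon_spec ⟨y, (hc.isLogODESolution_iff hs hst ht).2 hy⟩)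
  exact ⟨_, hspec, rfl, fun z hz => hz.eqOn hk hl hspec⟩

/-- Lipschitz estimates are enough here: the differentiability of χ in its starting point is never
needed, because the C¹ argument is run on Davie's map. -/
theorem bailleul_bounds (hc : HasRoughBounds T ω p γ c f x1 x2) (hω : IsControl T ω)
    (hp : 2 ≤ p) : ∃ A ≥ 0, ∀ s t, 0 ≤ s → s ≤ t → t ≤ T →
      (∀ a, ‖bailleulAlmostFlow f x1 x2 t s a - a‖ ≤ A * ω s t ^ (1 / p)) ∧
      ∀ a b, ‖bailleulAlmostFlow f x1 x2 t s a - bailleulAlmostFlow f x1 x2 t s b - (a - b)‖ ≤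
        A * ω s t ^ (1 / p) * ‖a - b‖ := by
  obtain ⟨d, hd, H⟩ := hc.logField_bounds hω hp
  refine ⟨d * Real.exp (d * |ω 0 T| ^ (1 / p)), by positivity, fun s t hs hst ht => ?_⟩
  obtain ⟨hb, hl⟩ := H s t hs hst ht
  have h0 := hω.nonneg s t hs hst ht
  have hk : 0 ≤ d * ω s t ^ (1 / p) := by positivity
  have hle : ω s t ^ (1 / p) ≤ |ω 0 T| ^ (1 / p) := by
    have := (hω.mono le_rfl hs hst ht le_rfl).trans (le_abs_self _)
    gcongr
  refine ⟨fun a => ?_, fun a b => ?_⟩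
  · obtain ⟨y, hy, e, -⟩ := hc.exists_isODESolution_bailleul hω hp hs hst ht a
    rw [e]
    refine (hy.norm_sub_initial_le hb (by simp)).trans ?_
    gcongr
    have : 1 ≤ Real.exp (d * |ω 0 T| ^ (1 / p)) := Real.one_le_exp (by positivity)
    nlinarith
  · obtain ⟨y, hy, ey, -⟩ := hc.exists_isODESolution_bailleul hω hp hs hst ht a
    obtain ⟨z, hz, ez, -⟩ := hc.exists_isODESolution_bailleul hω hp hs hst ht b
    rw [ey, ez]
    refine (hy.norm_sub_sub_sub_le hk hl hz).trans ?_
    calc _ ≤ d * ω s t ^ (1 / p) * Real.exp (d * |ω 0 T| ^ (1 / p)) * ‖a - b‖ := by gcongr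
      _ = _ := by ring

/-- Bailleul's and Davie's almost flows are in the same galaxy. -/
theorem bailleul_sub_davie_le (hc : HasRoughBounds T ω p γ c f x1 x2) (hω : IsControl T ω)
    (hp : 2 ≤ p) (hγ : 0 < γ) (hγ1 : γ ≤ 1) (hx : IsWeakGeometricRoughPath T ω p x1 x2) :
    ∃ C ≥ 0, ∀ s t, 0 ≤ s → s ≤ t → t ≤ T → ∀ a,
      ‖bailleulAlmostFlow f x1 x2 t s a - davieAlmostFlow f x1 x2 t s a‖ ≤
        C * remainderFn p γ (ω s t) := by
  have hM : (0 : ℝ) ≤ |ω 0 T| ^ (1 / p) := by positivity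
  obtain ⟨C, hC, H⟩ := exists_ode_expansion_bound (E := E) (γ := γ) hc.nonneg hM
  refine ⟨C * max 1 (|ω 0 T| ^ (1 / p)), by positivity, fun s t hs hst ht a => ?_⟩
  have h0 := hω.nonneg s t hs hst ht
  have hle : ω s t ^ (1 / p) ≤ |ω 0 T| ^ (1 / p) := by
    have := (hω.mono le_rfl hs hst ht le_rfl).trans (le_abs_self _)
    gcongr
  obtain ⟨y, hy, e, -⟩ := hc.exists_isODESolution_bailleul hω hp hs hst ht a
  rw [e, davieAlmostFlow_eq]
  simp only
  -- Weak geometricity turns Davie's second order term into the one of the ODE expansion.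
  rw [areaField_eq_of_geometric hc.differentiable hx hs hst ht]
  refine (H _ _ _ (by positivity) hle (hc.drift s t hs hst ht) (hc.bracket s t hs hst ht) a y
    hy).trans ?_
  rw [mul_assoc, ← rpow_root_rpow h0]
  gcongr
  exact pow_three_le hγ hγ1 (by positivity) hle

end HasRoughBounds

end Bailleul

/-! ### The functions δ and η. -/

section Vanishing

variable {T p γ : ℝ} {ω : ℝ → ℝ → ℝ}

theorem IsControl.isVanishing_rpow (hω : IsControl T ω) (hT : 0 < T) {e : ℝ} (he : 0 < e) :
    IsVanishing (fun S => ω 0 (min S T) ^ e) := by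
  have h0 : ∀ S, 0 ≤ S → 0 ≤ ω 0 (min S T) := fun S hS =>
    hω.nonneg 0 _ le_rfl (le_min hS hT.le) (min_le_right _ _)
  refine ⟨fun S hS => Real.rpow_nonneg (h0 S hS) _, fun S hS S' hS' hSS' => ?_, ?_⟩
  · have := hω.mono le_rfl le_rfl (le_min hS hT.le) (min_le_min_right T hSS') (min_le_right _ _)
    have := h0 S hS
    gcongr
  · rw [Metric.tendsto_nhdsWithin_nhds]
    intro ε hε
    obtain ⟨W, hW, H⟩ := exists_mul_rpow_le 1 he (half_pos hε)
    obtain ⟨h, hh, H'⟩ := hω.exists_forall_sub_le hW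
    refine ⟨h, hh, fun {S} hS hd => ?_⟩
    have hS0 : 0 ≤ S := le_of_lt hS
    rw [Real.dist_eq, sub_zero, abs_of_nonneg hS0] at hd
    rw [Real.dist_eq, sub_zero, abs_of_nonneg (Real.rpow_nonneg (h0 S hS0) _)]
    have := H _ (h0 S hS0) (H' 0 (min S T) le_rfl (le_min hS0 hT.le) (min_le_right _ _)
      (by rw [sub_zero]; exact (min_le_left _ _).trans hd.le))
    linarith

/-- The functions `δ` used for the almost flows driven by a rough path. -/
noncomputable def horizonBound (T p γ A : ℝ) (ω : ℝ → ℝ → ℝ) (S : ℝ) : ℝ :=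
  A * ω 0 (min S T) ^ (1 / p) + ω 0 (min S T) ^ ((2 + γ) / p * γ)

theorem isVanishing_horizonBound (hω : IsControl T ω) (hT : 0 < T) (hp : 2 ≤ p) (hγ : 0 < γ)
    {A : ℝ} (hA : 0 ≤ A) : IsVanishing (horizonBound T p γ A ω) := by
  have h1 := hω.isVanishing_rpow hT (e := 1 / p) (by positivity)
  have h2 := hω.isVanishing_rpow hT (e := (2 + γ) / p * γ) (by positivity)
  refine ⟨fun S hS => add_nonneg (mul_nonneg hA (h1.nonneg S hS)) (h2.nonneg S hS),
    fun S hS S' hS' hSS' => add_le_add (mul_le_mul_of_nonneg_left (h1.monotone hS hS' hSS') hA)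
      (h2.monotone hS hS' hSS'), ?_⟩
  have := (h1.tendsto_zero.const_mul A).add h2.tendsto_zero
  rw [mul_zero, add_zero] at this
  exact this

/-- With η = ϖ the condition reduces to ϖ(ω_{s,t})^γ ≤ δ_S, which the second term of `horizonBound`
ensures; its first term serves the Lipschitz bounds. -/
theorem isModulus_remainderFn (hω : IsControl T ω) (hp : 2 ≤ p) (hγ : 0 < γ)
    {A : ℝ} (hA : 0 ≤ A) :
    IsModulus T ω (remainderFn p γ) γ (horizonBound T p γ A ω) (remainderFn p γ) := by
  have he : 0 < (2 + γ) / p := by positivity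
  refine ⟨fun d hd => remainderFn_nonneg hd, ?_, ?_, fun S hS hST s t hs hst ht => ?_⟩
  · exact (Real.continuous_rpow_const he.le).continuousOn
  · exact Real.strictMonoOn_rpow_Ici_of_exponent_pos he
  · have h0 := hω.nonneg s t hs hst (ht.trans hST)
    have h1 := hω.nonneg 0 S le_rfl hS.le hST
    have hm := hω.mono le_rfl hs hst ht hST
    rw [mul_comm]
    refine mul_le_mul_of_nonneg_right ?_ (remainderFn_nonneg h0)
    rw [horizonBound, min_eq_left hST, remainderFn, ← Real.rpow_mul h0]
    have h2 : ω s t ^ ((2 + γ) / p * γ) ≤ ω 0 S ^ ((2 + γ) / p * γ) := by gcongr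
    have h3 : 0 ≤ A * ω 0 S ^ (1 / p) := by positivity
    linarith

theorem le_horizonBound (hω : IsControl T ω) (hp : 2 ≤ p) {A : ℝ} (hA : 0 ≤ A) {S s t : ℝ}
    (hST : S ≤ T) (hs : 0 ≤ s) (hst : s ≤ t) (ht : t ≤ S) :
    A * ω s t ^ (1 / p) ≤ horizonBound T p γ A ω S := by
  have h0 := hω.nonneg s t hs hst (ht.trans hST)
  have hm := hω.mono le_rfl hs hst ht hST
  rw [horizonBound, min_eq_left hST]
  have h2 : A * ω s t ^ (1 / p) ≤ A * ω 0 S ^ (1 / p) := by gcongr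
  have h3 : 0 ≤ ω 0 S ^ ((2 + γ) / p * γ) := Real.rpow_nonneg (h0.trans hm) _
  linarith

end Vanishing

/-! ### Almost flows, perturbations, and the theorem. -/

section Main

variable {E : Type*} [NormedAddCommGroup E] {T p γ : ℝ} {ω : ℝ → ℝ → ℝ}

theorem continuous_of_norm_sub_le {F : E → E} {c : ℝ}
    (h : ∀ a b, ‖F a - F b‖ ≤ c * ‖a - b‖) : Continuous F := by
  have : LipschitzWith c.toNNReal F := LipschitzWith.of_dist_le_mul fun a b => by
    rw [dist_eq_norm, dist_eq_norm]
    exact (h a b).trans (by gcongr; exact Real.le_coe_toNNReal c)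
  exact this.continuous

/-- The estimates are plainly Lipschitz, so the Hölder term is only a nonnegative addition; the
identity at s = t follows from the first bound because ω vanishes on the diagonal. -/
theorem isAlmostFlow_of_bounds (hω : IsControl T ω) (hT : 0 < T) (hp : 2 ≤ p) (hγ : 0 < γ)
    {A M : ℝ} (hA : 0 ≤ A) (hM : 0 ≤ M) {ζ : ℝ → ℝ → E → E}
    (near : ∀ s t, 0 ≤ s → s ≤ t → t ≤ T → ∀ a, ‖ζ t s a - a‖ ≤ A * ω s t ^ (1 / p))
    (lip : ∀ s t, 0 ≤ s → s ≤ t → t ≤ T → ∀ a b,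
      ‖ζ t s a - ζ t s b‖ ≤ (1 + A * ω s t ^ (1 / p)) * ‖a - b‖)
    (defect : ∀ r s t, 0 ≤ r → r ≤ s → s ≤ t → t ≤ T → ∀ a,
      ‖ζ t s (ζ s r a) - ζ t r a‖ ≤ M * remainderFn p γ (ω r t)) :
    IsAlmostFlow T ω (remainderFn p γ) γ ζ := by
  refine ⟨fun s t hs hst ht => continuous_of_norm_sub_le (lip s t hs hst ht),
    horizonBound T p γ A ω, remainderFn p γ, M, isVanishing_horizonBound hω hT hp hγ hA,
    isModulus_remainderFn hω hp hγ hA, hM, fun S hS hST => ⟨fun t ht0 ht a => ?_,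
    fun s t hs hst ht a => ?_, fun s t hs hst ht a b => ?_, fun r s t hr hrs hst ht a =>
      defect r s t hr hrs hst (ht.trans hST) a⟩⟩
  · have := near t t ht0 le_rfl (ht.trans hST) a
    rw [hω.diag t ht0 (ht.trans hST), Real.zero_rpow (by positivity), mul_zero] at this
    exact sub_eq_zero.1 (norm_le_zero_iff.1 this)
  · exact (near s t hs hst (ht.trans hST) a).trans (le_horizonBound hω hp hA hST hs hst ht)
  · have h1 := le_horizonBound (γ := γ) hω hp hA hST hs hst ht
    have h2 : 0 ≤ remainderFn p γ (ω s t) * ‖b - a‖ ^ γ :=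
      mul_nonneg (remainderFn_nonneg (hω.nonneg s t hs hst (ht.trans hST))) (by positivity)
    have h3 := lip s t hs hst (ht.trans hST) b a
    have h4 : (1 + A * ω s t ^ (1 / p)) * ‖b - a‖ ≤
        (1 + horizonBound T p γ A ω S) * ‖b - a‖ := by gcongr
    linarith

theorem isPerturbation_of_bounds (hω : IsControl T ω) (hT : 0 < T) (hp : 2 ≤ p) (hγ : 0 < γ)
    {A C : ℝ} (hA : 0 ≤ A) (hC : 0 ≤ C) {ε : ℝ → ℝ → E → E}
    (bound : ∀ s t, 0 ≤ s → s ≤ t → t ≤ T → ∀ a, ‖ε t s a‖ ≤ C * remainderFn p γ (ω s t))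
    (lip : ∀ s t, 0 ≤ s → s ≤ t → t ≤ T → ∀ a b,
      ‖ε t s a - ε t s b‖ ≤ A * ω s t ^ (1 / p) * ‖a - b‖) :
    IsPerturbation T ω (remainderFn p γ) γ ε := by
  refine ⟨fun s t hs hst ht => continuous_of_norm_sub_le (lip s t hs hst ht),
    horizonBound T p γ A ω, remainderFn p γ, C, isVanishing_horizonBound hω hT hp hγ hA,
    isModulus_remainderFn hω hp hγ hA, hC, fun S hS hST => ⟨fun t ht0 ht a => ?_,
    fun s t hs hst ht a => bound s t hs hst (ht.trans hST) a, fun s t hs hst ht a b => ?_⟩⟩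
  · have := bound t t ht0 le_rfl (ht.trans hST) a
    rw [hω.diag t ht0 (ht.trans hST), remainderFn, Real.zero_rpow (by positivity),
      mul_zero] at this
    exact norm_le_zero_iff.1 this
  · have h1 := le_horizonBound (γ := γ) hω hp hA hST hs hst ht
    have h2 : 0 ≤ remainderFn p γ (ω s t) * ‖b - a‖ ^ γ :=
      mul_nonneg (remainderFn_nonneg (hω.nonneg s t hs hst (ht.trans hST))) (by positivity)
    have h3 := lip s t hs hst (ht.trans hST) b a
    have h4 : A * ω s t ^ (1 / p) * ‖b - a‖ ≤ horizonBound T p γ A ω S * ‖b - a‖ := by gcongr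
    linarith

/-- The paths of a Lipschitz flow in the galaxy of an almost flow form a Lipschitz manifold. -/
theorem isLipschitzManifold_of_galaxy (hω : IsControl T ω) (hp : 2 ≤ p) (hγ : 0 < γ) {K : ℝ}
    {φ ψ : ℝ → ℝ → E → E}
    (near : ∀ s t, 0 ≤ s → s ≤ t → t ≤ T → ∀ a, ‖φ t s a - a‖ ≤ K * ω s t ^ (1 / p))
    (hψ : IsSemiFlow T ψ) (hL : IsLipschitzFamily T ψ)
    (hg : SameGalaxy T ω (remainderFn p γ) φ ψ) : IsLipschitzManifold T (fun r t => ψ t r) := by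
  obtain ⟨L, hL⟩ := hL
  obtain ⟨C, hC0, hC⟩ := hg.exists_nonneg hω
  refine ⟨fun r hr hrT a => ?_, L, fun r hr hrT a b t ht =>
    hL r ⟨hr, hrT⟩ t ⟨hr.trans ht.1, ht.2⟩ a b⟩
  rw [Metric.continuousOn_iff]
  intro u hu ε hε
  obtain ⟨W₁, hW₁, H₁⟩ := exists_mul_rpow_le K (e := 1 / p) (by positivity)
    (by positivity : 0 < ε / 3)
  obtain ⟨W₂, hW₂, H₂⟩ := exists_mul_rpow_le C (e := (2 + γ) / p) (by positivity)
    (by positivity : 0 < ε / 3)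
  obtain ⟨h, hh, H⟩ := hω.exists_forall_sub_le (lt_min hW₁ hW₂)
  -- By the semi-flow rule an increment of the path is ψ t s minus the identity at ψ s r a. The
  -- galaxy bound and the displacement of φ each make it small.
  have key : ∀ s t, r ≤ s → s ≤ t → t ≤ T → t - s ≤ h → ‖ψ t r a - ψ s r a‖ < ε := by
    intro s t hrs hst ht hd
    have hs := hr.trans hrs
    have h0 := hω.nonneg s t hs hst ht
    have hW := H s t hs hst ht hd
    have q1 := (near s t hs hst ht (ψ s r a)).trans (H₁ _ h0 (hW.trans (min_le_left _ _)))
    have q2 := (hC s t hs hst ht (ψ s r a)).trans (H₂ _ h0 (hW.trans (min_le_right _ _)))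
    rw [hψ.2 r s t hr hrs hst ht] at q2
    have := norm_sub_le_norm_sub_add_norm_sub (ψ t r a) (φ t s (ψ s r a)) (ψ s r a)
    linarith
  refine ⟨h, hh, fun v hv hd => ?_⟩
  rw [Real.dist_eq, abs_lt] at hd
  rw [dist_eq_norm]
  rcases le_total u v with huv | huv
  · exact key u v hu.1 huv hv.2 (by linarith)
  · rw [norm_sub_rev]
    exact key v u hv.1 huv hu.2 (by linarith)

end Main

theorem mainTheorem8 {E : Type*} [NormedAddCommGroup E] [NormedSpace ℝ E] [CompleteSpace E]
    {l : ℕ} (T : ℝ) (hT : 0 < T) (ω : ℝ → ℝ → ℝ) (hω : IsControl T ω)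
    (p γ : ℝ) (hp : 2 ≤ p) (hp3 : p < 3) (hγ0 : 0 < γ) (hγ1 : γ ≤ 1) (hpγ : p < 2 + γ)
    (f : Fin l → E → E) (hf : ∀ i, IsCbHolder 2 γ (f i))
    (x1 : ℝ → ℝ → Fin l → ℝ) (x2 : ℝ → ℝ → Fin l → Fin l → ℝ)
    (hx : IsWeakGeometricRoughPath T ω p x1 x2) :
    -- the ODE is well-posed on `[0, 1]`, so that `χ` is well defined
    (∀ s t, 0 ≤ s → s ≤ t → t ≤ T → ∀ a, ∃ y : ℝ → E,
      IsLogODESolution f x1 x2 s t a y ∧ bailleulAlmostFlow f x1 x2 t s a = y 1 ∧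
      ∀ z : ℝ → E, IsLogODESolution f x1 x2 s t a z → EqOn z y (Icc 0 1)) ∧
    -- `χ` is an almost flow, and a perturbation of Davie's almost flow
    IsAlmostFlow T ω (remainderFn p γ) γ (bailleulAlmostFlow f x1 x2) ∧
    IsAlmostFlow T ω (remainderFn p γ) γ (davieAlmostFlow f x1 x2) ∧
    IsPerturbation T ω (remainderFn p γ) γ
      (fun t s a => bailleulAlmostFlow f x1 x2 t s a - davieAlmostFlow f x1 x2 t s a) ∧
    -- Davie's flow `ψ` exists, `χ^π` converges to it, and it is the Lipschitz manifold of
    -- solutions generated by `χ`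
    ∃ ψ : ℝ → ℝ → E → E,
      IsDavieFlow T ω (remainderFn p γ) f x1 x2 ψ ∧
      IteratedProductsConverge T (bailleulAlmostFlow f x1 x2) ψ ∧
      IsManifoldOfSolutions T ω (remainderFn p γ) (bailleulAlmostFlow f x1 x2)
        (fun r t => ψ t r) ∧
      IsLipschitzManifold T (fun r t => ψ t r) ∧
      ∀ y : ℝ → ℝ → E → E,
        IsManifoldOfSolutions T ω (remainderFn p γ) (bailleulAlmostFlow f x1 x2) y →
        ∀ r t, 0 ≤ r → r ≤ t → t ≤ T → y r t = ψ t r := by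
  obtain ⟨c, hc⟩ := exists_hasRoughBounds hω hγ0 hγ1 hf hx
  obtain ⟨K, hφ⟩ := exists_isSmoothAlmostFlow_davie hω hp hγ0 hγ1 hc hx
  obtain ⟨A, hA, hχ⟩ := hc.bailleul_bounds hω hp
  obtain ⟨C, hC, hχφ⟩ := hc.bailleul_sub_davie_le hω hp hγ0 hγ1 hx
  have hK := hφ.nonneg
  obtain ⟨ψ, hψ, hψL, hψg⟩ := hφ.exists_flow hω hp hγ0 hpγ hT
  obtain ⟨Λ, hΛ⟩ := hψL.exists_isForwardLipschitz
  have hψχ : SameGalaxy T ω (remainderFn p γ) (bailleulAlmostFlow f x1 x2) ψ := by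
    obtain ⟨C', hC'⟩ := hψg
    refine ⟨C + C', fun s t hs hst ht a => ?_⟩
    rw [add_mul]
    exact (norm_sub_le_norm_sub_add_norm_sub _ _ _).trans
      (add_le_add (hχφ s t hs hst ht a) (hC' s t hs hst ht a))
  refine ⟨fun s t hs hst ht a => ?_, ?_, ?_, ?_, ψ, ⟨hψ, hψL, hψg, ?_, ?_⟩, ?_, ?_, ?_, ?_⟩
  · obtain ⟨y, hy, e, huniq⟩ := hc.exists_isODESolution_bailleul hω hp hs hst ht a
    exact ⟨y, (hc.isLogODESolution_iff hs hst ht).2 hy, e,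
      fun z hz => huniq z ((hc.isLogODESolution_iff hs hst ht).1 hz)⟩
  · set χ := bailleulAlmostFlow f x1 x2
    set φ := davieAlmostFlow f x1 x2
    refine isAlmostFlow_of_bounds hω hT hp hγ0 hA
      -- The defect of χ is that of φ, plus the cost of exchanging χ for φ three times; the exchange
      -- inside φ t s is amplified by its Lipschitz constant.
      (M := C + (1 + K * |ω 0 T| ^ (1 / p)) * C + K + C) (by positivity)
      (fun s t hs hst ht => (hχ s t hs hst ht).1)
      (fun s t hs hst ht a b => norm_sub_le_of_norm_sub_sub_sub_le ((hχ s t hs hst ht).2 a b))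
      fun r s t hr hrs hst ht a => ?_
    have hs := hr.trans hrs
    have hrt := hrs.trans hst
    have m1 : remainderFn p γ (ω s t) ≤ remainderFn p γ (ω r t) :=
      remainderFn_mono hp hγ0 (hω.nonneg s t hs hst ht) (hω.mono hr hrs hst le_rfl ht)
    have m2 : remainderFn p γ (ω r s) ≤ remainderFn p γ (ω r t) :=
      remainderFn_mono hp hγ0 (hω.nonneg r s hr hrs (hst.trans ht)) (hω.mono hr le_rfl hrs hst ht)
    have h0 := hω.nonneg s t hs hst ht
    have e1 : ‖χ t s (χ s r a) - φ t s (χ s r a)‖ ≤ C * remainderFn p γ (ω r t) :=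
      (hχφ s t hs hst ht _).trans (by gcongr)
    have e2 : ‖φ t s (χ s r a) - φ t s (φ s r a)‖ ≤
        (1 + K * |ω 0 T| ^ (1 / p)) * (C * remainderFn p γ (ω r t)) := by
      refine (hφ.lipschitz hs hst ht _ _).trans ?_
      have hle := (hω.mono le_rfl hs hst ht le_rfl).trans (le_abs_self _)
      gcongr
      exact (hχφ r s hr hrs (hst.trans ht) a).trans (by gcongr)
    have e3 := hφ.defect_le r s t hr hrs hst ht a
    have e4 := hχφ r t hr hrt ht a
    rw [norm_sub_rev] at e4
    have dec : χ t s (χ s r a) - χ t r a = (χ t s (χ s r a) - φ t s (χ s r a)) +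
        (φ t s (χ s r a) - φ t s (φ s r a)) + (φ t s (φ s r a) - φ t r a) +
        (φ t r a - χ t r a) := by abel
    rw [dec]
    exact (norm_add_le_of_le (norm_add_le_of_le (norm_add_le_of_le e1 e2) e3) e4).trans_eq (by ring)
  · exact isAlmostFlow_of_bounds hω hT hp hγ0 hK hK hφ.norm_sub_le
      (fun s t hs hst ht => hφ.lipschitz hs hst ht) hφ.defect_le
  · refine isPerturbation_of_bounds hω hT hp hγ0 (A := A + K) (by positivity) hC hχφ
      fun s t hs hst ht a b => ?_
    have e1 := (hχ s t hs hst ht).2 a b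
    have e2 := norm_sub_sub_sub_le_of_fderiv (hφ.differentiable s t hs hst ht)
      (hφ.fderiv_sub_le s t hs hst ht) a b
    -- χ - φ is written as (χ - id) - (φ - id), and both parts have a small Lipschitz constant.
    rw [sub_sub_sub_comm, ← sub_sub_sub_cancel_right _ _ (a - b), add_mul, add_mul]
    exact (norm_sub_le _ _).trans (add_le_add e1 e2)
  · exact fun ψ' hψ' hg s t hs hst ht =>
      hψ.1.unique hω hp hpγ hT hΛ hψg hψ' hg hs hst ht
  · exact iteratedProductsConverge hω hp hpγ hψ.1 hΛ hψg
  · exact iteratedProductsConverge hω hp hpγ hψ.1 hΛ hψχ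
  · exact hψ.1.isManifoldOfSolutions hω hψχ
  · exact isLipschitzManifold_of_galaxy hω hp hγ0 hφ.norm_sub_le hψ.1 hψL hψg
  · exact fun y hy r t hr hrt ht => hy.eq_semiFlow hω hp hpγ hT hψ.1 hΛ hψχ hr hrt ht
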